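/- **Setting.** $N$ users have weights $\mu_1\ge\mu_2\ge\dots\ge\mu_N>0$ with $\sum_n\mu_n=1$; put $\mu_{N+1}=0$. Let $0<\eta<1$, $N_0>0$, $\varepsilon>1$, $\eta'=\eta N_0/\varepsilon$, $P_{\max}>0$, and let $x_n(i)>0$ be the noise-normalized power gain of user $n$ in slot $i$. In slot $i$ one chooses a scheduling variable $a_i$ ($1$: downlink, $0$: uplink), the base-station power $P_0(i)$ and the user powers $P_{d,n}(i)\ge 0$. The problem, in the limit $M\to\infty$ and given $P_{avg}>0$, is $$\text{maximize } \frac1M\sum_{i=1}^M\sum_{n=1}^N\mu_n(1-a_i)\log_2\Big(1+\frac{P_{d,n}(i)x_n(i)}{1+\sum_{k<n}P_{d,k}(i)x_k(i)}\Big)$$ subject to - $\overline{C1}$: $\frac1M\sum_{i}(1-a_i)P_{d,n}(i)-\frac1M\sum_{i}\eta' a_iP_0(i)x_n(i)\to0$ for every $n$; - $C3$: $\limsup_M\frac1M\sum_{i} a_iP_0(i)\le P_{avg}$; - $C4$: $0\le P_0(i)\le P_{\max}$; - $C5$: $a_i\in\{0,1\}$. An allocation is *optimal* if it is feasible and, for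 every feasible allocation (also noncausal) and every $\delta>0$, for all large $M$ its average weighted rate is at least that of the other allocation minus $\delta$. **The rules.** Let $\lambda_1,\dots,\lambda_N>0$ and $\lambda_0\ge0$. For $S=\{n_1<\dots<n_l\}\subseteq\{1,\dots,N\}$ and $x\in(0,\infty)^N$ put $P_s^S(x)=0$ for $s\notin S$, and for $1\le m\le l$ $$P^S_{n_m}(x)=\frac{(\mu_{n_m}-\mu_{n_{m+1}})/\ln 2}{\lambda_{n_m}-\lambda_{n_{m+1}}x_{n_m}/x_{n_{m+1}}}-\frac{(\mu_{n_{m-1}}-\mu_{n_m})/\ln 2}{-\lambda_{n_m}+\lambda_{n_{m-1}}x_{n_m}/x_{n_{m-1}}},$$ where for $m=l$ the first term is $\mu_{n_l}/(\lambda_{n_l}\ln2)$ and for $m=1$ the second term is $1/x_{n_1}$. (In this formula a quotient with denominator $0$ is read as $0$.) The activity region $\mathcal R_S$ is the set of $x\in(0,\infty)^N$ such that $P^S_n(x)>0$ for $n\in S$ and $$\frac{x_s}{\ln2}\sum_{m\ge s}\frac{\mu_m-\mu_{m+1}}{1+\sum_{k\le m}P^S_k(x)x_k}\le\lambda_s\qquad(s\notin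 S),$$ i.e. no silent user has a marginal weighted rate above its price. An allocation *follows the rules* with multipliers $\lambda_0,\dots,\lambda_N$ if in every slot, for some $S$ with $x(i)\in\mathcal R_S$ and with $P_n^*(i)=P_n^S(x(i))$: 1. $a_i^*=0$ if $$\sum_{n}(\mu_n-\mu_{n+1})\log_2\Big(1+\sum_{k\le n}P_k^*(i)x_k(i)\Big)-\sum_n\lambda_nP_n^*(i)\ \ge\ \hat P_0(i)\Big(\eta'\sum_n\lambda_nx_n(i)-\lambda_0\Big),$$ and $a_i^*=1$ otherwise, where $\hat P_0(i)=P_{\max}$ if $\sum_n\lambda_nx_n(i)\ge\lambda_0/\eta'$ and $\hat P_0(i)=0$ otherwise; 2. $P_0^*(i)=P_{\max}$ if $\sum_n\lambda_nx_n(i)\ge\lambda_0/\eta'$ and $a_i^*=1$, and $P_0^*(i)=0$ otherwise; 3. $P_{d,n}^*(i)=(1-a_i^*)P_n^*(i)$ for all $n$. **Theorem.** (i) For all $\lambda_1,\dots,\lambda_N>0$ the $2^N$ regions $\mathcal R_S$ cover $(0,\infty)^N$, and $x$ lies in exactly one of them unless $\mu_m=\mu_n$ and $\lambda_m/x_m=\lambda_n/x_n$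 for some $m\ne n$. (ii) Let $P_{avg}>0$. On every sequence of positive gain vectors, an allocation that follows the rules with multipliers $\lambda_1,\dots,\lambda_N>0$, $\lambda_0\ge0$, is feasible, and satisfies $C3$ with equality ($\frac1M\sum_ia_i^*P_0^*(i)\to P_{avg}$) or has $\lambda_0=0$, is optimal. (iii) Let the gain vectors $x(i)$ form a stationary ergodic process that is almost surely positive, with $E[x_n(0)]<\infty$ for every $n$, and such that the law of $x(0)$ is absolutely continuous with respect to a product of atomless $\sigma$-finite measures on $\mathbb R$ (e.g. it has a density, or the $N$ gains are independent with continuous distributions). Then there is $P_{crit}\in(0,P_{\max})$ such that for every $P_{avg}>0$ there are multipliers $\lambda_1,\dots,\lambda_N>0$, $\lambda_0\ge0$, with $\lambda_0=0$ if $P_{avg}>P_{crit}$, and numbers $V,b_1,\dots,b_N$, with the following properties. Almost surely, every $x(i)$ lies in exactly one region, and exactly one allocation follows the rules; it satisfies $\frac1M\sum_i(1-a_i^*)P^*_{d,n}(i)\to b_n$ and $\frac1M\sum_i\eta'a_i^*P_0^*(i)x_n(i)\to b_n$ for every $n$, and $\frac1M\sum_ia_i^*P_0^*(i)\to\min(P_{avg},P_{crit})$;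 so $C3$ holds with equality whenever $P_{avg}\le P_{crit}$. Its average weighted rate converges to $V$, and it is optimal. The duality gap is zero: for $\lambda\in\mathbb R^N$, $\lambda_0\ge0$ let $$g(\lambda,\lambda_0)=\lambda_0P_{avg}+E\Big[\sup_{a,p_0,p}\Big\{\sum_n\mu_n(1-a)\log_2\Big(1+\frac{p_nx_n}{1+\sum_{k<n}p_kx_k}\Big)-\sum_n\lambda_n\big((1-a)p_n-\eta'ap_0x_n\big)-\lambda_0ap_0\Big\}\Big]\in[0,\infty],$$ with $x=x(0)$ and the supremum over $a\in\{0,1\}$, $0\le p_0\le P_{\max}$, $p\in[0,\infty)^N$. Then $V$ is the minimum of $g$ over $\mathbb R^N\times[0,\infty)$, and it is attained at the multipliers above. -/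

import Mathlib

open Filter Topology MeasureTheory

noncomputable section

namespace WPT

/-- The normalised power conversion coefficient `η' = η N₀ / ε`. -/
def etaPrime (η N₀ ε : ℝ) : ℝ := η * N₀ / ε

/-- `μ_{n+1}`, with the convention that the weight after the last user is `0`. -/
def nextWeight {N : ℕ} (μ : Fin N → ℝ) (n : Fin N) : ℝ :=
  if h : n.val + 1 < N then μ ⟨n.val + 1, h⟩ else 0

/-- The rate (in bits per symbol) of user `n` in a slot with scheduling variable `a`, user powers `P`
and gains `x`: users `k < n` are the interferers that are decoded after user `n`. -/
def slotRate {N : ℕ} (x : Fin N → ℝ) (a : ℝ) (P : Fin N → ℝ) (n : Fin N) : ℝ :=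
  (1 - a) * Real.logb 2 (1 + P n * x n / (1 + ∑ k ∈ Finset.univ.filter (· < n), P k * x k))

/-- The weighted sum rate of a slot. -/
def slotObjective {N : ℕ} (μ x : Fin N → ℝ) (a : ℝ) (P : Fin N → ℝ) : ℝ :=
  ∑ n, μ n * slotRate x a P n

/-- `1 + ∑_{k ≤ n} P_k x_k`. -/
def level {N : ℕ} (x P : Fin N → ℝ) (n : Fin N) : ℝ :=
  1 + ∑ k ∈ Finset.univ.filter (· ≤ n), P k * x k

/-- The average of the first `M` terms of a sequence. -/
def avg (f : ℕ → ℝ) (M : ℕ) : ℝ := (∑ i ∈ Finset.range M, f i) / M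

/-- The decision variables of the time-division problem, slot by slot: the scheduling variable, the
base-station power and the desired powers of the users. -/
structure Alloc (N : ℕ) where
  a : ℕ → ℝ
  P0 : ℕ → ℝ
  Pd : ℕ → Fin N → ℝ

/-- Feasibility on a fading path `x` in the limit of infinitely many slots: binary scheduling, the
peak power constraint, nonnegative user powers, the average energy balance of every user, and the
average power constraint of the base station. An allocation may depend on the whole path, so that
noncausal allocations are included. -/
def IsFeasible {N : ℕ} (η' Pmax Pavg : ℝ) (x : ℕ → Fin N → ℝ) (A : Alloc N) : Prop :=
  (∀ i, A.a i = 0 ∨ A.a i = 1) ∧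
  (∀ i, 0 ≤ A.P0 i ∧ A.P0 i ≤ Pmax) ∧
  (∀ i n, 0 ≤ A.Pd i n) ∧
  (∀ n, Tendsto (fun M => avg (fun i => (1 - A.a i) * A.Pd i n) M
      - avg (fun i => η' * A.a i * A.P0 i * x i n) M) atTop (𝓝 0)) ∧
  (∀ δ > 0, ∀ᶠ M in atTop, avg (fun i => A.a i * A.P0 i) M ≤ Pavg + δ)

/-- The average weighted rate over the first `M` slots. -/
def avgObjective {N : ℕ} (μ : Fin N → ℝ) (x : ℕ → Fin N → ℝ) (A : Alloc N) (M : ℕ) : ℝ :=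
  avg (fun i => slotObjective μ (x i) (A.a i) (A.Pd i)) M

/-- `A` solves the problem on the path `x`: it is feasible, and no feasible allocation has a larger
average weighted rate in the limit of infinitely many slots. -/
def IsOptimal {N : ℕ} (μ : Fin N → ℝ) (η' Pmax Pavg : ℝ) (x : ℕ → Fin N → ℝ) (A : Alloc N) : Prop :=
  IsFeasible η' Pmax Pavg x A ∧
  ∀ A' : Alloc N, IsFeasible η' Pmax Pavg x A' →
    ∀ δ > 0, ∀ᶠ M in atTop, avgObjective μ x A' M ≤ avgObjective μ x A M + δ

/-- First term of the power formula for the active user `n` of the active set `S`; it involves the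
next active user, if there is one. -/
def upperTerm {N : ℕ} (μ lam : Fin N → ℝ) (S : Finset (Fin N)) (x : Fin N → ℝ) (n : Fin N) : ℝ :=
  if h : (S.filter (n < ·)).Nonempty then
    let k := (S.filter (n < ·)).min' h
    ((μ n - μ k) / Real.log 2) / (lam n - lam k * x n / x k)
  else (μ n / Real.log 2) / lam n

/-- Second term of the power formula for the active user `n` of the active set `S`; it involves the
previous active user, if there is one. -/
def lowerTerm {N : ℕ} (μ lam : Fin N → ℝ) (S : Finset (Fin N)) (x : Fin N → ℝ) (n : Fin N) : ℝ :=
  if h : (S.filter (· < n)).Nonempty then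
    let k := (S.filter (· < n)).max' h
    ((μ k - μ n) / Real.log 2) / (-lam n + lam k * x n / x k)
  else 1 / x n

/-- The powers of the users when exactly the users in `S` are active. -/
def activePower {N : ℕ} (μ lam : Fin N → ℝ) (S : Finset (Fin N)) (x : Fin N → ℝ) (n : Fin N) : ℝ :=
  if n ∈ S then upperTerm μ lam S x n - lowerTerm μ lam S x n else 0

/-- The marginal weighted rate of user `n`, that is the partial derivative with respect to `P n` of
`∑ m, (μ m - μ (m+1)) * log₂ (1 + ∑ k ≤ m, P k * x k)`. -/
def marginalRate {N : ℕ} (μ x P : Fin N → ℝ) (n : Fin N) : ℝ :=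
  x n / Real.log 2 * ∑ m ∈ Finset.univ.filter (n ≤ ·), (μ m - nextWeight μ m) / level x P m

/-- The activity region of `S`: the gain vectors at which the power formula gives positive powers to
all users of `S`, while no silent user has a marginal rate above its price. -/
def region {N : ℕ} (μ lam : Fin N → ℝ) (S : Finset (Fin N)) : Set (Fin N → ℝ) :=
  {x | (∀ n, 0 < x n) ∧ (∀ n ∈ S, 0 < activePower μ lam S x n) ∧
    ∀ n ∉ S, marginalRate μ x (activePower μ lam S x) n ≤ lam n}

/-- Left-hand side of the selection inequality. -/
def uplinkGain {N : ℕ} (μ lam x P : Fin N → ℝ) : ℝ :=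
  ∑ n, (μ n - nextWeight μ n) * Real.logb 2 (level x P n) - ∑ n, lam n * P n

open Classical in
/-- The power with which the base station transmits in a slot of scheduling value `a`. -/
def bsPower {N : ℕ} (η' Pmax : ℝ) (lam : Fin N → ℝ) (lam0 : ℝ) (x : Fin N → ℝ) (a : ℝ) : ℝ :=
  if lam0 / η' ≤ ∑ n, lam n * x n ∧ a = 1 then Pmax else 0

open Classical in
/-- The selection rule, with the candidate user powers `P` for `a = 0` and the candidate
base-station power for `a = 1`. -/
def selection {N : ℕ} (μ : Fin N → ℝ) (η' Pmax : ℝ) (lam : Fin N → ℝ) (lam0 : ℝ)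
    (x P : Fin N → ℝ) : ℝ :=
  if bsPower η' Pmax lam lam0 x 1 * (η' * ∑ n, lam n * x n - lam0) ≤ uplinkGain μ lam x P
  then 0 else 1

/-- In every slot the allocation `A` obeys the threshold rules with multipliers `lam`, `lam0`. -/
def FollowsRule {N : ℕ} (μ : Fin N → ℝ) (η' Pmax : ℝ) (lam : Fin N → ℝ) (lam0 : ℝ)
    (x : ℕ → Fin N → ℝ) (A : Alloc N) : Prop :=
  ∀ i, ∃ S : Finset (Fin N), x i ∈ region μ lam S ∧
    A.a i = selection μ η' Pmax lam lam0 (x i) (activePower μ lam S (x i)) ∧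
    A.P0 i = bsPower η' Pmax lam lam0 (x i) (A.a i) ∧
    ∀ n, A.Pd i n = (1 - A.a i) * activePower μ lam S (x i) n

/-- Decisions that are admissible in a single slot. -/
def SlotActions (N : ℕ) (Pmax : ℝ) : Set (ℝ × ℝ × (Fin N → ℝ)) :=
  {u | (u.1 = 0 ∨ u.1 = 1) ∧ (0 ≤ u.2.1 ∧ u.2.1 ≤ Pmax) ∧ ∀ n, 0 ≤ u.2.2 n}

/-- The contribution of one slot to the Lagrangian, without the constant `lam0 * Pavg`. -/
def slotLagrangian {N : ℕ} (μ : Fin N → ℝ) (η' : ℝ) (lam : Fin N → ℝ) (lam0 : ℝ) (x : Fin N → ℝ)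
    (u : ℝ × ℝ × (Fin N → ℝ)) : ℝ :=
  slotObjective μ x u.1 u.2.2
    - ∑ n, lam n * ((1 - u.1) * u.2.2 n - η' * u.1 * u.2.1 * x n)
    - lam0 * (u.1 * u.2.1)

/-- The Lagrange dual function for gains of law `ν`, with values in `[0, ∞]`. Truncating the
Lagrangian at `0` changes nothing, because transmitting nothing contributes the value `0`. -/
def dualValue {N : ℕ} (μ : Fin N → ℝ) (η' Pmax Pavg : ℝ) (ν : Measure (Fin N → ℝ))
    (lam : Fin N → ℝ) (lam0 : ℝ) : ENNReal :=
  (∫⁻ x, ⨆ u ∈ SlotActions N Pmax, ENNReal.ofReal (slotLagrangian μ η' lam lam0 x u) ∂ν)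
    + ENNReal.ofReal (lam0 * Pavg)

/-- A stationary and ergodic fading process: the shift on the path space is ergodic (in particular
measure preserving) for the law of the process. -/
def IsStationaryErgodic {N : ℕ} {Ω : Type*} [MeasurableSpace Ω] (ℙ : Measure Ω)
    (x : ℕ → Ω → Fin N → ℝ) : Prop :=
  (∀ i, Measurable (x i)) ∧
  Ergodic (fun (s : ℕ → Fin N → ℝ) (i : ℕ) => s (i + 1)) (ℙ.map (fun ω i => x i ω))

/-- A law on `ℝ^N` that has a density with respect to a product of atomless σ-finite measures, for
example a law with a Lebesgue density or a product of continuous distributions. -/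
def IsContinuousLaw {N : ℕ} (ν : Measure (Fin N → ℝ)) : Prop :=
  ∃ ρ : Fin N → Measure ℝ, (∀ n, SigmaFinite (ρ n)) ∧ (∀ n t, ρ n {t} = 0) ∧ ν ≪ Measure.pi ρ

end WPT

end

/-! Put a price `lam n` on the energy balance of user `n` and a price `lam0` on the average
base-station power. The Lagrangian then separates into slots, and in a slot it is the maximum of two
problems: a downlink slot, linear in the base-station power, and an uplink slot, whose value after
summation by parts is the concave function `∑ (μ_n - μ_{n+1}) log₂ level_n - ∑ λ_n P_n`.

For the concave problem the Karush-Kuhn-Tucker conditions are necessary and sufficient. In the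
region of `S` the power formula solves the stationarity equations for active set `S`
(`isKKT_activePower`), so the regions sort gain vectors by the active set of a maximiser. A
maximiser exists by compactness, and power can be moved between active users of equal weight until
all active weights differ (`IsKKT.merge`), whence the covering. Strict concavity fixes the levels at
which the weights drop. Two different maximisers would therefore need users of equal weight and
equal ratio `lam n / x n` (`IsKKT.unique`).

On a single path, the rules maximise the Lagrangian slot by slot against every admissible action.
After averaging, the price terms vanish in the limit by energy balance and by complementary
slackness of the power constraint (`isOptimal_of_followsRule`).

For ergodic fading the multipliers come from minimising the expected slot value plus `lam0 * Pavg`.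
This function blows up as a price tends to `0` or to infinity, so it has a minimiser with positive
prices (`exists_dualMean_min`). It is differentiable there, because for almost every gain vector the
optimal powers are unique and the two modes do not interfere. Its derivatives are harvested minus
spent energy and `Pavg` minus the mean base-station power, so stationarity is the balance of the
constraints (`exists_multipliers`). The critical power is the mean power at a minimiser with `lam0 =
0`. Expectations become time averages by Birkhoff's theorem, and energy balance makes the mean
Lagrangian of the rules independent of the prices of the users, which closes the duality gap.

The delicate null set is `modeTie`. By the envelope inequality, a slice of it in direction `n` can
be accumulated from both sides only where `P_n = Pmax * η' * x_n`. If this holds for all `n`, then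
the gain of the last user solves a quadratic equation. Hence `modeTie` is covered by finitely many
sets, each with countable slices in some direction. -/

noncomputable section

namespace WPT

/-! ### The pointwise ergodic theorem. -/

section Birkhoff

variable {α : Type*}

/-- The maximum of `0` and the first `n` Birkhoff sums. -/
def birkhoffMax (T : α → α) (f : α → ℝ) : ℕ → α → ℝ
  | 0, _ => 0
  | n + 1, x => max 0 (f x + birkhoffMax T f n (T x))

lemma birkhoffMax_nonneg (T : α → α) (f : α → ℝ) (n : ℕ) (x : α) : 0 ≤ birkhoffMax T f n x := by
  cases n with
  | zero => exact le_rfl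
  | succ n => exact le_max_left _ _

lemma birkhoffMax_le_succ (T : α → α) (f : α → ℝ) (n : ℕ) (x : α) :
    birkhoffMax T f n x ≤ birkhoffMax T f (n + 1) x := by
  induction n generalizing x with
  | zero => exact le_max_left _ _
  | succ n ih => exact max_le_max le_rfl (by linarith [ih (T x)])

lemma birkhoffSum_le_birkhoffMax (T : α → α) (f : α → ℝ) (n : ℕ) (x : α) :
    birkhoffSum T f n x ≤ birkhoffMax T f n x := by
  induction n generalizing x with
  | zero => simp [birkhoffMax]
  | succ n ih =>
    rw [birkhoffSum_succ']
    exact le_trans (by linarith [ih (T x)]) (le_max_right _ _)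

variable [MeasurableSpace α] {m : Measure α}

lemma measurable_birkhoffMax {T : α → α} (hT : Measurable T) {f : α → ℝ} (hf : Measurable f)
    (n : ℕ) : Measurable (birkhoffMax T f n) := by
  induction n with
  | zero => exact measurable_const
  | succ n ih => exact measurable_const.max (hf.add (ih.comp hT))

lemma integrable_birkhoffMax {T : α → α} (hT : MeasurePreserving T m m) {f : α → ℝ}
    (hf : Integrable f m) (n : ℕ) : Integrable (birkhoffMax T f n) m := by
  induction n with
  | zero => exact integrable_zero _ _ _
  | succ n ih =>
    exact (integrable_zero _ _ _).sup (hf.add (hT.integrable_comp_of_integrable ih))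

/-- For an ergodic transformation and an integrand of negative mean the Birkhoff sums are almost
everywhere bounded above. -/
lemma ae_exists_birkhoffSum_le [IsProbabilityMeasure m] {T : α → α} (hT : Ergodic T m) {f : α → ℝ}
    (hfm : Measurable f) (hf : Integrable f m) (hneg : ∫ x, f x ∂m < 0) :
    ∀ᵐ x ∂m, ∃ C : ℝ, ∀ n, birkhoffSum T f n x ≤ C := by
  have hTm := hT.toMeasurePreserving
  -- `A` is the set where the maximal sums are unbounded. The recursion shows that passing from `x`
  -- to `T x` changes them by a bounded amount, so `A` is invariant and has measure `0` or `1`.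
  set A : Set α := {x | ∀ C : ℕ, ∃ n, (C : ℝ) < birkhoffMax T f n x} with hA
  have hAm : MeasurableSet A := by
    rw [hA, Set.ofPred_forall]
    refine MeasurableSet.iInter fun C => ?_
    rw [Set.ofPred_exists]
    exact MeasurableSet.iUnion fun n =>
      measurableSet_lt measurable_const (measurable_birkhoffMax hTm.measurable hfm n)
  have hinv : T ⁻¹' A = A := by
    ext x
    constructor
    · intro hx C
      obtain ⟨k, hk⟩ := exists_nat_ge (-f x)
      obtain ⟨n, hn⟩ := hx (C + k)
      refine ⟨n + 1, lt_of_lt_of_le ?_ (le_max_right _ _)⟩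
      push_cast at hn
      linarith
    · intro hx C
      obtain ⟨k, hk⟩ := exists_nat_ge (f x)
      obtain ⟨n, hn⟩ := hx (C + k)
      push_cast at hn
      cases n with
      | zero =>
        simp only [birkhoffMax] at hn
        have h1 : (0 : ℝ) ≤ C := Nat.cast_nonneg C
        have h2 : (0 : ℝ) ≤ k := Nat.cast_nonneg k
        linarith
      | succ n =>
        refine ⟨n, ?_⟩
        simp only [birkhoffMax] at hn
        rcases lt_max_iff.1 hn with h | h
        · have h1 : (0 : ℝ) ≤ C := Nat.cast_nonneg C
          have h2 : (0 : ℝ) ≤ k := Nat.cast_nonneg k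
          linarith
        · linarith
  rcases hT.toPreErgodic.prob_eq_zero_or_one hAm hinv with h0 | h1
  · have : ∀ᵐ x ∂m, x ∉ A := measure_eq_zero_iff_ae_notMem.1 h0
    filter_upwards [this] with x hx
    simp only [hA, Set.mem_ofPred_eq, not_forall, not_exists, not_lt] at hx
    obtain ⟨C, hC⟩ := hx
    exact ⟨C, fun n => (birkhoffSum_le_birkhoffMax T f n x).trans (hC n)⟩
  · exfalso
    have hae : ∀ᵐ x ∂m, x ∈ A := by
      have := (prob_compl_eq_zero_iff hAm).2 h1
      exact measure_eq_zero_iff_ae_notMem.1 this |>.mono fun x hx => not_not.1 hx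
    -- If `A` had full measure, `D n` would tend to `f` almost everywhere, dominated by `|f|`. Since
    -- `D n` is `M_{n+1} - M_n ∘ T` and `T` preserves the measure, its integral is that of `M_{n+1}
    -- - M_n ≥ 0`. The limit contradicts the negative mean of `f`.
    let D : ℕ → α → ℝ := fun n x => max (-birkhoffMax T f n (T x)) (f x)
    have hD : ∀ n x, D n x = birkhoffMax T f (n + 1) x - birkhoffMax T f n (T x) := by
      intro n x
      simp only [D, birkhoffMax]
      rw [← max_sub_sub_right]
      congr 1 <;> ring
    have hDint : ∀ n, 0 ≤ ∫ x, D n x ∂m := by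
      intro n
      have h1 := integrable_birkhoffMax hTm hf (n + 1)
      have h2 := integrable_birkhoffMax hTm hf n
      have h3 : ∫ x, birkhoffMax T f n (T x) ∂m = ∫ x, birkhoffMax T f n x ∂m := by
        rw [← integral_map (μ := m) hTm.aemeasurable, hTm.map_eq]
        rw [hTm.map_eq]
        exact h2.aestronglyMeasurable
      simp_rw [hD]
      have h4 : Integrable (fun x => birkhoffMax T f n (T x)) m := hTm.integrable_comp_of_integrable h2
      rw [integral_sub h1 h4, h3, sub_nonneg]
      exact integral_mono h2 h1 fun x => birkhoffMax_le_succ T f n x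
    have hlim : Tendsto (fun n => ∫ x, D n x ∂m) atTop (𝓝 (∫ x, f x ∂m)) := by
      refine tendsto_integral_of_dominated_convergence (fun x => |f x|) ?_ hf.abs ?_ ?_
      · intro n
        exact (((measurable_birkhoffMax hTm.measurable hfm n).comp hTm.measurable).neg.max
          hfm).aestronglyMeasurable
      · intro n
        refine Eventually.of_forall fun x => ?_
        have := birkhoffMax_nonneg T f n (T x)
        rw [Real.norm_eq_abs, abs_le]
        exact ⟨(neg_abs_le _).trans (le_max_right _ _),
          max_le (by linarith [abs_nonneg (f x)]) (le_abs_self _)⟩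
      · filter_upwards [hae] with x hx
        rw [← hinv] at hx
        obtain ⟨k, hk⟩ := exists_nat_ge (-f x)
        obtain ⟨n, hn⟩ := hx k
        refine tendsto_const_nhds.congr' ?_
        filter_upwards [eventually_ge_atTop n] with j hj
        have hmono : Monotone fun j => birkhoffMax T f j (T x) :=
          monotone_nat_of_le_succ fun j => birkhoffMax_le_succ T f j (T x)
        have := hmono hj
        simp only [D]
        rw [max_eq_right]
        simp only at this
        linarith
    exact absurd (ge_of_tendsto' hlim hDint) (not_le.2 hneg)

/-- Subtracting `∫ f + ε / 2` makes the mean negative. The shifted sums are then bounded above, and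
the bound divided by `n` eventually falls below `ε / 2`. -/
lemma ae_eventually_birkhoffSum_le [IsProbabilityMeasure m] {T : α → α} (hT : Ergodic T m)
    {f : α → ℝ} (hfm : Measurable f) (hf : Integrable f m) {ε : ℝ} (hε : 0 < ε) :
    ∀ᵐ x ∂m, ∀ᶠ n : ℕ in atTop, birkhoffSum T f n x / n ≤ ∫ x, f x ∂m + ε := by
  set c : ℝ := ∫ x, f x ∂m + ε / 2
  have hneg : ∫ x, (f x - c) ∂m < 0 := by
    rw [integral_sub hf (integrable_const _)]
    simp [c]
    linarith
  filter_upwards [ae_exists_birkhoffSum_le hT (hfm.sub_const c) (hf.sub (integrable_const c)) hneg]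
    with x ⟨C, hC⟩
  have hev : ∀ᶠ n : ℕ in atTop, C / (n : ℝ) < ε / 2 :=
    (tendsto_const_div_atTop_nhds_zero_nat C).eventually_lt_const (by linarith)
  filter_upwards [hev, eventually_gt_atTop 0] with n hn h0
  have h0' : (0 : ℝ) < n := by exact_mod_cast h0
  have h1 := hC n
  have h2 : birkhoffSum T (fun x => f x - c) n x = birkhoffSum T f n x - n * c := by
    simp [birkhoffSum, Finset.sum_sub_distrib]
  rw [h2] at h1
  rw [div_lt_iff₀ h0'] at hn
  rw [div_le_iff₀ h0']
  have : ∫ x, f x ∂m + ε = c + ε / 2 := by simp [c]; ring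
  rw [this]
  nlinarith

/-- **Birkhoff's pointwise ergodic theorem** for ergodic transformations. -/
theorem ae_tendsto_birkhoffSum_div [IsProbabilityMeasure m] {T : α → α} (hT : Ergodic T m)
    {f : α → ℝ} (hfm : Measurable f) (hf : Integrable f m) :
    ∀ᵐ x ∂m, Tendsto (fun n : ℕ => birkhoffSum T f n x / n) atTop (𝓝 (∫ x, f x ∂m)) := by
  -- Only the countably many tolerances `1 / (k + 1)` are used, so that one null set suffices. The
  -- lower bound is the upper bound for `-f`.
  have h1 : ∀ᵐ x ∂m, ∀ k : ℕ, ∀ᶠ n : ℕ in atTop,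
      birkhoffSum T f n x / n ≤ ∫ x, f x ∂m + 1 / ((k : ℝ) + 1) :=
    ae_all_iff.2 fun k => ae_eventually_birkhoffSum_le hT hfm hf (by positivity)
  have h2 : ∀ᵐ x ∂m, ∀ k : ℕ, ∀ᶠ n : ℕ in atTop,
      birkhoffSum T (-f) n x / n ≤ ∫ x, (-f) x ∂m + 1 / ((k : ℝ) + 1) :=
    ae_all_iff.2 fun k => ae_eventually_birkhoffSum_le hT hfm.neg hf.neg (by positivity)
  filter_upwards [h1, h2] with x hx1 hx2
  rw [Metric.tendsto_atTop']
  intro ε hε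
  obtain ⟨k, hk⟩ := exists_nat_one_div_lt hε
  have := (hx1 k).and (hx2 k)
  obtain ⟨n, hn⟩ := eventually_atTop.1 this
  refine ⟨n, fun j hj => ?_⟩
  obtain ⟨ha, hb⟩ := hn j hj.le
  rw [birkhoffSum_neg, integral_neg', neg_div] at hb
  rw [Real.dist_eq, abs_lt]
  constructor <;> linarith

/-- The pointwise ergodic theorem for a function of the present state of a stationary ergodic
process. -/
theorem IsStationaryErgodic.ae_tendsto_avg {N : ℕ} {Ω : Type*} [MeasurableSpace Ω] {ℙ : Measure Ω}
    [IsProbabilityMeasure ℙ] {x : ℕ → Ω → Fin N → ℝ} (hx : IsStationaryErgodic ℙ x)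
    {f : (Fin N → ℝ) → ℝ} (hfm : Measurable f) (hf : Integrable f (ℙ.map (x 0))) :
    ∀ᵐ ω ∂ℙ, Tendsto (avg fun i => f (x i ω)) atTop (𝓝 (∫ y, f y ∂(ℙ.map (x 0)))) := by
  obtain ⟨hxm, herg⟩ := hx
  have hX : Measurable fun ω i => x i ω := measurable_pi_iff.2 hxm
  have hprob : IsProbabilityMeasure (ℙ.map fun ω i => x i ω) :=
    Measure.isProbabilityMeasure_map hX.aemeasurable
  have hmap : (ℙ.map fun ω i => x i ω).map (fun s => s 0) = ℙ.map (x 0) := by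
    rw [Measure.map_map (measurable_pi_apply 0) hX]; rfl
  have hint : Integrable (fun s : ℕ → Fin N → ℝ => f (s 0)) (ℙ.map fun ω i => x i ω) := by
    rw [← hmap] at hf
    exact hf.comp_measurable (measurable_pi_apply 0)
  have h := ae_tendsto_birkhoffSum_div herg (hfm.comp (measurable_pi_apply 0)) hint
  have h2 := ae_of_ae_map hX.aemeasurable h
  have heq : ∫ s, f (s 0) ∂(ℙ.map fun ω i => x i ω) = ∫ y, f y ∂(ℙ.map (x 0)) := by
    rw [← hmap, integral_map (measurable_pi_apply 0).aemeasurable hfm.aestronglyMeasurable]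
  filter_upwards [h2] with ω hω
  have hiter : ∀ (k : ℕ) (s : ℕ → Fin N → ℝ) (i : ℕ),
      ((fun (s : ℕ → Fin N → ℝ) (i : ℕ) => s (i + 1))^[k] s) i = s (i + k) := by
    intro k
    induction k with
    | zero => intro s i; rfl
    | succ k ih => intro s i; rw [Function.iterate_succ_apply, ih, add_assoc]
  rw [← heq]
  refine hω.congr fun n => ?_
  simp [birkhoffSum, avg, hiter]

/-- Invariance of the path law under the shift, read off on one coordinate. It carries almost sure
properties of slot `0` over to every slot. -/
lemma IsStationaryErgodic.map_eq {N : ℕ} {Ω : Type*} [MeasurableSpace Ω] {ℙ : Measure Ω}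
    {x : ℕ → Ω → Fin N → ℝ} (hx : IsStationaryErgodic ℙ x) (i : ℕ) :
    ℙ.map (x i) = ℙ.map (x 0) := by
  obtain ⟨hxm, herg⟩ := hx
  have hX : Measurable fun ω i => x i ω := measurable_pi_iff.2 hxm
  induction i with
  | zero => rfl
  | succ i ih =>
    rw [← ih]
    have h1 := herg.toMeasurePreserving.map_eq
    have h2 : ∀ j, ℙ.map (x j) = (ℙ.map fun ω i => x i ω).map (fun s => s j) := by
      intro j; rw [Measure.map_map (measurable_pi_apply j) hX]; rfl
    rw [h2 i, ← h1, Measure.map_map (measurable_pi_apply i) herg.measurable,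
      Measure.map_map (by fun_prop) hX]
    rfl

end Birkhoff

/-! ### Telescoping sums over users and weight decrements. -/

section Sums

variable {N : ℕ}

lemma filter_le_succ {k : ℕ} (hk : k + 1 < N) :
    Finset.univ.filter (· ≤ (⟨k + 1, hk⟩ : Fin N))
      = insert ⟨k + 1, hk⟩ (Finset.univ.filter (· ≤ (⟨k, by omega⟩ : Fin N))) := by
  ext i
  simp only [Finset.mem_filter, Finset.mem_univ, true_and, Finset.mem_insert, Fin.ext_iff,
    Fin.le_def]
  omega

lemma filter_lt_succ {k : ℕ} (hk : k + 1 < N) :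
    Finset.univ.filter (· < (⟨k + 1, hk⟩ : Fin N))
      = Finset.univ.filter (· ≤ (⟨k, by omega⟩ : Fin N)) := by
  ext i
  simp only [Finset.mem_filter, Finset.mem_univ, true_and, Fin.lt_def, Fin.le_def]
  omega

lemma sum_filter_le (p : Fin N → ℝ) (n : Fin N) :
    ∑ k ∈ Finset.univ.filter (· ≤ n), p k = ∑ k ∈ Finset.univ.filter (· < n), p k + p n := by
  have : Finset.univ.filter (· ≤ n) = insert n (Finset.univ.filter (· < n)) := by
    ext i
    simp only [Finset.mem_filter, Finset.mem_univ, true_and, Finset.mem_insert]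
    exact le_iff_eq_or_lt
  rw [this, Finset.sum_insert (by simp), add_comm]

lemma sum_telescope (g : ℝ → ℝ) (p : Fin N → ℝ) (m : Fin N) :
    ∑ n ∈ Finset.univ.filter (· ≤ m), (g (1 + ∑ k ∈ Finset.univ.filter (· ≤ n), p k)
      - g (1 + ∑ k ∈ Finset.univ.filter (· < n), p k))
      = g (1 + ∑ k ∈ Finset.univ.filter (· ≤ m), p k) - g 1 := by
  obtain ⟨k, hk⟩ := m
  induction k with
  | zero =>
    have h1 : Finset.univ.filter (· ≤ (⟨0, hk⟩ : Fin N)) = {⟨0, hk⟩} := by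
      ext i
      simp [Fin.ext_iff, Fin.le_def]
    have h2 : Finset.univ.filter (· < (⟨0, hk⟩ : Fin N)) = ∅ := by
      ext i
      simp [Fin.lt_def]
    rw [h1, Finset.sum_singleton, h1, h2]
    simp
  | succ k ih =>
    rw [filter_le_succ hk, Finset.sum_insert (by simp [Fin.le_def]), ih (by omega),
      filter_le_succ hk, filter_lt_succ hk]
    ring

/-- The decrement `μ_n - μ_{n+1}` of the weights. -/
def weightDrop (μ : Fin N → ℝ) (n : Fin N) : ℝ := μ n - nextWeight μ n

lemma sum_weightDrop (μ : Fin N → ℝ) (n : Fin N) :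
    ∑ m ∈ Finset.univ.filter (n ≤ ·), weightDrop μ m = μ n := by
  -- Downward induction from the last user, `d` being the number of users after `n`.
  obtain ⟨d, hd⟩ : ∃ d, n.val + d + 1 = N := ⟨N - n.val - 1, by omega⟩
  induction d generalizing n with
  | zero =>
    have h1 : Finset.univ.filter (n ≤ ·) = {n} := by
      ext i
      simp only [Finset.mem_filter, Finset.mem_univ, true_and, Finset.mem_singleton, Fin.ext_iff,
        Fin.le_def]
      omega
    rw [h1, Finset.sum_singleton, weightDrop, nextWeight, dif_neg (by omega), sub_zero]
  | succ d ih =>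
    have hn : n.val + 1 < N := by omega
    have h1 : Finset.univ.filter (n ≤ ·)
        = insert n (Finset.univ.filter ((⟨n.val + 1, hn⟩ : Fin N) ≤ ·)) := by
      ext i
      simp only [Finset.mem_filter, Finset.mem_univ, true_and, Finset.mem_insert, Fin.ext_iff,
        Fin.le_def]
      omega
    rw [h1, Finset.sum_insert (by simp [Fin.le_def]), ih ⟨n.val + 1, hn⟩ (by simp; omega),
      weightDrop, nextWeight, dif_pos hn]
    ring

lemma sum_filter_le_split (f : Fin N → ℝ) {n j : Fin N} (hnj : n ≤ j) :
    ∑ m ∈ Finset.univ.filter (n ≤ ·), f m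
      = ∑ m ∈ Finset.univ.filter (fun m => n ≤ m ∧ m < j), f m
        + ∑ m ∈ Finset.univ.filter (j ≤ ·), f m := by
  rw [← Finset.sum_union]
  · congr 1
    ext i
    simp only [Finset.mem_filter, Finset.mem_univ, true_and, Finset.mem_union, Fin.lt_def,
      Fin.le_def] at *
    omega
  · rw [Finset.disjoint_left]
    intro i hi hi'
    simp only [Finset.mem_filter, Finset.mem_univ, true_and] at hi hi'
    exact absurd hi.2 (not_lt.2 hi')

lemma sum_weightDrop_between (μ : Fin N → ℝ) {n j : Fin N} (hnj : n ≤ j) :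
    ∑ m ∈ Finset.univ.filter (fun m => n ≤ m ∧ m < j), weightDrop μ m = μ n - μ j := by
  have := sum_filter_le_split (weightDrop μ) hnj
  rw [sum_weightDrop, sum_weightDrop] at this
  linarith

lemma weightDrop_nonneg {μ : Fin N → ℝ} (hμpos : ∀ n, 0 < μ n) (hμanti : Antitone μ) (n : Fin N) :
    0 ≤ weightDrop μ n := by
  unfold weightDrop nextWeight
  split_ifs with h
  · exact sub_nonneg.2 (hμanti (by simp [Fin.le_def]))
  · simpa using (hμpos n).le

/-- The drops between `n` and `j` are nonnegative and add up to `μ n - μ j = 0`. -/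
lemma weightDrop_eq_zero {μ : Fin N → ℝ} (hμpos : ∀ n, 0 < μ n) (hμanti : Antitone μ)
    {n j m : Fin N} (h : μ n = μ j) (hn : n ≤ m) (hj : m < j) : weightDrop μ m = 0 := by
  have h1 := sum_weightDrop_between μ (hn.trans hj.le)
  rw [h, sub_self, Finset.sum_eq_zero_iff_of_nonneg fun i _ => weightDrop_nonneg hμpos hμanti i]
    at h1
  exact h1 m (by simp [hn, hj])

end Sums

/-! ### The uplink objective: concavity, optimality conditions, uniqueness. -/

section Objective

variable {N : ℕ} {μ lam x P R : Fin N → ℝ}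

lemma level_eq (x P : Fin N → ℝ) (n : Fin N) :
    level x P n = 1 + ∑ k ∈ Finset.univ.filter (· < n), P k * x k + P n * x n := by
  rw [level, sum_filter_le, add_assoc]

lemma one_le_level (hx : ∀ n, 0 < x n) (hP : ∀ n, 0 ≤ P n) (n : Fin N) : 1 ≤ level x P n :=
  le_add_of_nonneg_right (Finset.sum_nonneg fun k _ => mul_nonneg (hP k) (hx k).le)

lemma level_pos (hx : ∀ n, 0 < x n) (hP : ∀ n, 0 ≤ P n) (n : Fin N) : 0 < level x P n :=
  one_pos.trans_le (one_le_level hx hP n)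

lemma slotObjective_one (μ x P : Fin N → ℝ) : slotObjective μ x 1 P = 0 := by
  simp [slotObjective, slotRate]

/-- Summation by parts of the weighted sum rate. -/
lemma slotObjective_zero (hx : ∀ n, 0 < x n) (hP : ∀ n, 0 ≤ P n) :
    slotObjective μ x 0 P = ∑ n, weightDrop μ n * Real.logb 2 (level x P n) := by
  -- Under successive decoding the rate of a user is the logarithm of a quotient of consecutive
  -- levels, so the rates telescope.
  have hrate : ∀ n, slotRate x 0 P n
      = Real.logb 2 (1 + ∑ k ∈ Finset.univ.filter (· ≤ n), P k * x k)
        - Real.logb 2 (1 + ∑ k ∈ Finset.univ.filter (· < n), P k * x k) := by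
    intro n
    have h0 : 0 < 1 + ∑ k ∈ Finset.univ.filter (· < n), P k * x k :=
      add_pos_of_pos_of_nonneg one_pos
        (Finset.sum_nonneg fun k _ => mul_nonneg (hP k) (hx k).le)
    have h1 : 0 < 1 + ∑ k ∈ Finset.univ.filter (· ≤ n), P k * x k := level_pos hx hP n
    rw [slotRate, sub_zero, one_mul, ← Real.logb_div h1.ne' h0.ne', sum_filter_le]
    congr 1
    field_simp
    ring
  have hlev : ∀ m, ∑ n ∈ Finset.univ.filter (· ≤ m), slotRate x 0 P n
      = Real.logb 2 (level x P m) := by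
    intro m
    simp_rw [hrate]
    rw [sum_telescope (Real.logb 2) (fun k => P k * x k) m]
    simp [level]
  simp_rw [← hlev, slotObjective, Finset.mul_sum]
  conv_lhs => enter [2, n]; rw [← sum_weightDrop μ n, Finset.sum_mul]
  simp_rw [Finset.sum_filter]
  exact Finset.sum_comm

lemma uplinkGain_eq (μ lam x P : Fin N → ℝ) :
    uplinkGain μ lam x P
      = ∑ n, weightDrop μ n * Real.logb 2 (level x P n) - ∑ n, lam n * P n := rfl

/-- The tangent of the concave logarithm at `a`. -/
lemma logb_le_add {a b : ℝ} (ha : 0 < a) (hb : 0 < b) :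
    Real.logb 2 b ≤ Real.logb 2 a + (b - a) / a / Real.log 2 := by
  have h2 : 0 < Real.log 2 := Real.log_pos one_lt_two
  have h := Real.log_le_sub_one_of_pos (div_pos hb ha)
  rw [Real.log_div hb.ne' ha.ne'] at h
  rw [Real.logb, Real.logb, ← add_div]
  refine div_le_div_of_nonneg_right ?_ h2.le
  have : (b - a) / a = b / a - 1 := by field_simp
  linarith

lemma logb_lt_add {a b : ℝ} (ha : 0 < a) (hb : 0 < b) (hab : b ≠ a) :
    Real.logb 2 b < Real.logb 2 a + (b - a) / a / Real.log 2 := by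
  have h2 : 0 < Real.log 2 := Real.log_pos one_lt_two
  have h := Real.log_lt_sub_one_of_pos (div_pos hb ha) (by rwa [Ne, div_eq_one_iff_eq ha.ne'])
  rw [Real.log_div hb.ne' ha.ne'] at h
  rw [Real.logb, Real.logb, ← add_div]
  refine div_lt_div_of_pos_right ?_ h2
  have : (b - a) / a = b / a - 1 := by field_simp
  linarith

lemma level_sub_level (x P R : Fin N → ℝ) (m : Fin N) :
    level x R m - level x P m = ∑ k ∈ Finset.univ.filter (· ≤ m), (R k - P k) * x k := by
  simp only [level, sub_mul, Finset.sum_sub_distrib]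
  ring

/-- The directional derivative at `P` towards `R`, first summed over levels and then, after
interchanging the sums, over users. It turns the tangent bounds into the gradient inequality. -/
lemma sum_marginalRate (μ x P R : Fin N → ℝ) :
    ∑ m, weightDrop μ m * ((level x R m - level x P m) / level x P m / Real.log 2)
      = ∑ k, (R k - P k) * marginalRate μ x P k := by
  simp_rw [level_sub_level, marginalRate, Finset.sum_div, Finset.mul_sum, Finset.sum_filter]
  rw [Finset.sum_comm]
  refine Finset.sum_congr rfl fun k _ => Finset.sum_congr rfl fun m _ => ?_
  split_ifs
  · rw [weightDrop]; ring
  · ring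

/-- The gradient inequality for the concave function `uplinkGain`. -/
lemma uplinkGain_le_add (hμpos : ∀ n, 0 < μ n) (hμanti : Antitone μ) (hx : ∀ n, 0 < x n)
    (hP : ∀ n, 0 ≤ P n) (hR : ∀ n, 0 ≤ R n) :
    uplinkGain μ lam x R
      ≤ uplinkGain μ lam x P + ∑ k, (R k - P k) * (marginalRate μ x P k - lam k) := by
  have h : ∑ n, weightDrop μ n * Real.logb 2 (level x R n)
      ≤ ∑ n, (weightDrop μ n * Real.logb 2 (level x P n)
        + weightDrop μ n * ((level x R n - level x P n) / level x P n / Real.log 2)) := by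
    refine Finset.sum_le_sum fun n _ => ?_
    rw [← mul_add]
    exact mul_le_mul_of_nonneg_left (logb_le_add (level_pos hx hP n) (level_pos hx hR n))
      (weightDrop_nonneg hμpos hμanti n)
  rw [Finset.sum_add_distrib, sum_marginalRate] at h
  simp only [uplinkGain_eq, mul_sub, sub_mul, Finset.sum_sub_distrib] at *
  simp only [mul_comm (lam _)]
  linarith

/-- The objective is strictly concave only in those levels that carry a positive weight drop. One
such level that differs makes the gradient inequality strict. -/
lemma uplinkGain_lt_add (hμpos : ∀ n, 0 < μ n) (hμanti : Antitone μ) (hx : ∀ n, 0 < x n)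
    (hP : ∀ n, 0 ≤ P n) (hR : ∀ n, 0 ≤ R n) {m : Fin N} (hm : 0 < weightDrop μ m)
    (hne : level x R m ≠ level x P m) :
    uplinkGain μ lam x R
      < uplinkGain μ lam x P + ∑ k, (R k - P k) * (marginalRate μ x P k - lam k) := by
  have h : ∑ n, weightDrop μ n * Real.logb 2 (level x R n)
      < ∑ n, (weightDrop μ n * Real.logb 2 (level x P n)
        + weightDrop μ n * ((level x R n - level x P n) / level x P n / Real.log 2)) := by
    refine Finset.sum_lt_sum (fun n _ => ?_) ⟨m, Finset.mem_univ _, ?_⟩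
    · rw [← mul_add]
      exact mul_le_mul_of_nonneg_left (logb_le_add (level_pos hx hP n) (level_pos hx hR n))
        (weightDrop_nonneg hμpos hμanti n)
    · rw [← mul_add]
      exact mul_lt_mul_of_pos_left (logb_lt_add (level_pos hx hP m) (level_pos hx hR m) hne) hm
  rw [Finset.sum_add_distrib, sum_marginalRate] at h
  simp only [uplinkGain_eq, mul_sub, sub_mul, Finset.sum_sub_distrib] at *
  simp only [mul_comm (lam _)]
  linarith

/-- The Karush-Kuhn-Tucker conditions for the maximisation of `uplinkGain`. -/
structure IsKKT (μ lam x P : Fin N → ℝ) : Prop where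
  nonneg : ∀ n, 0 ≤ P n
  le : ∀ n, marginalRate μ x P n ≤ lam n
  eq : ∀ n, P n ≠ 0 → marginalRate μ x P n = lam n

/-- Complementary slackness: an active user contributes nothing, and a silent one can only raise a
power whose marginal rate is at most its price. -/
lemma IsKKT.sum_nonpos (h : IsKKT μ lam x P) (hR : ∀ n, 0 ≤ R n) :
    ∑ k, (R k - P k) * (marginalRate μ x P k - lam k) ≤ 0 := by
  refine Finset.sum_nonpos fun k _ => ?_
  by_cases hk : P k = 0
  · rw [hk, sub_zero]
    exact mul_nonpos_of_nonneg_of_nonpos (hR k) (sub_nonpos.2 (h.le k))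
  · rw [h.eq k hk, sub_self, mul_zero]

lemma IsKKT.uplinkGain_le (hμpos : ∀ n, 0 < μ n) (hμanti : Antitone μ) (hx : ∀ n, 0 < x n)
    (h : IsKKT μ lam x P) (hR : ∀ n, 0 ≤ R n) : uplinkGain μ lam x R ≤ uplinkGain μ lam x P :=
  (uplinkGain_le_add hμpos hμanti hx h.nonneg hR).trans (by linarith [h.sum_nonpos hR])

/-- Optimal powers may be ambiguous, but by strict concavity the levels with a positive drop are
not. -/
lemma IsKKT.level_eq_of_le (hμpos : ∀ n, 0 < μ n) (hμanti : Antitone μ) (hx : ∀ n, 0 < x n)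
    (h : IsKKT μ lam x P) (hR : ∀ n, 0 ≤ R n)
    (hle : uplinkGain μ lam x P ≤ uplinkGain μ lam x R) {m : Fin N} (hm : 0 < weightDrop μ m) :
    level x R m = level x P m := by
  by_contra hne
  have h1 := uplinkGain_lt_add (lam := lam) hμpos hμanti hx h.nonneg hR hm hne
  linarith [h.sum_nonpos hR]

/-- `∑_{m ≥ n} (μ_m - μ_{m+1}) / level_m`. -/
def tailRate (μ x P : Fin N → ℝ) (n : Fin N) : ℝ :=
  ∑ m ∈ Finset.univ.filter (n ≤ ·), weightDrop μ m / level x P m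

lemma marginalRate_eq (μ x P : Fin N → ℝ) (n : Fin N) :
    marginalRate μ x P n = x n / Real.log 2 * tailRate μ x P n := rfl

lemma tailRate_congr (h : ∀ m, weightDrop μ m ≠ 0 → level x R m = level x P m) (n : Fin N) :
    tailRate μ x R n = tailRate μ x P n := by
  refine Finset.sum_congr rfl fun m _ => ?_
  by_cases hm : weightDrop μ m = 0
  · rw [hm, zero_div, zero_div]
  · rw [h m hm]

/-- No two users have equal weights and equal ratios of price and gain. -/
def NoTie (μ lam x : Fin N → ℝ) : Prop :=
  ∀ m n, m ≠ n → μ m = μ n → lam m / x m ≠ lam n / x n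

lemma weightDrop_exists_pos (hμpos : ∀ n, 0 < μ n) (hμanti : Antitone μ) (n : Fin N) :
    ∃ m, n ≤ m ∧ 0 < weightDrop μ m ∧ ∀ i, n ≤ i → i < m → weightDrop μ i = 0 := by
  have hne : (Finset.univ.filter fun m => n ≤ m ∧ 0 < weightDrop μ m).Nonempty := by
    by_contra h
    have h0 : ∑ m ∈ Finset.univ.filter (n ≤ ·), weightDrop μ m ≤ 0 := by
      refine Finset.sum_nonpos fun m hm => ?_
      by_contra hlt
      refine h ⟨m, ?_⟩
      simp only [Finset.mem_filter, Finset.mem_univ, true_and] at hm ⊢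
      exact ⟨hm, not_le.1 hlt⟩
    rw [sum_weightDrop] at h0
    exact absurd (hμpos n) (not_lt.2 h0)
  have hmem := Finset.min'_mem _ hne
  simp only [Finset.mem_filter, Finset.mem_univ, true_and] at hmem
  refine ⟨_, hmem.1, hmem.2, fun i hi hlt => ?_⟩
  by_contra h0
  have hpos : 0 < weightDrop μ i := lt_of_le_of_ne (weightDrop_nonneg hμpos hμanti i) (Ne.symm h0)
  exact absurd (Finset.min'_le _ i (by simp [hi, hpos])) (not_le.2 hlt)

/-- Stationarity in a form whose right-hand side depends on the levels only. It allows the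
comparison of different users, even across two solutions. -/
lemma IsKKT.ratio_eq (hx : ∀ n, 0 < x n) (h : IsKKT μ lam x P) {n : Fin N} (hn : P n ≠ 0) :
    lam n / x n = tailRate μ x P n / Real.log 2 := by
  rw [← h.eq n hn, marginalRate_eq]
  field_simp [(hx n).ne']

/-- Suppose `P n > R n` with equal powers below `n`. At the first positive drop `m ≥ n` the two
levels agree, so some user `k` with `n < k ≤ m` has `P k < R k`. No drop is positive between `n` and
`k`, so these users have equal weights and equal tail rates. As `n` is active in `P` and `k` in `R`,
their price ratios coincide, which is a tie. -/
lemma IsKKT.le_of_eq_below (hμpos : ∀ n, 0 < μ n) (hμanti : Antitone μ) (hx : ∀ n, 0 < x n)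
    (hP : IsKKT μ lam x P) (hR : IsKKT μ lam x R) (htie : NoTie μ lam x) {n : Fin N}
    (hlt : ∀ k < n, P k = R k) : P n ≤ R n := by
  by_contra hcon
  rw [not_le] at hcon
  have hlev : ∀ m, weightDrop μ m ≠ 0 → level x R m = level x P m := fun m hm =>
    hP.level_eq_of_le hμpos hμanti hx hR.nonneg (hR.uplinkGain_le hμpos hμanti hx hP.nonneg)
      (lt_of_le_of_ne (weightDrop_nonneg hμpos hμanti m) (Ne.symm hm))
  obtain ⟨m, hnm, hm, hzero⟩ := weightDrop_exists_pos hμpos hμanti n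
  have hk : ∃ k ≤ m, P k < R k := by
    by_contra hk
    push Not at hk
    have hsum : ∑ k ∈ Finset.univ.filter (· ≤ m), R k * x k
        < ∑ k ∈ Finset.univ.filter (· ≤ m), P k * x k := by
      refine Finset.sum_lt_sum (fun k hk' => ?_) ⟨n, by simp [hnm], ?_⟩
      · exact mul_le_mul_of_nonneg_right (hk k (by simpa using hk')) (hx k).le
      · exact mul_lt_mul_of_pos_right hcon (hx n)
    have := hlev m hm.ne'
    simp only [level] at this
    linarith
  obtain ⟨k, hkm, hk⟩ := hk
  have hnk : n < k := by
    rcases lt_trichotomy k n with h | h | h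
    · exact absurd (hlt k h) hk.ne
    · exact absurd (h ▸ hk) (not_lt.2 hcon.le)
    · exact h
  have hz : ∀ i ∈ Finset.univ.filter (fun i => n ≤ i ∧ i < k), weightDrop μ i = 0 := by
    intro i hi
    simp only [Finset.mem_filter, Finset.mem_univ, true_and] at hi
    exact hzero i hi.1 (hi.2.trans_le hkm)
  have hμ : μ n = μ k := by
    have h1 := sum_weightDrop_between μ hnk.le
    rw [Finset.sum_eq_zero hz] at h1
    linarith
  have hPn : P n ≠ 0 := ((hR.nonneg n).trans_lt hcon).ne'
  have hRk : R k ≠ 0 := ((hP.nonneg k).trans_lt hk).ne'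
  refine htie n k hnk.ne hμ ?_
  rw [hP.ratio_eq hx hPn, hR.ratio_eq hx hRk, tailRate_congr hlev, tailRate,
    sum_filter_le_split _ hnk.le, Finset.sum_eq_zero, zero_add]
  · rfl
  · intro i hi
    rw [hz i hi, zero_div]

lemma IsKKT.unique (hμpos : ∀ n, 0 < μ n) (hμanti : Antitone μ) (hx : ∀ n, 0 < x n)
    (hP : IsKKT μ lam x P) (hR : IsKKT μ lam x R) (htie : NoTie μ lam x) : P = R := by
  funext n
  induction n using WellFoundedLT.induction with
  | ind n ih =>
    exact le_antisymm (hP.le_of_eq_below hμpos hμanti hx hR htie ih)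
      (hR.le_of_eq_below hμpos hμanti hx hP htie fun k hk => (ih k hk).symm)

end Objective

/-! ### The power formula and its equivalence with the optimality conditions. -/

section Region

variable {N : ℕ} {μ lam x P R : Fin N → ℝ} {S : Finset (Fin N)}

lemma exists_next_or_last (S : Finset (Fin N)) (n : Fin N) :
    (∃ j ∈ S, n < j ∧ ∀ i ∈ S, n < i → j ≤ i) ∨ ∀ i ∈ S, ¬ n < i := by
  by_cases h : (S.filter (n < ·)).Nonempty
  · have hmem := Finset.min'_mem _ h
    rw [Finset.mem_filter] at hmem
    exact Or.inl ⟨_, hmem.1, hmem.2,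
      fun i hi hni => Finset.min'_le _ i (Finset.mem_filter.2 ⟨hi, hni⟩)⟩
  · exact Or.inr fun i hi hni => h ⟨i, Finset.mem_filter.2 ⟨hi, hni⟩⟩

lemma exists_prev_or_first (S : Finset (Fin N)) (n : Fin N) :
    (∃ j ∈ S, j < n ∧ ∀ i ∈ S, i < n → i ≤ j) ∨ ∀ i ∈ S, ¬ i < n := by
  by_cases h : (S.filter (· < n)).Nonempty
  · have hmem := Finset.max'_mem _ h
    rw [Finset.mem_filter] at hmem
    exact Or.inl ⟨_, hmem.1, hmem.2,
      fun i hi hni => Finset.le_max' _ i (Finset.mem_filter.2 ⟨hi, hni⟩)⟩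
  · exact Or.inr fun i hi hni => h ⟨i, Finset.mem_filter.2 ⟨hi, hni⟩⟩

lemma upperTerm_of_next {n j : Fin N} (hj : j ∈ S) (hnj : n < j) (hmin : ∀ i ∈ S, n < i → j ≤ i) :
    upperTerm μ lam S x n = ((μ n - μ j) / Real.log 2) / (lam n - lam j * x n / x j) := by
  have hne : (S.filter (n < ·)).Nonempty := ⟨j, Finset.mem_filter.2 ⟨hj, hnj⟩⟩
  have hm : (S.filter (n < ·)).min' hne = j := by
    refine le_antisymm (Finset.min'_le _ j (Finset.mem_filter.2 ⟨hj, hnj⟩)) ?_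
    refine Finset.le_min' _ _ _ fun i hi => ?_
    rw [Finset.mem_filter] at hi
    exact hmin i hi.1 hi.2
  rw [upperTerm, dif_pos hne]
  simp only [hm]

lemma upperTerm_of_last {n : Fin N} (h : ∀ i ∈ S, ¬ n < i) :
    upperTerm μ lam S x n = (μ n / Real.log 2) / lam n := by
  rw [upperTerm, dif_neg]
  rintro ⟨i, hi⟩
  rw [Finset.mem_filter] at hi
  exact h i hi.1 hi.2

lemma lowerTerm_of_prev {n k : Fin N} (hk : k ∈ S) (hkn : k < n) (hmax : ∀ i ∈ S, i < n → i ≤ k) :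
    lowerTerm μ lam S x n = ((μ k - μ n) / Real.log 2) / (-lam n + lam k * x n / x k) := by
  have hne : (S.filter (· < n)).Nonempty := ⟨k, Finset.mem_filter.2 ⟨hk, hkn⟩⟩
  have hm : (S.filter (· < n)).max' hne = k := by
    refine le_antisymm ?_ (Finset.le_max' _ k (Finset.mem_filter.2 ⟨hk, hkn⟩))
    refine Finset.max'_le _ _ _ fun i hi => ?_
    rw [Finset.mem_filter] at hi
    exact hmax i hi.1 hi.2
  rw [lowerTerm, dif_pos hne]
  simp only [hm]

lemma lowerTerm_of_first {n : Fin N} (h : ∀ i ∈ S, ¬ i < n) :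
    lowerTerm μ lam S x n = 1 / x n := by
  rw [lowerTerm, dif_neg]
  rintro ⟨i, hi⟩
  rw [Finset.mem_filter] at hi
  exact h i hi.1 hi.2

/-- In terms of received power, the subtracted term of an active user is the leading term of the
previous one. This makes the formula telescope along the active users. -/
lemma lowerTerm_mul (hx : ∀ n, 0 < x n) {n k : Fin N} (hn : n ∈ S) (hk : k ∈ S) (hkn : k < n)
    (hmax : ∀ i ∈ S, i < n → i ≤ k) :
    lowerTerm μ lam S x n * x n = upperTerm μ lam S x k * x k := by
  have hmin : ∀ i ∈ S, k < i → n ≤ i := fun i hi hki =>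
    not_lt.1 fun h => absurd (hmax i hi h) (not_le.2 hki)
  rw [lowerTerm_of_prev hk hkn hmax, upperTerm_of_next hn hkn hmin]
  have h : -lam n + lam k * x n / x k = (x n / x k) * (lam k - lam n * x k / x n) := by
    have := (hx n).ne'
    have := (hx k).ne'
    field_simp
    ring
  rw [h]
  have hxn := (hx n).ne'
  have hxk := (hx k).ne'
  -- The two denominators vanish together, and then both quotients are `0` by convention.
  by_cases hD : lam k - lam n * x k / x n = 0
  · simp [hD]
  · generalize lam k - lam n * x k / x n = D at hD
    field_simp

lemma level_of_prev (hP : ∀ i ∉ S, P i = 0) {n k : Fin N} (hkn : k < n)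
    (hmax : ∀ i ∈ S, i < n → i ≤ k) : level x P n = level x P k + P n * x n := by
  rw [level_eq, level]
  congr 2
  symm
  refine Finset.sum_subset (fun i hi => ?_) fun i hi hik => ?_
  · simp only [Finset.mem_filter, Finset.mem_univ, true_and] at hi ⊢
    exact hi.trans_lt hkn
  · simp only [Finset.mem_filter, Finset.mem_univ, true_and] at hi hik
    rw [hP i fun hiS => hik (hmax i hiS hi), zero_mul]

lemma level_of_first (hP : ∀ i ∉ S, P i = 0) {n : Fin N} (hfirst : ∀ i ∈ S, ¬ i < n) :
    level x P n = 1 + P n * x n := by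
  rw [level_eq, Finset.sum_eq_zero, add_zero]
  intro i hi
  simp only [Finset.mem_filter, Finset.mem_univ, true_and] at hi
  rw [hP i fun hiS => hfirst i hiS hi, zero_mul]

lemma level_eq_of_le (hP : ∀ i ∉ S, P i = 0) {n m : Fin N} (hnm : n ≤ m)
    (h : ∀ i ∈ S, n < i → m < i) : level x P m = level x P n := by
  rw [level, level]
  congr 1
  symm
  refine Finset.sum_subset (fun i hi => ?_) fun i hi hik => ?_
  · simp only [Finset.mem_filter, Finset.mem_univ, true_and] at hi ⊢
    exact hi.trans hnm
  · simp only [Finset.mem_filter, Finset.mem_univ, true_and, not_le] at hi hik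
    rw [hP i fun hiS => absurd (h i hiS hik) (not_lt.2 hi), zero_mul]

/-- The level is constant between consecutive active users, so the drops in between can be summed.
-/
lemma tailRate_of_next (hP : ∀ i ∉ S, P i = 0) {n j : Fin N} (hnj : n < j)
    (hmin : ∀ i ∈ S, n < i → j ≤ i) :
    tailRate μ x P n = (μ n - μ j) / level x P n + tailRate μ x P j := by
  rw [tailRate, sum_filter_le_split _ hnj.le, ← sum_weightDrop_between μ hnj.le, Finset.sum_div]
  congr 1
  refine Finset.sum_congr rfl fun m hm => ?_
  simp only [Finset.mem_filter, Finset.mem_univ, true_and] at hm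
  rw [level_eq_of_le hP hm.1 fun i hi hni => hm.2.trans_le (hmin i hi hni)]

lemma tailRate_of_last (hP : ∀ i ∉ S, P i = 0) {n : Fin N} (hlast : ∀ i ∈ S, ¬ n < i) :
    tailRate μ x P n = μ n / level x P n := by
  rw [tailRate, ← sum_weightDrop μ n, Finset.sum_div]
  refine Finset.sum_congr rfl fun m hm => ?_
  simp only [Finset.mem_filter, Finset.mem_univ, true_and] at hm
  rw [level_eq_of_le hP hm fun i hi hni => absurd hni (hlast i hi)]

lemma activePower_of_notMem {n : Fin N} (hn : n ∉ S) : activePower μ lam S x n = 0 := if_neg hn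

lemma activePower_nonneg (hx : x ∈ region μ lam S) (n : Fin N) : 0 ≤ activePower μ lam S x n := by
  by_cases hn : n ∈ S
  · exact (hx.2.1 n hn).le
  · rw [activePower_of_notMem hn]

/-- The formula writes each received power as a difference of consecutive levels, the level before
the first active user being `1`. Induction along the active users sums them. -/
lemma level_activePower (hx : ∀ n, 0 < x n) {n : Fin N} (hn : n ∈ S) :
    level x (activePower μ lam S x) n = upperTerm μ lam S x n * x n := by
  have hP : ∀ i ∉ S, activePower μ lam S x i = 0 := fun i => activePower_of_notMem
  induction n using WellFoundedLT.induction with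
  | ind n ih =>
    have hval : activePower μ lam S x n = upperTerm μ lam S x n - lowerTerm μ lam S x n := if_pos hn
    rcases exists_prev_or_first S n with ⟨k, hk, hkn, hmax⟩ | hfirst
    · rw [level_of_prev hP hkn hmax, ih k hkn hk, hval, ← lowerTerm_mul hx hn hk hkn hmax]
      ring
    · rw [level_of_first hP hfirst, hval, lowerTerm_of_first hfirst]
      have := (hx n).ne'
      field_simp
      ring

/-- In the activity region of `S` the powers of the formula satisfy the optimality conditions. -/
lemma isKKT_activePower (hlam : ∀ n, 0 < lam n) (hμpos : ∀ n, 0 < μ n)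
    (hS : x ∈ region μ lam S) : IsKKT μ lam x (activePower μ lam S x) := by
  have hx := hS.1
  have hP : ∀ i ∉ S, activePower μ lam S x i = 0 := fun i => activePower_of_notMem
  have h2 : Real.log 2 ≠ 0 := (Real.log_pos one_lt_two).ne'
  -- Stationarity of the active users, by downward induction from the last one.
  have key : ∀ n ∈ S, lam n / x n = tailRate μ x (activePower μ lam S x) n / Real.log 2 := by
    intro n
    induction n using WellFoundedGT.induction with
    | ind n ih =>
      intro hn
      have hlevel := level_activePower (μ := μ) (lam := lam) hx hn
      have hpos := level_pos hx (activePower_nonneg hS) n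
      have hxn := (hx n).ne'
      rcases exists_next_or_last S n with ⟨j, hj, hnj, hmin⟩ | hlast
      · have hxj := (hx j).ne'
        rw [tailRate_of_next hP hnj hmin, add_div, ← ih j hnj hj]
        rw [upperTerm_of_next hj hnj hmin] at hlevel
        -- A zero denominator or equal consecutive weights would make the quotient, and with it the
        -- level, equal to `0`, although levels are at least `1` in the region.
        have hD : lam n - lam j * x n / x j ≠ 0 := by
          intro h0
          rw [h0, div_zero, zero_mul] at hlevel
          exact hpos.ne' hlevel
        have hd : μ n - μ j ≠ 0 := by
          intro h0
          rw [h0, zero_div, zero_div, zero_mul] at hlevel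
          exact hpos.ne' hlevel
        rw [hlevel]
        generalize hDD : lam n - lam j * x n / x j = D at hD
        have : lam n = D + lam j * x n / x j := by rw [← hDD]; ring
        rw [this]
        field_simp
      · rw [tailRate_of_last hP hlast, hlevel, upperTerm_of_last hlast]
        have := (hlam n).ne'
        have := (hμpos n).ne'
        field_simp
  have heq : ∀ n ∈ S, marginalRate μ x (activePower μ lam S x) n = lam n := by
    intro n hn
    have := key n hn
    have hxn := (hx n).ne'
    rw [marginalRate_eq]
    field_simp at this ⊢
    linarith
  refine ⟨activePower_nonneg hS, fun n => ?_, fun n hn => heq n ?_⟩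
  · by_cases hn : n ∈ S
    · exact (heq n hn).le
    · exact hS.2.2 n hn
  · by_contra h
    exact hn (hP n h)

/-- A solution of the optimality conditions without two active users of the same weight is given by
the power formula. -/
lemma IsKKT.mem_region (hx : ∀ n, 0 < x n) (h : IsKKT μ lam x P) (hlam : ∀ n, 0 < lam n)
    (hμ : ∀ m n, P m ≠ 0 → P n ≠ 0 → m ≠ n → μ m ≠ μ n) :
    x ∈ region μ lam (Finset.univ.filter (P · ≠ 0))
      ∧ activePower μ lam (Finset.univ.filter (P · ≠ 0)) x = P := by
  set S := Finset.univ.filter (P · ≠ 0) with hSdef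
  have hmem : ∀ i, i ∈ S ↔ P i ≠ 0 := fun i => by simp [hSdef]
  have hP : ∀ i ∉ S, P i = 0 := fun i hi => by simpa [hmem] using hi
  have h2 : 0 < Real.log 2 := Real.log_pos one_lt_two
  have hupper : ∀ n ∈ S, upperTerm μ lam S x n * x n = level x P n := by
    intro n hn
    have hpos := (level_pos hx h.nonneg n).ne'
    have hq := h.ratio_eq hx ((hmem n).1 hn)
    have hxn := (hx n).ne'
    rcases exists_next_or_last S n with ⟨j, hj, hnj, hmin⟩ | hlast
    · have hqj := h.ratio_eq hx ((hmem j).1 hj)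
      -- With equal weights the stationarity equations of `n` and `j` would give `0 / 0` and could
      -- not be solved for the level.
      have hd : μ n - μ j ≠ 0 := sub_ne_zero.2 (hμ n j ((hmem n).1 hn) ((hmem j).1 hj) hnj.ne)
      rw [tailRate_of_next hP hnj hmin, add_div, ← hqj] at hq
      have hD : lam n - lam j * x n / x j = (μ n - μ j) / level x P n / Real.log 2 * x n := by
        have : lam n = lam n / x n * x n := by field_simp
        rw [this, hq]
        ring
      rw [upperTerm_of_next hj hnj hmin, hD]
      field_simp
    · rw [tailRate_of_last hP hlast] at hq
      have hl := (hlam n).ne'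
      rw [upperTerm_of_last hlast]
      field_simp at hq ⊢
      linarith
  have hact : activePower μ lam S x = P := by
    funext n
    by_cases hn : n ∈ S
    · rw [activePower, if_pos hn]
      have hxn := (hx n).ne'
      rw [← mul_left_inj' hxn, sub_mul, hupper n hn]
      rcases exists_prev_or_first S n with ⟨k, hk, hkn, hmax⟩ | hfirst
      · rw [lowerTerm_mul hx hn hk hkn hmax, hupper k hk, level_of_prev hP hkn hmax]
        ring
      · rw [lowerTerm_of_first hfirst, level_of_first hP hfirst]
        field_simp
        ring
    · rw [activePower_of_notMem hn, hP n hn]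
  refine ⟨⟨hx, fun n hn => ?_, fun n _ => ?_⟩, hact⟩
  · rw [hact]
    exact lt_of_le_of_ne (h.nonneg n) (Ne.symm ((hmem n).1 hn))
  · rw [hact]
    exact h.le n

lemma level_update (x P : Fin N → ℝ) (n m : Fin N) (t : ℝ) :
    level x (Function.update P n t) m = level x P m + if n ≤ m then (t - P n) * x n else 0 := by
  have h := level_sub_level x P (Function.update P n t) m
  rw [← sub_eq_iff_eq_add', h, Finset.sum_filter, Finset.sum_eq_single n]
  · simp
  · intro k _ hk
    simp [Function.update_of_ne hk]
  · simp

/-- Moving the power of a user to a later user of equal weight preserves optimality. -/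
lemma IsKKT.merge (hμpos : ∀ n, 0 < μ n) (hμanti : Antitone μ) (hx : ∀ n, 0 < x n)
    (h : IsKKT μ lam x P) {n j : Fin N} (hnj : n < j) (hμ : μ n = μ j) (hj : P j ≠ 0) :
    IsKKT μ lam x (Function.update (Function.update P n 0) j (P j + P n * x n / x j)) := by
  set R := Function.update (Function.update P n 0) j (P j + P n * x n / x j) with hR
  -- The power added to `j` restores the received power from `j` on. The levels strictly before `j`
  -- that do change carry no drop, since `μ n = μ j`.
  have hlev : ∀ m, weightDrop μ m ≠ 0 → level x R m = level x P m := by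
    intro m hm
    rw [hR, level_update, level_update, Function.update_of_ne hnj.ne']
    have hxj := (hx j).ne'
    by_cases h1 : j ≤ m
    · rw [if_pos h1, if_pos (hnj.le.trans h1)]
      field_simp
      ring
    · rw [if_neg h1, if_neg]
      · ring
      · exact fun h2 => hm (weightDrop_eq_zero hμpos hμanti hμ h2 (not_le.1 h1))
  have hmarg : ∀ k, marginalRate μ x R k = marginalRate μ x P k := fun k => by
    rw [marginalRate_eq, marginalRate_eq, tailRate_congr hlev]
  refine ⟨fun k => ?_, fun k => (hmarg k).trans_le (h.le k), fun k hk => (hmarg k).trans ?_⟩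
  · by_cases hkj : k = j
    · subst hkj
      rw [hR, Function.update_self]
      exact add_nonneg (h.nonneg k) (div_nonneg (mul_nonneg (h.nonneg n) (hx n).le) (hx k).le)
    · rw [hR, Function.update_of_ne hkj]
      by_cases hkn : k = n
      · subst hkn
        rw [Function.update_self]
      · rw [Function.update_of_ne hkn]
        exact h.nonneg k
  · by_cases hkj : k = j
    · subst hkj
      exact h.eq k hj
    · rw [hR, Function.update_of_ne hkj] at hk
      by_cases hkn : k = n
      · subst hkn
        exact absurd (Function.update_self k (0 : ℝ) P) hk
      · rw [Function.update_of_ne hkn] at hk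
        exact h.eq k hk

/-- Induction on the number of active users: merging two of equal weight silences one of them, and
once the active weights are distinct the power formula applies. -/
lemma IsKKT.exists_mem_region (hμpos : ∀ n, 0 < μ n) (hμanti : Antitone μ) (hx : ∀ n, 0 < x n)
    (hlam : ∀ n, 0 < lam n) (h : IsKKT μ lam x P) : ∃ S, x ∈ region μ lam S := by
  induction hc : (Finset.univ.filter (P · ≠ 0)).card using Nat.strong_induction_on generalizing P with
  | _ c ih =>
    by_cases hμ : ∀ m n, P m ≠ 0 → P n ≠ 0 → m ≠ n → μ m ≠ μ n
    · exact ⟨_, (h.mem_region hx hlam hμ).1⟩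
    · push Not at hμ
      obtain ⟨m, n, hm, hn, hmn, hμmn⟩ := hμ
      wlog hlt : m < n generalizing m n
      · exact this n m hn hm hmn.symm hμmn.symm (lt_of_le_of_ne (not_lt.1 hlt) hmn.symm)
      refine ih _ ?_ (h.merge hμpos hμanti hx hlt hμmn hn) rfl
      rw [← hc]
      refine Finset.card_lt_card (Finset.ssubset_iff_of_subset (fun k hk => ?_) |>.2
        ⟨m, by simpa using hm, ?_⟩)
      · simp only [Finset.mem_filter, Finset.mem_univ, true_and] at hk ⊢
        by_cases hkn : k = n
        · exact hkn ▸ hn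
        · rw [Function.update_of_ne hkn] at hk
          by_cases hkm : k = m
          · exact hkm ▸ hm
          · rwa [Function.update_of_ne hkm] at hk
      · simp [Function.update_of_ne hlt.ne]

end Region

/-! ### Existence of optimal powers; covering and disjointness of the regions. -/

section Existence

variable {N : ℕ} {μ lam x P R : Fin N → ℝ}

lemma continuous_level (x : Fin N → ℝ) (n : Fin N) : Continuous fun P => level x P n := by
  unfold level
  fun_prop

lemma continuousOn_uplinkGain (μ lam : Fin N → ℝ) (hx : ∀ n, 0 < x n) :
    ContinuousOn (uplinkGain μ lam x) {P | ∀ n, 0 ≤ P n} := by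
  unfold uplinkGain
  refine ContinuousOn.sub ?_ (by fun_prop)
  refine continuousOn_finsetSum _ fun n _ => continuousOn_const.mul ?_
  simp only [Real.logb]
  refine ContinuousOn.div_const ?_ _
  exact (continuous_level x n).continuousOn.log fun P hP => (level_pos hx hP n).ne'

/-- A power above `μ_n / (λ_n ln 2)` has a marginal rate below its price. -/
lemma marginalRate_lt (hμpos : ∀ n, 0 < μ n) (hμanti : Antitone μ) (hx : ∀ n, 0 < x n)
    (hP : ∀ n, 0 ≤ P n) (hlam : ∀ n, 0 < lam n) {n : Fin N}
    (h : μ n / (lam n * Real.log 2) ≤ P n) : marginalRate μ x P n < lam n := by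
  have h2 : 0 < Real.log 2 := Real.log_pos one_lt_two
  have hle : ∀ m ∈ Finset.univ.filter (n ≤ ·),
      weightDrop μ m / level x P m ≤ weightDrop μ m / (1 + P n * x n) := by
    intro m hm
    have hpos : 0 < 1 + P n * x n := add_pos_of_pos_of_nonneg one_pos (mul_nonneg (hP n) (hx n).le)
    refine div_le_div_of_nonneg_left (weightDrop_nonneg hμpos hμanti m) hpos ?_
    refine add_le_add le_rfl (Finset.single_le_sum (f := fun k => P k * x k)
      (fun k _ => mul_nonneg (hP k) (hx k).le) (by simpa using hm))
  have hpos : 0 < 1 + P n * x n := add_pos_of_pos_of_nonneg one_pos (mul_nonneg (hP n) (hx n).le)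
  have h1 := Finset.sum_le_sum hle
  rw [← Finset.sum_div, sum_weightDrop] at h1
  rw [marginalRate_eq]
  have hxn := hx n
  calc x n / Real.log 2 * tailRate μ x P n
      ≤ x n / Real.log 2 * (μ n / (1 + P n * x n)) :=
        mul_le_mul_of_nonneg_left h1 (div_pos hxn h2).le
    _ < lam n := by
        rw [div_mul_div_comm, div_lt_iff₀ (mul_pos h2 hpos)]
        rw [div_le_iff₀ (mul_pos (hlam n) h2)] at h
        nlinarith [mul_pos (hlam n) h2]

/-- This bound does not depend on the gains. Later it provides the compactness, the Lipschitz
constants in the prices and the integrability of the powers. -/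
lemma IsKKT.le_bound (hμpos : ∀ n, 0 < μ n) (hμanti : Antitone μ) (hx : ∀ n, 0 < x n)
    (hlam : ∀ n, 0 < lam n) (h : IsKKT μ lam x P) (n : Fin N) :
    P n ≤ μ n / (lam n * Real.log 2) := by
  have h2 : 0 < Real.log 2 := Real.log_pos one_lt_two
  by_contra hcon
  rw [not_le] at hcon
  have hpos : 0 < P n := (div_pos (hμpos n) (mul_pos (hlam n) h2)).trans hcon
  exact (marginalRate_lt hμpos hμanti hx h.nonneg hlam hcon.le).ne (h.eq n hpos.ne')

lemma continuousAt_marginalRate_update (hx : ∀ n, 0 < x n) (hP : ∀ n, 0 ≤ P n) (n : Fin N) :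
    ContinuousAt (fun t => marginalRate μ x (Function.update P n t) n) (P n) := by
  unfold marginalRate
  refine continuousAt_const.mul (tendsto_finsetSum _ fun m _ => ?_)
  refine ContinuousAt.div continuousAt_const ?_ ?_
  · exact ((continuous_level x m).comp (continuous_const.update n continuous_id)).continuousAt
  · rw [Function.update_eq_self]
    exact (level_pos hx hP m).ne'

lemma nonneg_update (hP : ∀ n, 0 ≤ P n) {n : Fin N} {t : ℝ} (ht : 0 ≤ t) (k : Fin N) :
    0 ≤ Function.update P n t k := by
  by_cases hk : k = n
  · subst hk
    rwa [Function.update_self]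
  · rw [Function.update_of_ne hk]
    exact hP k

/-- The gradient inequality, based at the moved point and evaluated at `P`. Letting `t` tend to `P
n` gives the first-order conditions without differentiating the objective. -/
lemma marginalRate_update_mul_nonpos (hμpos : ∀ n, 0 < μ n) (hμanti : Antitone μ)
    (hx : ∀ n, 0 < x n) (hP : ∀ n, 0 ≤ P n) {n : Fin N} {t : ℝ} (ht : 0 ≤ t)
    (hmax : uplinkGain μ lam x (Function.update P n t) ≤ uplinkGain μ lam x P) :
    (t - P n) * (marginalRate μ x (Function.update P n t) n - lam n) ≤ 0 := by
  have h := uplinkGain_le_add (lam := lam) hμpos hμanti hx (nonneg_update hP (n := n) ht) hP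
  rw [Finset.sum_eq_single n, Function.update_self] at h
  · nlinarith
  · intro k _ hk
    rw [Function.update_of_ne hk, sub_self, zero_mul]
  · simp

/-- Maximisers in the direction of larger powers have marginal rates at most the price. -/
lemma marginalRate_le_of_eventually (hμpos : ∀ n, 0 < μ n) (hμanti : Antitone μ)
    (hx : ∀ n, 0 < x n) (hP : ∀ n, 0 ≤ P n) {n : Fin N}
    (hmax : ∀ᶠ t in 𝓝[>] (P n), uplinkGain μ lam x (Function.update P n t) ≤ uplinkGain μ lam x P) :
    marginalRate μ x P n ≤ lam n := by
  have hc := (continuousAt_marginalRate_update (μ := μ) hx hP n).tendsto.mono_left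
    (nhdsWithin_le_nhds (s := Set.Ioi (P n)))
  rw [Function.update_eq_self] at hc
  refine le_of_tendsto hc ?_
  filter_upwards [hmax, self_mem_nhdsWithin] with t ht hlt
  have h := marginalRate_update_mul_nonpos hμpos hμanti hx hP ((hP n).trans (le_of_lt hlt)) ht
  have hlt' : P n < t := hlt
  by_contra hcon
  rw [not_le] at hcon
  nlinarith [mul_pos (sub_pos.2 hlt') (sub_pos.2 hcon)]

lemma le_marginalRate_of_eventually (hμpos : ∀ n, 0 < μ n) (hμanti : Antitone μ)
    (hx : ∀ n, 0 < x n) (hP : ∀ n, 0 ≤ P n) {n : Fin N} (hn : 0 < P n)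
    (hmax : ∀ᶠ t in 𝓝[<] (P n), uplinkGain μ lam x (Function.update P n t) ≤ uplinkGain μ lam x P) :
    lam n ≤ marginalRate μ x P n := by
  have hc := (continuousAt_marginalRate_update (μ := μ) hx hP n).tendsto.mono_left
    (nhdsWithin_le_nhds (s := Set.Iio (P n)))
  rw [Function.update_eq_self] at hc
  refine ge_of_tendsto hc ?_
  filter_upwards [hmax, self_mem_nhdsWithin, Ioo_mem_nhdsLT hn] with t ht hlt hpos
  have h := marginalRate_update_mul_nonpos hμpos hμanti hx hP hpos.1.le ht
  have hlt' : t < P n := hlt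
  by_contra hcon
  rw [not_le] at hcon
  nlinarith [mul_pos (sub_pos.2 hlt') (sub_pos.2 hcon)]

/-- A maximiser over a box which contains all powers with marginal rates above the prices satisfies
the optimality conditions. -/
lemma isKKT_of_isMaxOn_box (hμpos : ∀ n, 0 < μ n) (hμanti : Antitone μ) (hx : ∀ n, 0 < x n)
    (hlam : ∀ n, 0 < lam n) {b : Fin N → ℝ} (hb : ∀ n, μ n / (lam n * Real.log 2) ≤ b n)
    (hP : ∀ n, 0 ≤ P n) (hPb : ∀ n, P n ≤ b n)
    (hmax : ∀ R, (∀ n, 0 ≤ R n) → (∀ n, R n ≤ b n) → uplinkGain μ lam x R ≤ uplinkGain μ lam x P) :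
    IsKKT μ lam x P := by
  have hup : ∀ (n : Fin N) (t : ℝ), 0 ≤ t → t ≤ b n →
      uplinkGain μ lam x (Function.update P n t) ≤ uplinkGain μ lam x P := by
    intro n t h0 hbt
    refine hmax _ (nonneg_update hP h0) fun k => ?_
    by_cases hk : k = n
    · subst hk
      rwa [Function.update_self]
    · rw [Function.update_of_ne hk]
      exact hPb k
  have hle : ∀ n, marginalRate μ x P n ≤ lam n := by
    intro n
    rcases (hPb n).lt_or_eq with hlt | heq
    · refine marginalRate_le_of_eventually hμpos hμanti hx hP ?_
      filter_upwards [Ioo_mem_nhdsGT hlt] with t ht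
      exact hup n t ((hP n).trans ht.1.le) ht.2.le
    -- On the upper face of the box no move upwards is available, but there the marginal rate is
    -- below the price anyway.
    · exact (marginalRate_lt hμpos hμanti hx hP hlam (heq ▸ hb n)).le
  refine ⟨hP, hle, fun n hn => le_antisymm (hle n) ?_⟩
  have hpos := lt_of_le_of_ne (hP n) (Ne.symm hn)
  refine le_marginalRate_of_eventually hμpos hμanti hx hP hpos ?_
  filter_upwards [Ioo_mem_nhdsLT hpos] with t ht
  exact hup n t ht.1.le (ht.2.le.trans (hPb n))

lemma isKKT_of_max (hμpos : ∀ n, 0 < μ n) (hμanti : Antitone μ) (hx : ∀ n, 0 < x n)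
    (hlam : ∀ n, 0 < lam n) (hP : ∀ n, 0 ≤ P n)
    (hmax : ∀ R, (∀ n, 0 ≤ R n) → uplinkGain μ lam x R ≤ uplinkGain μ lam x P) :
    IsKKT μ lam x P :=
  isKKT_of_isMaxOn_box (b := fun n => max (P n) (μ n / (lam n * Real.log 2))) hμpos hμanti hx hlam
    (fun _ => le_max_right _ _) hP (fun _ => le_max_left _ _) fun R hR _ => hmax R hR

lemma exists_isKKT (hμpos : ∀ n, 0 < μ n) (hμanti : Antitone μ) (hx : ∀ n, 0 < x n)
    (hlam : ∀ n, 0 < lam n) : ∃ P, IsKKT μ lam x P := by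
  have h2 : 0 < Real.log 2 := Real.log_pos one_lt_two
  set b : Fin N → ℝ := fun n => μ n / (lam n * Real.log 2)
  have hb : ∀ n, 0 ≤ b n := fun n => (div_pos (hμpos n) (mul_pos (hlam n) h2)).le
  have hcomp : IsCompact (Set.Icc (0 : Fin N → ℝ) b) := isCompact_Icc
  obtain ⟨P, hP, hmax⟩ := hcomp.exists_isMaxOn ⟨0, le_rfl, hb⟩
    ((continuousOn_uplinkGain μ lam hx).mono fun P hP n => hP.1 n)
  exact ⟨P, isKKT_of_isMaxOn_box hμpos hμanti hx hlam (fun n => le_rfl) hP.1 hP.2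
    fun R h0 h1 => hmax ⟨h0, h1⟩⟩

/-- The activity regions cover the positive gain vectors. -/
theorem exists_mem_region (hμpos : ∀ n, 0 < μ n) (hμanti : Antitone μ) (hx : ∀ n, 0 < x n)
    (hlam : ∀ n, 0 < lam n) : ∃ S, x ∈ region μ lam S := by
  obtain ⟨P, hP⟩ := exists_isKKT hμpos hμanti hx hlam
  exact hP.exists_mem_region hμpos hμanti hx hlam

lemma activePower_ne_zero_iff {S : Finset (Fin N)} (hS : x ∈ region μ lam S) (n : Fin N) :
    activePower μ lam S x n ≠ 0 ↔ n ∈ S :=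
  ⟨fun h => by_contra fun hn => h (activePower_of_notMem hn), fun h => (hS.2.1 n h).ne'⟩

/-- Both formulas give the unique optimal power vector, and the active set is its support. -/
lemma region_unique (hμpos : ∀ n, 0 < μ n) (hμanti : Antitone μ) (hx : ∀ n, 0 < x n)
    (hlam : ∀ n, 0 < lam n) (htie : NoTie μ lam x) {S T : Finset (Fin N)}
    (hS : x ∈ region μ lam S) (hT : x ∈ region μ lam T) : S = T := by
  have h := (isKKT_activePower hlam hμpos hS).unique hμpos hμanti hx
    (isKKT_activePower hlam hμpos hT) htie
  ext n
  rw [← activePower_ne_zero_iff hS, ← activePower_ne_zero_iff hT, h]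

theorem existsUnique_mem_region (hμpos : ∀ n, 0 < μ n) (hμanti : Antitone μ) (hx : ∀ n, 0 < x n)
    (hlam : ∀ n, 0 < lam n) (htie : NoTie μ lam x) : ∃! S, x ∈ region μ lam S := by
  obtain ⟨S, hS⟩ := exists_mem_region hμpos hμanti hx hlam
  exact ⟨S, hS, fun T hT => region_unique hμpos hμanti hx hlam htie hT hS⟩

end Existence

/-! ### Maximisation of the Lagrangian in one slot. -/

section Slot

variable {N : ℕ} {μ lam x P : Fin N → ℝ} {η' Pmax lam0 : ℝ}

/-- The value of the best downlink slot. -/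
def downlinkGain (η' Pmax : ℝ) (lam : Fin N → ℝ) (lam0 : ℝ) (x : Fin N → ℝ) : ℝ :=
  Pmax * max 0 (η' * ∑ n, lam n * x n - lam0)

/-- The threshold rule for the base station takes the positive part of the coefficient of its power.
-/
lemma bsPower_one_mul (hη : 0 < η') :
    bsPower η' Pmax lam lam0 x 1 * (η' * ∑ n, lam n * x n - lam0)
      = downlinkGain η' Pmax lam lam0 x := by
  unfold bsPower downlinkGain
  by_cases h : lam0 / η' ≤ ∑ n, lam n * x n
  · rw [if_pos ⟨h, rfl⟩, max_eq_right]
    rw [div_le_iff₀ hη] at h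
    linarith
  · rw [if_neg fun h' => h h'.1, max_eq_left]
    · simp
    · rw [div_le_iff₀ hη] at h
      linarith

lemma slotLagrangian_zero (hx : ∀ n, 0 < x n) (hP : ∀ n, 0 ≤ P n) (p0 : ℝ) :
    slotLagrangian μ η' lam lam0 x (0, p0, P) = uplinkGain μ lam x P := by
  simp only [slotLagrangian, slotObjective_zero hx hP, uplinkGain_eq]
  simp

lemma slotLagrangian_one (p0 : ℝ) (P : Fin N → ℝ) :
    slotLagrangian μ η' lam lam0 x (1, p0, P) = p0 * (η' * ∑ n, lam n * x n - lam0) := by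
  simp only [slotLagrangian, slotObjective_one]
  have : ∑ n, lam n * ((1 - 1) * P n - η' * 1 * p0 * x n) = - (p0 * (η' * ∑ n, lam n * x n)) := by
    rw [Finset.mul_sum, Finset.mul_sum, ← Finset.sum_neg_distrib]
    exact Finset.sum_congr rfl fun n _ => by ring
  rw [this]
  ring

lemma slotLagrangian_le (hμpos : ∀ n, 0 < μ n) (hμanti : Antitone μ) (hx : ∀ n, 0 < x n)
    (h : IsKKT μ lam x P) {u : ℝ × ℝ × (Fin N → ℝ)} (hu : u ∈ SlotActions N Pmax) :
    slotLagrangian μ η' lam lam0 x u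
      ≤ max (uplinkGain μ lam x P) (downlinkGain η' Pmax lam lam0 x) := by
  obtain ⟨a, p0, R⟩ := u
  obtain ⟨ha, ⟨h0, h1⟩, hR⟩ := hu
  simp only at ha h0 h1 hR
  rcases ha with rfl | rfl
  · rw [slotLagrangian_zero hx hR]
    exact (h.uplinkGain_le hμpos hμanti hx hR).trans (le_max_left _ _)
  · rw [slotLagrangian_one]
    refine le_trans ?_ (le_max_right _ _)
    calc p0 * (η' * ∑ n, lam n * x n - lam0)
        ≤ p0 * max 0 (η' * ∑ n, lam n * x n - lam0) :=
          mul_le_mul_of_nonneg_left (le_max_right _ _) h0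
      _ ≤ downlinkGain η' Pmax lam lam0 x := mul_le_mul_of_nonneg_right h1 (le_max_left _ _)

lemma selection_eq (hη : 0 < η') :
    selection μ η' Pmax lam lam0 x P
      = if downlinkGain η' Pmax lam lam0 x ≤ uplinkGain μ lam x P then 0 else 1 := by
  classical
  unfold selection
  rw [bsPower_one_mul hη]

/-- The selection inequality compares the values of the two modes, so with KKT powers the rules
attain the bound of `slotLagrangian_le`. -/
lemma slotLagrangian_rule (hη : 0 < η') (hx : ∀ n, 0 < x n) (hP : ∀ n, 0 ≤ P n) :
    slotLagrangian μ η' lam lam0 x (selection μ η' Pmax lam lam0 x P,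
      bsPower η' Pmax lam lam0 x (selection μ η' Pmax lam lam0 x P),
      fun n => (1 - selection μ η' Pmax lam lam0 x P) * P n)
      = max (uplinkGain μ lam x P) (downlinkGain η' Pmax lam lam0 x) := by
  rw [selection_eq hη]
  split_ifs with h
  · simp only [sub_zero, one_mul]
    rw [slotLagrangian_zero hx hP, max_eq_left h]
  · rw [slotLagrangian_one, bsPower_one_mul hη, max_eq_right (not_le.1 h).le]

lemma selection_eq_zero_or_one : selection μ η' Pmax lam lam0 x P = 0
    ∨ selection μ η' Pmax lam lam0 x P = 1 := by
  unfold selection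
  split_ifs
  · exact Or.inl rfl
  · exact Or.inr rfl

lemma bsPower_mem (hPmax : 0 ≤ Pmax) (a : ℝ) :
    0 ≤ bsPower η' Pmax lam lam0 x a ∧ bsPower η' Pmax lam lam0 x a ≤ Pmax := by
  unfold bsPower
  split_ifs
  · exact ⟨hPmax, le_rfl⟩
  · exact ⟨le_rfl, hPmax⟩

lemma rule_mem_slotActions (hPmax : 0 ≤ Pmax) (hP : ∀ n, 0 ≤ P n) :
    (selection μ η' Pmax lam lam0 x P,
      bsPower η' Pmax lam lam0 x (selection μ η' Pmax lam lam0 x P),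
      fun n => (1 - selection μ η' Pmax lam lam0 x P) * P n) ∈ SlotActions N Pmax := by
  refine ⟨selection_eq_zero_or_one, bsPower_mem hPmax _, fun n => mul_nonneg ?_ (hP n)⟩
  rcases selection_eq_zero_or_one (μ := μ) (η' := η') (Pmax := Pmax) (lam := lam) (lam0 := lam0)
    (x := x) (P := P) with h | h <;> simp [h]

end Slot

/-! ### Optimality of the rules on an arbitrary path. -/

section Average

variable {N : ℕ}

lemma avg_mono {f g : ℕ → ℝ} (h : ∀ i, f i ≤ g i) (M : ℕ) : avg f M ≤ avg g M :=
  div_le_div_of_nonneg_right (Finset.sum_le_sum fun i _ => h i) (Nat.cast_nonneg M)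

lemma avg_slotLagrangian (μ : Fin N → ℝ) (η' : ℝ) (lam : Fin N → ℝ) (lam0 : ℝ)
    (x : ℕ → Fin N → ℝ) (A : Alloc N) (M : ℕ) :
    avg (fun i => slotLagrangian μ η' lam lam0 (x i) (A.a i, A.P0 i, A.Pd i)) M
      = avgObjective μ x A M
        - ∑ n, lam n * (avg (fun i => (1 - A.a i) * A.Pd i n) M
            - avg (fun i => η' * A.a i * A.P0 i * x i n) M)
        - lam0 * avg (fun i => A.a i * A.P0 i) M := by
  simp only [avgObjective, avg, slotLagrangian, Finset.sum_sub_distrib, sub_div]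
  rw [Finset.sum_comm]
  congr 1
  · congr 1
    rw [Finset.sum_div]
    refine Finset.sum_congr rfl fun n _ => ?_
    rw [← Finset.mul_sum, mul_div_assoc, Finset.sum_sub_distrib, sub_div]
  · rw [← Finset.mul_sum, mul_div_assoc]

/-- Sufficiency of the threshold rules on an arbitrary fading path. -/
theorem isOptimal_of_followsRule {μ : Fin N → ℝ} (hμpos : ∀ n, 0 < μ n) (hμanti : Antitone μ)
    {η' Pmax Pavg : ℝ} (hη : 0 < η') {x : ℕ → Fin N → ℝ}
    (hx : ∀ i n, 0 < x i n) {lam : Fin N → ℝ} {lam0 : ℝ} (hlam : ∀ n, 0 < lam n) (hlam0 : 0 ≤ lam0)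
    {A : Alloc N} (hA : FollowsRule μ η' Pmax lam lam0 x A) (hfeas : IsFeasible η' Pmax Pavg x A)
    (hC3 : lam0 = 0 ∨ Tendsto (avg fun i => A.a i * A.P0 i) atTop (𝓝 Pavg)) :
    IsOptimal μ η' Pmax Pavg x A := by
  refine ⟨hfeas, fun A' hA' δ hδ => ?_⟩
  -- The comparison is made separately in every slot, so it does not matter how the competitor uses
  -- past or future gains.
  have hslot : ∀ i, slotLagrangian μ η' lam lam0 (x i) (A'.a i, A'.P0 i, A'.Pd i)
      ≤ slotLagrangian μ η' lam lam0 (x i) (A.a i, A.P0 i, A.Pd i) := by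
    intro i
    obtain ⟨S, hS, ha, hP0, hPd⟩ := hA i
    have hkkt := isKKT_activePower hlam hμpos hS
    rw [show A.Pd i = fun n => (1 - A.a i) * activePower μ lam S (x i) n from funext hPd, hP0, ha,
      slotLagrangian_rule hη (hx i) hkkt.nonneg]
    exact slotLagrangian_le hμpos hμanti (hx i) hkkt ⟨hA'.1 i, hA'.2.1 i, hA'.2.2.1 i⟩
  have hlagr := fun M => avg_mono hslot M
  simp_rw [avg_slotLagrangian] at hlagr
  have hbal : ∀ B : Alloc N, IsFeasible η' Pmax Pavg x B →
      Tendsto (fun M => ∑ n, lam n * (avg (fun i => (1 - B.a i) * B.Pd i n) M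
        - avg (fun i => η' * B.a i * B.P0 i * x i n) M)) atTop (𝓝 0) := by
    intro B hB
    have := tendsto_finsetSum Finset.univ fun n _ => (hB.2.2.2.1 n).const_mul (lam n)
    simpa using this
  have hb' : ∀ᶠ M in atTop, ∑ n, lam n * (avg (fun i => (1 - A'.a i) * A'.Pd i n) M
      - avg (fun i => η' * A'.a i * A'.P0 i * x i n) M) < δ / 3 :=
    (hbal A' hA').eventually_lt_const (by linarith)
  have hb : ∀ᶠ M in atTop, -(δ / 3) < ∑ n, lam n * (avg (fun i => (1 - A.a i) * A.Pd i n) M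
      - avg (fun i => η' * A.a i * A.P0 i * x i n) M) :=
    (hbal A hfeas).eventually_const_lt (by linarith)
  have hpow : ∀ᶠ M in atTop, lam0 * avg (fun i => A'.a i * A'.P0 i) M
      ≤ lam0 * avg (fun i => A.a i * A.P0 i) M + δ / 3 := by
    rcases hC3 with h0 | h0
    · refine Eventually.of_forall fun M => ?_
      rw [h0]
      linarith
    -- The power averages of the two allocations are each compared with `Pavg` up to `κ`, and `2 *
    -- lam0 * κ ≤ δ / 3`. The summand `1` keeps the denominator positive.
    · set κ := δ / (6 * (lam0 + 1)) with hκ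
      have hκpos : 0 < κ := by positivity
      have hκle : lam0 * κ ≤ δ / 6 := by
        rw [hκ, mul_div_assoc', div_le_div_iff₀ (by positivity) (by norm_num)]
        nlinarith
      filter_upwards [hA'.2.2.2.2 κ hκpos, h0.eventually_const_lt (sub_lt_self Pavg hκpos)]
        with M h1 h2
      have h3 := mul_le_mul_of_nonneg_left h1 hlam0
      have h4 := mul_le_mul_of_nonneg_left h2.le hlam0
      linarith
  filter_upwards [hb, hb', hpow] with M h1 h2 h3
  have := hlagr M
  linarith

end Average

/-! ### Ties between users and ties between modes are null sets. -/

section NullSets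

/-- A measurable set whose slices in some coordinate direction are countable is null for a product
of atomless measures. -/
lemma pi_eq_zero_of_countable_slices {ι : Type*} [Fintype ι] [DecidableEq ι] (ρ : ι → Measure ℝ)
    [∀ i, SigmaFinite (ρ i)] (hρ : ∀ i t, ρ i {t} = 0) {E : Set (ι → ℝ)} (hE : MeasurableSet E)
    (i : ι) (h : ∀ y : ι → ℝ, {t | Function.update y i t ∈ E}.Countable) :
    Measure.pi ρ E = 0 := by
  have hatom : NullSingletonClass (ρ i) := ⟨hρ i⟩
  have hm : Measurable (E.indicator (1 : (ι → ℝ) → ENNReal)) := measurable_one.indicator hE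
  rw [← lintegral_indicator_one hE, lintegral_eq_lmarginal_univ (0 : ι → ℝ),
    lmarginal_erase' _ hm (Finset.mem_univ i)]
  -- Coordinate `i` is integrated first; a countable slice is null for the atomless `ρ i`.
  have hz : (fun x : ι → ℝ => ∫⁻ t, E.indicator (1 : (ι → ℝ) → ENNReal) (Function.update x i t) ∂ρ i)
      = 0 := by
    funext y
    have : ∀ᵐ t ∂ρ i, E.indicator (1 : (ι → ℝ) → ENNReal) (Function.update y i t) = 0 := by
      filter_upwards [(h y).ae_notMem (ρ i)] with t ht
      exact Set.indicator_of_notMem ht _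
    rw [lintegral_congr_ae this]
    simp
  rw [hz]
  simp [lmarginal]

lemma countable_setOf_quadratic_eq_zero {a : ℝ} (ha : a ≠ 0) (b c : ℝ) :
    {t : ℝ | a * t ^ 2 + b * t + c = 0}.Countable := by
  by_cases hne : ∃ t₁ : ℝ, a * t₁ ^ 2 + b * t₁ + c = 0
  · obtain ⟨t₁, h₁⟩ := hne
    -- By Vieta, a root other than `t₁` equals `-b / a - t₁`.
    refine Set.Countable.mono (s₂ := {t₁, -b / a - t₁}) (fun t ht => ?_) (Set.to_countable _)
    have ht' : a * t ^ 2 + b * t + c = 0 := ht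
    by_cases h : t = t₁
    · exact Or.inl h
    · right
      have h2 : (t - t₁) * (a * (t + t₁) + b) = 0 := by linear_combination ht' - h₁
      have h3 := (mul_eq_zero.1 h2).resolve_left (sub_ne_zero.2 h)
      rw [Set.mem_singleton_iff, eq_sub_iff_add_eq, eq_div_iff ha]
      linarith
  · convert Set.countable_empty
    ext t
    simp only [Set.mem_ofPred_eq, Set.mem_empty_iff_false, iff_false]
    exact fun h => hne ⟨t, h⟩

variable {N : ℕ} {μ lam x P : Fin N → ℝ}

lemma measurable_upperTerm (μ lam : Fin N → ℝ) (S : Finset (Fin N)) (n : Fin N) :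
    Measurable fun x => upperTerm μ lam S x n := by
  unfold upperTerm
  split_ifs
  · fun_prop
  · exact measurable_const

lemma measurable_lowerTerm (μ lam : Fin N → ℝ) (S : Finset (Fin N)) (n : Fin N) :
    Measurable fun x => lowerTerm μ lam S x n := by
  unfold lowerTerm
  split_ifs
  · fun_prop
  · fun_prop

lemma measurable_activePower (μ lam : Fin N → ℝ) (S : Finset (Fin N)) (n : Fin N) :
    Measurable fun x => activePower μ lam S x n := by
  unfold activePower
  split_ifs
  · exact (measurable_upperTerm μ lam S n).sub (measurable_lowerTerm μ lam S n)
  · exact measurable_const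

lemma measurable_level {P : (Fin N → ℝ) → Fin N → ℝ} (hP : ∀ n, Measurable fun x => P x n)
    (n : Fin N) : Measurable fun x => level x (P x) n := by
  unfold level
  exact measurable_const.add (Finset.measurable_fun_sum _ fun k _ =>
    (hP k).mul (measurable_pi_apply k))

lemma measurable_marginalRate (μ : Fin N → ℝ) {P : (Fin N → ℝ) → Fin N → ℝ}
    (hP : ∀ n, Measurable fun x => P x n) (n : Fin N) :
    Measurable fun x => marginalRate μ x (P x) n := by
  unfold marginalRate
  exact ((measurable_pi_apply n).div_const _).mul (Finset.measurable_fun_sum _ fun m _ =>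
    measurable_const.div (measurable_level hP m))

lemma measurable_uplinkGain (μ lam : Fin N → ℝ) {P : (Fin N → ℝ) → Fin N → ℝ}
    (hP : ∀ n, Measurable fun x => P x n) : Measurable fun x => uplinkGain μ lam x (P x) := by
  unfold uplinkGain
  refine Measurable.sub ?_ ?_
  · exact Finset.measurable_fun_sum _ fun n _ =>
      ((measurable_level hP n).log.div_const (Real.log 2)).const_mul (μ n - nextWeight μ n)
  · exact Finset.measurable_fun_sum _ fun n _ => measurable_const.mul (hP n)

lemma measurableSet_region (μ lam : Fin N → ℝ) (S : Finset (Fin N)) :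
    MeasurableSet (region μ lam S) := by
  unfold region
  refine MeasurableSet.inter (s₁ := {x | ∀ n, 0 < x n}) ?_ (MeasurableSet.inter
    (s₁ := {x | ∀ n ∈ S, 0 < activePower μ lam S x n}) ?_ ?_)
  · rw [Set.ofPred_forall]
    exact MeasurableSet.iInter fun n => measurableSet_lt measurable_const (measurable_pi_apply n)
  · simp only [Set.ofPred_forall]
    exact MeasurableSet.iInter fun n => MeasurableSet.iInter fun _ =>
      measurableSet_lt measurable_const (measurable_activePower μ lam S n)
  · change MeasurableSet {x | ∀ n ∉ S, marginalRate μ x (activePower μ lam S x) n ≤ lam n}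
    simp only [Set.ofPred_forall]
    exact MeasurableSet.iInter fun n => MeasurableSet.iInter fun _ =>
      measurableSet_le (measurable_marginalRate μ (fun k => measurable_activePower μ lam S k) n)
        measurable_const

/-- The power of the formula in the region of the gain vector, as a measurable function. -/
def rulePower (μ lam x : Fin N → ℝ) (n : Fin N) : ℝ :=
  ∑ S, (region μ lam S).indicator (fun x => activePower μ lam S x n) x

lemma measurable_rulePower (μ lam : Fin N → ℝ) (n : Fin N) :
    Measurable fun x => rulePower μ lam x n :=
  Finset.measurable_fun_sum _ fun S _ =>
    (measurable_activePower μ lam S n).indicator (measurableSet_region μ lam S)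

lemma rulePower_eq (hμpos : ∀ n, 0 < μ n) (hμanti : Antitone μ)
    (hlam : ∀ n, 0 < lam n) (htie : NoTie μ lam x) {S : Finset (Fin N)}
    (hS : x ∈ region μ lam S) : rulePower μ lam x = activePower μ lam S x := by
  funext n
  rw [rulePower, Finset.sum_eq_single S, Set.indicator_of_mem hS]
  · exact fun T _ hT => Set.indicator_of_notMem
      (fun hmem => hT (region_unique hμpos hμanti hS.1 hlam htie hmem hS)) _
  · simp

lemma isKKT_rulePower (hμpos : ∀ n, 0 < μ n) (hμanti : Antitone μ) (hx : ∀ n, 0 < x n)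
    (hlam : ∀ n, 0 < lam n) (htie : NoTie μ lam x) : IsKKT μ lam x (rulePower μ lam x) := by
  obtain ⟨S, hS⟩ := exists_mem_region hμpos hμanti hx hlam
  rw [rulePower_eq hμpos hμanti hlam htie hS]
  exact isKKT_activePower hlam hμpos hS

lemma measurableSet_pos : MeasurableSet {x : Fin N → ℝ | ∀ n, 0 < x n} := by
  rw [Set.ofPred_forall]
  exact MeasurableSet.iInter fun n => measurableSet_lt measurable_const (measurable_pi_apply n)

lemma measurableSet_noTie (μ lam : Fin N → ℝ) : MeasurableSet {x | NoTie μ lam x} := by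
  unfold NoTie
  simp only [Set.ofPred_forall]
  refine MeasurableSet.iInter fun m => MeasurableSet.iInter fun n => MeasurableSet.iInter fun _ =>
    MeasurableSet.iInter fun _ => (measurableSet_eq_fun ?_ ?_).compl
  · exact measurable_const.div (measurable_pi_apply m)
  · exact measurable_const.div (measurable_pi_apply n)

/-- When all gains but `x m` are fixed, equality of the two ratios leaves at most one positive value
for `x m`. -/
lemma ae_noTie {ν : Measure (Fin N → ℝ)} (hν : IsContinuousLaw ν)
    (hpos : ∀ᵐ x ∂ν, ∀ n, 0 < x n) (hlam : ∀ n, 0 < lam n) : ∀ᵐ x ∂ν, NoTie μ lam x := by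
  obtain ⟨ρ, hσ, hρ, hac⟩ := hν
  have hpair : ∀ m n : Fin N, ∀ᵐ x ∂ν, m ≠ n → (∀ k, 0 < x k) → lam m / x m ≠ lam n / x n := by
    intro m n
    by_cases hmn : m = n
    · exact Eventually.of_forall fun x h => absurd hmn h
    have hE : MeasurableSet {x : Fin N → ℝ | (∀ k, 0 < x k) ∧ lam m / x m = lam n / x n} :=
      measurableSet_pos.inter (measurableSet_eq_fun
        (measurable_const.div (measurable_pi_apply m)) (measurable_const.div (measurable_pi_apply n)))
    have hz := pi_eq_zero_of_countable_slices ρ hρ hE m fun y => by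
      refine Set.Subsingleton.countable fun s hs t ht => ?_
      obtain ⟨hs0, hs⟩ := hs
      obtain ⟨ht0, ht⟩ := ht
      have hs1 := hs0 m
      have ht1 := ht0 m
      rw [Function.update_self] at hs1 ht1 hs ht
      rw [Function.update_of_ne (Ne.symm hmn)] at hs ht
      have := hs.trans ht.symm
      have hl := (hlam m).ne'
      have := hs1.ne'
      have := ht1.ne'
      field_simp at *
      linarith
    filter_upwards [measure_eq_zero_iff_ae_notMem.1 (hac hz)] with x hx _ hxpos heq
    exact hx ⟨hxpos, heq⟩
  filter_upwards [hpos, ae_all_iff.2 fun m => ae_all_iff.2 fun n => hpair m n] with x hx h m n hmn _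
  exact h m n hmn hx

lemma level_update_gain (x P : Fin N → ℝ) {n : Fin N} {t : ℝ} (ht : t ≠ 0) (m : Fin N) :
    level (Function.update x n t) (Function.update P n (P n * x n / t)) m = level x P m := by
  unfold level
  congr 1
  refine Finset.sum_congr rfl fun k _ => ?_
  by_cases hk : k = n
  · subst hk
    simp only [Function.update_self]
    field_simp
  · simp only [Function.update_of_ne hk]

/-- Rescaling the power of a user keeps the rates when its gain changes. -/
lemma uplinkGain_update_gain (μ lam x P : Fin N → ℝ) {n : Fin N} {t : ℝ} (ht : t ≠ 0) :
    uplinkGain μ lam (Function.update x n t) (Function.update P n (P n * x n / t))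
      = uplinkGain μ lam x P - lam n * (P n * x n / t - P n) := by
  simp only [uplinkGain_eq, level_update_gain x P ht]
  have : ∑ k, lam k * Function.update P n (P n * x n / t) k
      = ∑ k, lam k * P k + lam n * (P n * x n / t - P n) := by
    rw [← sub_eq_iff_eq_add', ← Finset.sum_sub_distrib, Finset.sum_eq_single n]
    · rw [Function.update_self]; ring
    · intro k _ hk
      rw [Function.update_of_ne hk, sub_self]
    · simp
  rw [this]
  ring

lemma sum_mul_update (lam x : Fin N → ℝ) (n : Fin N) (t : ℝ) :
    ∑ k, lam k * Function.update x n t k = ∑ k, lam k * x k + lam n * (t - x n) := by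
  rw [← sub_eq_iff_eq_add', ← Finset.sum_sub_distrib, Finset.sum_eq_single n]
  · rw [Function.update_self]; ring
  · intro k _ hk
    rw [Function.update_of_ne hk, sub_self]
  · simp

variable {η' Pmax lam0 : ℝ}

/-- The gain vectors without ties at which uplink and downlink are equally good. -/
def modeTie (μ : Fin N → ℝ) (η' Pmax : ℝ) (lam : Fin N → ℝ) (lam0 : ℝ) : Set (Fin N → ℝ) :=
  {x | (∀ n, 0 < x n) ∧ NoTie μ lam x ∧
    uplinkGain μ lam x (rulePower μ lam x) = Pmax * (η' * ∑ n, lam n * x n - lam0)}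

lemma measurableSet_modeTie : MeasurableSet (modeTie μ η' Pmax lam lam0) :=
  measurableSet_pos.inter ((measurableSet_noTie μ lam).inter
    (measurableSet_eq_fun (measurable_uplinkGain μ lam (measurable_rulePower μ lam))
      (by fun_prop)))

/-- The envelope inequality between two points of `modeTie` on a line in direction `n`. -/
lemma modeTie_mul_le (hμpos : ∀ n, 0 < μ n) (hμanti : Antitone μ) (hlam : ∀ n, 0 < lam n)
    {n : Fin N} {t : ℝ} (hx : x ∈ modeTie μ η' Pmax lam lam0)
    (hy : Function.update x n t ∈ modeTie μ η' Pmax lam lam0) :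
    rulePower μ lam x n * (t - x n) ≤ Pmax * η' * t * (t - x n) := by
  obtain ⟨hx0, hxt, hxe⟩ := hx
  obtain ⟨hy0, hyt, hye⟩ := hy
  have ht : 0 < t := by simpa using hy0 n
  have hP := isKKT_rulePower hμpos hμanti hx0 hlam hxt
  have hR := isKKT_rulePower hμpos hμanti hy0 hlam hyt
  -- At the second point the optimum is compared with the powers of the first, the `n`-th rescaled
  -- to keep the received power. Only the cost of user `n` changes, and both optimal values are
  -- known from the mode equation.
  have h := hR.uplinkGain_le hμpos hμanti hy0
    (nonneg_update hP.nonneg (n := n) (t := rulePower μ lam x n * x n / t)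
      (div_nonneg (mul_nonneg (hP.nonneg n) (hx0 n).le) ht.le))
  rw [uplinkGain_update_gain μ lam x _ ht.ne', hye, hxe, sum_mul_update] at h
  have h1 : lam n * (rulePower μ lam x n * x n / t - rulePower μ lam x n)
      = - (lam n * (rulePower μ lam x n * (t - x n)) / t) := by
    field_simp
    ring
  rw [h1] at h
  have h2 : lam n * (rulePower μ lam x n * (t - x n)) / t
      ≤ lam n * (Pmax * η' * (t - x n)) := by linarith
  rw [div_le_iff₀ ht] at h2
  have h3 : lam n * (rulePower μ lam x n * (t - x n)) ≤ lam n * (Pmax * η' * t * (t - x n)) := by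
    linarith
  exact le_of_mul_le_mul_left h3 (hlam n)

/-- Where mode ties accumulate from both sides of `t` along the slice, dividing the envelope
inequality by `s - t` and letting `s` tend to `t` gives both inequalities for `P_n = Pmax * η' * t`.
The remaining points are isolated on the left or on the right within the slice, and there are only
countably many of these. -/
lemma countable_slice_modeTie (hμpos : ∀ n, 0 < μ n) (hμanti : Antitone μ) (hlam : ∀ n, 0 < lam n)
    (n : Fin N) (y : Fin N → ℝ) :
    {t | Function.update y n t ∈ modeTie μ η' Pmax lam lam0 ∩
      {x | rulePower μ lam x n ≠ Pmax * η' * x n}}.Countable := by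
  set E := {t | Function.update y n t ∈ modeTie μ η' Pmax lam lam0}
  refine ((countable_setOfPred_isolated_right_within (s := E)).union
    (countable_setOfPred_isolated_left_within (s := E))).mono fun t ⟨ht, hne⟩ => ?_
  by_contra hcon
  rw [Set.mem_union, not_or] at hcon
  have hr : (𝓝[E ∩ Set.Ioi t] t).NeBot := ⟨fun h => hcon.1 ⟨ht, h⟩⟩
  have hl : (𝓝[E ∩ Set.Iio t] t).NeBot := ⟨fun h => hcon.2 ⟨ht, h⟩⟩
  refine hne ?_
  have key : ∀ s ∈ E, rulePower μ lam (Function.update y n t) n * (s - t)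
      ≤ Pmax * η' * s * (s - t) := by
    intro s hs
    have h := modeTie_mul_le (n := n) (t := s) hμpos hμanti hlam ht
      (by rw [Function.update_idem]; exact hs)
    rwa [Function.update_self] at h
  have hlim : Tendsto (fun s : ℝ => Pmax * η' * s) (𝓝 t) (𝓝 (Pmax * η' * t)) :=
    (continuous_const.mul continuous_id).tendsto t
  rw [Function.update_self]
  refine le_antisymm ?_ ?_
  · refine ge_of_tendsto (hlim.mono_left (nhdsWithin_le_nhds (s := E ∩ Set.Ioi t))) ?_
    filter_upwards [self_mem_nhdsWithin] with s hs
    exact le_of_mul_le_mul_right (key s hs.1) (sub_pos.2 hs.2)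
  · refine le_of_tendsto (hlim.mono_left (nhdsWithin_le_nhds (s := E ∩ Set.Iio t))) ?_
    filter_upwards [self_mem_nhdsWithin] with s hs
    have h1 : 0 < t - s := sub_pos.2 hs.2
    have h2 := key s hs.1
    refine le_of_mul_le_mul_right ?_ h1
    linarith

/-- All users are active here. The last level is `1 + Pmax * η' * ∑ x_k ^ 2`, and stationarity of
the last user, whose tail rate is `μ_l / level_l`, is the equation. -/
lemma quadratic_of_rulePower_eq (hμpos : ∀ n, 0 < μ n) (hμanti : Antitone μ)
    (hlam : ∀ n, 0 < lam n) (hη : 0 < η') (hPmax : 0 < Pmax)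
    (hx : x ∈ modeTie μ η' Pmax lam lam0)
    (h : ∀ n, rulePower μ lam x n = Pmax * η' * x n) {l : Fin N} (hl : ∀ k, k ≤ l) :
    lam l * Real.log 2 * (1 + Pmax * η' * ∑ k, x k ^ 2) = μ l * x l := by
  obtain ⟨hx0, hxt, -⟩ := hx
  have hP := isKKT_rulePower hμpos hμanti hx0 hlam hxt
  have hne : rulePower μ lam x l ≠ 0 := by
    rw [h l]
    exact (mul_pos (mul_pos hPmax hη) (hx0 l)).ne'
  have hq := hP.ratio_eq hx0 hne
  rw [tailRate_of_last (S := Finset.univ) (by simp) (fun i _ => not_lt.2 (hl i))] at hq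
  have hlev : level x (rulePower μ lam x) l = 1 + Pmax * η' * ∑ k, x k ^ 2 := by
    rw [level, Finset.filter_true_of_mem (fun k _ => hl k), Finset.mul_sum]
    congr 1
    exact Finset.sum_congr rfl fun k _ => by rw [h k]; ring
  have hpos := level_pos hx0 hP.nonneg l
  rw [hlev] at hq hpos
  have h2 : Real.log 2 ≠ 0 := (Real.log_pos one_lt_two).ne'
  have := (hx0 l).ne'
  have := hpos.ne'
  generalize 1 + Pmax * η' * ∑ k, x k ^ 2 = L at *
  field_simp at hq
  linarith

/-- Either the envelope equation fails for some `n`, and the slices in direction `n` are countable,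
or it holds for all users, and the gain of the last user is a root of a nondegenerate quadratic. -/
lemma ae_notMem_modeTie {ν : Measure (Fin N → ℝ)} (hν : IsContinuousLaw ν)
    (hN : 0 < N) (hμpos : ∀ n, 0 < μ n) (hμanti : Antitone μ)
    (hlam : ∀ n, 0 < lam n) (hη : 0 < η') (hPmax : 0 < Pmax) :
    ∀ᵐ x ∂ν, x ∉ modeTie μ η' Pmax lam lam0 := by
  obtain ⟨ρ, hσ, hρ, hac⟩ := hν
  have h1 : ∀ᵐ x ∂ν, ∀ n, x ∉ modeTie μ η' Pmax lam lam0 ∩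
      {x | rulePower μ lam x n ≠ Pmax * η' * x n} := by
    refine ae_all_iff.2 fun n => measure_eq_zero_iff_ae_notMem.1 (hac ?_)
    refine pi_eq_zero_of_countable_slices ρ hρ ?_ n
      fun y => countable_slice_modeTie hμpos hμanti hlam n y
    exact measurableSet_modeTie.inter
      (measurableSet_eq_fun (measurable_rulePower μ lam n) (by fun_prop)).compl
  obtain ⟨l, hl⟩ : ∃ l : Fin N, ∀ k, k ≤ l :=
    ⟨⟨N - 1, by omega⟩, fun k => by rw [Fin.le_def]; simp only; omega⟩
  have h2 : ∀ᵐ x ∂ν, x ∉ {x : Fin N → ℝ |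
      lam l * Real.log 2 * (1 + Pmax * η' * ∑ k, x k ^ 2) = μ l * x l} := by
    refine measure_eq_zero_iff_ae_notMem.1 (hac ?_)
    refine pi_eq_zero_of_countable_slices ρ hρ (measurableSet_eq_fun (by fun_prop) (by fun_prop)) l
      fun y => ?_
    have hlog := Real.log_pos one_lt_two
    have ha : lam l * Real.log 2 * (Pmax * η') ≠ 0 :=
      (mul_pos (mul_pos (hlam l) hlog) (mul_pos hPmax hη)).ne'
    refine (countable_setOf_quadratic_eq_zero ha (-μ l) (lam l * Real.log 2 *
      (1 + Pmax * η' * (∑ k, y k ^ 2 - y l ^ 2)))).mono fun t ht => ?_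
    have hsum : ∑ k, Function.update y l t k ^ 2 = ∑ k, y k ^ 2 - y l ^ 2 + t ^ 2 := by
      rw [← Finset.add_sum_erase _ _ (Finset.mem_univ l),
        ← Finset.add_sum_erase _ (fun k => y k ^ 2) (Finset.mem_univ l), Function.update_self]
      rw [Finset.sum_congr rfl fun k hk => by
        rw [Function.update_of_ne (Finset.ne_of_mem_erase hk)]]
      ring
    simp only [Set.mem_ofPred_eq, hsum, Function.update_self] at ht ⊢
    linarith
  filter_upwards [h1, h2] with x hx1 hx2 hmem
  refine hx2 (quadratic_of_rulePower_eq hμpos hμanti hlam hη hPmax hmem (fun n => ?_) hl)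
  by_contra hne
  exact hx1 n ⟨hmem, hne⟩

/-- For almost all gain vectors the users and the two modes are not tied. -/
theorem ae_generic {ν : Measure (Fin N → ℝ)} (hν : IsContinuousLaw ν)
    (hpos : ∀ᵐ x ∂ν, ∀ n, 0 < x n) (hN : 0 < N) (hμpos : ∀ n, 0 < μ n) (hμanti : Antitone μ)
    (hlam : ∀ n, 0 < lam n) (hη : 0 < η') (hPmax : 0 < Pmax) (lam0 : ℝ) :
    ∀ᵐ x ∂ν, (∀ n, 0 < x n) ∧ NoTie μ lam x ∧
      uplinkGain μ lam x (rulePower μ lam x) ≠ Pmax * (η' * ∑ n, lam n * x n - lam0) := by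
  filter_upwards [hpos, ae_noTie (μ := μ) hν hpos hlam,
    ae_notMem_modeTie (lam0 := lam0) hν hN hμpos hμanti hlam hη hPmax] with x h1 h2 h3
  exact ⟨h1, h2, fun h => h3 ⟨h1, h2, h⟩⟩

end NullSets

/-! ### The optimal slot value: Lipschitz bounds and derivatives in the prices. -/

section Value

variable {N : ℕ} {μ lam lam' v x P R : Fin N → ℝ} {η' Pmax lam0 lam0' w : ℝ}

open Classical in
/-- A power vector that satisfies the optimality conditions. -/
def optPower (μ lam x : Fin N → ℝ) : Fin N → ℝ :=
  if h : ∃ P, IsKKT μ lam x P then h.choose else 0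

lemma isKKT_optPower (hμpos : ∀ n, 0 < μ n) (hμanti : Antitone μ) (hx : ∀ n, 0 < x n)
    (hlam : ∀ n, 0 < lam n) : IsKKT μ lam x (optPower μ lam x) := by
  have h := exists_isKKT hμpos hμanti hx hlam
  rw [optPower, dif_pos h]
  exact h.choose_spec

lemma optPower_eq_rulePower (hμpos : ∀ n, 0 < μ n) (hμanti : Antitone μ) (hx : ∀ n, 0 < x n)
    (hlam : ∀ n, 0 < lam n) (htie : NoTie μ lam x) : optPower μ lam x = rulePower μ lam x :=
  (isKKT_optPower hμpos hμanti hx hlam).unique hμpos hμanti hx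
    (isKKT_rulePower hμpos hμanti hx hlam htie) htie

/-- The value of the best uplink slot. -/
def uplinkValue (μ lam x : Fin N → ℝ) : ℝ := uplinkGain μ lam x (optPower μ lam x)

/-- The value of the best slot. -/
def slotValue (μ : Fin N → ℝ) (η' Pmax : ℝ) (lam : Fin N → ℝ) (lam0 : ℝ) (x : Fin N → ℝ) : ℝ :=
  max (uplinkValue μ lam x) (downlinkGain η' Pmax lam lam0 x)

lemma uplinkGain_le_uplinkValue (hμpos : ∀ n, 0 < μ n) (hμanti : Antitone μ) (hx : ∀ n, 0 < x n)
    (hlam : ∀ n, 0 < lam n) (hR : ∀ n, 0 ≤ R n) :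
    uplinkGain μ lam x R ≤ uplinkValue μ lam x :=
  (isKKT_optPower hμpos hμanti hx hlam).uplinkGain_le hμpos hμanti hx hR

lemma level_zero (x : Fin N → ℝ) (n : Fin N) : level x 0 n = 1 := by simp [level]

lemma uplinkGain_zero (μ lam x : Fin N → ℝ) : uplinkGain μ lam x 0 = 0 := by
  simp [uplinkGain, level_zero]

lemma uplinkValue_nonneg (hμpos : ∀ n, 0 < μ n) (hμanti : Antitone μ) (hx : ∀ n, 0 < x n)
    (hlam : ∀ n, 0 < lam n) : 0 ≤ uplinkValue μ lam x := by
  rw [← uplinkGain_zero μ lam x]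
  exact uplinkGain_le_uplinkValue hμpos hμanti hx hlam fun _ => le_rfl

lemma downlinkGain_nonneg (hPmax : 0 ≤ Pmax) : 0 ≤ downlinkGain η' Pmax lam lam0 x :=
  mul_nonneg hPmax (le_max_left _ _)

lemma uplinkGain_sub (μ lam lam' x P : Fin N → ℝ) :
    uplinkGain μ lam' x P = uplinkGain μ lam x P - ∑ n, (lam' n - lam n) * P n := by
  simp only [uplinkGain_eq, sub_mul, Finset.sum_sub_distrib]
  ring

/-- The gradient inequality at zero power, where all levels are `1` and the drops sum to the
weights. With bounded powers the bound is linear in the gains, hence integrable. -/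
lemma uplinkGain_le_sum (hμpos : ∀ n, 0 < μ n) (hμanti : Antitone μ) (hx : ∀ n, 0 < x n)
    (hlam : ∀ n, 0 < lam n) (hR : ∀ n, 0 ≤ R n) :
    uplinkGain μ lam x R ≤ ∑ n, R n * (x n / Real.log 2 * μ n) := by
  have h := uplinkGain_le_add (lam := lam) hμpos hμanti hx (P := 0) (fun _ => le_rfl) hR
  rw [uplinkGain_zero, zero_add] at h
  refine h.trans (Finset.sum_le_sum fun n _ => ?_)
  have : marginalRate μ x 0 n = x n / Real.log 2 * μ n := by
    rw [marginalRate_eq, tailRate]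
    simp only [level_zero, div_one, sum_weightDrop]
  rw [this, Pi.zero_apply, sub_zero]
  exact mul_le_mul_of_nonneg_left (by linarith [hlam n]) (hR n)

lemma uplinkValue_le_sum (hμpos : ∀ n, 0 < μ n) (hμanti : Antitone μ) (hx : ∀ n, 0 < x n)
    (hlam : ∀ n, 0 < lam n) :
    uplinkValue μ lam x ≤ ∑ n, μ n / (lam n * Real.log 2) * (x n / Real.log 2 * μ n) := by
  have h2 : 0 < Real.log 2 := Real.log_pos one_lt_two
  have h := isKKT_optPower hμpos hμanti hx hlam
  refine (uplinkGain_le_sum hμpos hμanti hx hlam h.nonneg).trans (Finset.sum_le_sum fun n _ => ?_)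
  exact mul_le_mul_of_nonneg_right (h.le_bound hμpos hμanti hx hlam n)
    (mul_pos (div_pos (hx n) h2) (hμpos n)).le

/-- The optimal powers for `lam'` are admissible for `lam` and bounded by `μ n / (δ n * log 2)`;
only their cost changes. -/
lemma uplinkValue_le_add (hμpos : ∀ n, 0 < μ n) (hμanti : Antitone μ) (hx : ∀ n, 0 < x n)
    {δ : Fin N → ℝ} (hδ : ∀ n, 0 < δ n) (hlam : ∀ n, δ n ≤ lam n)
    (hlam' : ∀ n, δ n ≤ lam' n) :
    uplinkValue μ lam' x
      ≤ uplinkValue μ lam x + ∑ n, |lam' n - lam n| * (μ n / (δ n * Real.log 2)) := by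
  have h2 : 0 < Real.log 2 := Real.log_pos one_lt_two
  have hpos : ∀ n, 0 < lam n := fun n => (hδ n).trans_le (hlam n)
  have hpos' : ∀ n, 0 < lam' n := fun n => (hδ n).trans_le (hlam' n)
  have h := isKKT_optPower hμpos hμanti hx hpos'
  have h1 := uplinkGain_le_uplinkValue hμpos hμanti hx hpos h.nonneg
  rw [uplinkValue, uplinkGain_sub μ lam lam', sub_eq_add_neg, ← Finset.sum_neg_distrib]
  refine add_le_add h1 (Finset.sum_le_sum fun n _ => ?_)
  rw [← neg_mul]
  refine mul_le_mul (neg_le_abs _) ?_ (h.nonneg n) (abs_nonneg _)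
  refine (h.le_bound hμpos hμanti hx hpos' n).trans ?_
  exact div_le_div_of_nonneg_left (hμpos n).le (mul_pos (hδ n) h2)
    (mul_le_mul_of_nonneg_right (hlam' n) h2.le)

lemma downlinkGain_le_add (hη : 0 < η') (hPmax : 0 < Pmax) (hx : ∀ n, 0 < x n) :
    downlinkGain η' Pmax lam' lam0' x ≤ downlinkGain η' Pmax lam lam0 x
      + (∑ n, |lam' n - lam n| * (Pmax * η' * x n) + Pmax * |lam0' - lam0|) := by
  have h1 : ∑ n, lam' n * x n ≤ ∑ n, lam n * x n + ∑ n, |lam' n - lam n| * x n := by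
    rw [← Finset.sum_add_distrib]
    refine Finset.sum_le_sum fun n _ => ?_
    have := mul_le_mul_of_nonneg_right (le_abs_self (lam' n - lam n)) (hx n).le
    linarith
  have h2 : ∑ n, |lam' n - lam n| * (Pmax * η' * x n)
      = Pmax * (η' * ∑ n, |lam' n - lam n| * x n) := by
    rw [Finset.mul_sum, Finset.mul_sum]
    exact Finset.sum_congr rfl fun n _ => by ring
  have h3 : 0 ≤ ∑ n, |lam' n - lam n| * x n :=
    Finset.sum_nonneg fun n _ => mul_nonneg (abs_nonneg _) (hx n).le
  rw [h2, downlinkGain, downlinkGain, ← mul_add, ← mul_add]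
  refine mul_le_mul_of_nonneg_left (max_le ?_ ?_) hPmax.le
  · have := le_max_left 0 (η' * ∑ n, lam n * x n - lam0)
    have := mul_nonneg hη.le h3
    linarith [abs_nonneg (lam0' - lam0)]
  · have := le_max_right 0 (η' * ∑ n, lam n * x n - lam0)
    have := mul_le_mul_of_nonneg_left h1 hη.le
    linarith [neg_abs_le (lam0' - lam0)]

/-- The Lipschitz constants in the prices are affine in the gains. They give continuity of the mean
value and the dominating function for differentiation under the integral. -/
lemma slotValue_le_add (hμpos : ∀ n, 0 < μ n) (hμanti : Antitone μ) (hη : 0 < η')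
    (hPmax : 0 < Pmax) (hx : ∀ n, 0 < x n)
    {δ : Fin N → ℝ} (hδ : ∀ n, 0 < δ n) (hlam : ∀ n, δ n ≤ lam n)
    (hlam' : ∀ n, δ n ≤ lam' n) :
    slotValue μ η' Pmax lam' lam0' x ≤ slotValue μ η' Pmax lam lam0 x
      + (∑ n, |lam' n - lam n| * (μ n / (δ n * Real.log 2) + Pmax * η' * x n)
        + Pmax * |lam0' - lam0|) := by
  have h2 : 0 < Real.log 2 := Real.log_pos one_lt_two
  have h1 := uplinkValue_le_add hμpos hμanti hx hδ hlam hlam'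
  have h3 := downlinkGain_le_add (lam := lam) (lam' := lam') (lam0 := lam0) (lam0' := lam0')
    hη hPmax hx
  have h4 : 0 ≤ ∑ n, |lam' n - lam n| * (μ n / (δ n * Real.log 2)) :=
    Finset.sum_nonneg fun n _ => mul_nonneg (abs_nonneg _)
      (div_pos (hμpos n) (mul_pos (hδ n) h2)).le
  have h5 : 0 ≤ ∑ n, |lam' n - lam n| * (Pmax * η' * x n) :=
    Finset.sum_nonneg fun n _ => mul_nonneg (abs_nonneg _)
      (mul_pos (mul_pos hPmax hη) (hx n)).le
  have h6 : 0 ≤ Pmax * |lam0' - lam0| := mul_nonneg hPmax.le (abs_nonneg _)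
  simp only [mul_add (|lam' _ - lam _|), Finset.sum_add_distrib]
  refine max_le ?_ ?_
  · have := le_max_left (uplinkValue μ lam x) (downlinkGain η' Pmax lam lam0 x)
    unfold slotValue
    linarith
  · have := le_max_right (uplinkValue μ lam x) (downlinkGain η' Pmax lam lam0 x)
    unfold slotValue
    linarith

lemma slotValue_nonneg (hPmax : 0 ≤ Pmax) : 0 ≤ slotValue μ η' Pmax lam lam0 x :=
  (downlinkGain_nonneg hPmax).trans (le_max_right _ _)

lemma uplinkGain_line (μ lam v x Q : Fin N → ℝ) (h : ℝ) :
    uplinkGain μ (lam + h • v) x Q = uplinkGain μ lam x Q - h * ∑ n, v n * Q n := by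
  rw [uplinkGain_sub μ lam, Finset.mul_sum]
  congr 1
  refine Finset.sum_congr rfl fun n _ => ?_
  simp only [Pi.add_apply, Pi.smul_apply, smul_eq_mul]
  ring

lemma eventually_half_le (hlam : ∀ n, 0 < lam n) (v : Fin N → ℝ) :
    ∀ᶠ h : ℝ in 𝓝 0, ∀ n, lam n / 2 ≤ (lam + h • v) n := by
  refine eventually_all.2 fun n => ?_
  have hc : Tendsto (fun h : ℝ => (lam + h • v) n) (𝓝 0) (𝓝 (lam n)) := by
    have : Continuous fun h : ℝ => (lam + h • v) n := by
      simp only [Pi.add_apply, Pi.smul_apply, smul_eq_mul]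
      fun_prop
    simpa using this.tendsto 0
  exact (hc.eventually_const_lt (half_lt_self (hlam n))).mono fun h hh => hh.le

/-- The optimal powers depend continuously on the prices along lines, where they are unique. -/
lemma tendsto_optPower (hμpos : ∀ n, 0 < μ n) (hμanti : Antitone μ) (hx : ∀ n, 0 < x n)
    (hlam : ∀ n, 0 < lam n) (htie : NoTie μ lam x) (v : Fin N → ℝ) :
    Tendsto (fun h : ℝ => optPower μ (lam + h • v) x) (𝓝 0) (𝓝 (optPower μ lam x)) := by
  have h2 : 0 < Real.log 2 := Real.log_pos one_lt_two
  have hev := eventually_half_le hlam v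
  have hkkt : ∀ᶠ h : ℝ in 𝓝 0, IsKKT μ (lam + h • v) x (optPower μ (lam + h • v) x) :=
    hev.mono fun h hh => isKKT_optPower hμpos hμanti hx fun n => (half_pos (hlam n)).trans_le (hh n)
  have hbox : ∀ᶠ h : ℝ in 𝓝 0, optPower μ (lam + h • v) x
      ∈ Set.Icc (0 : Fin N → ℝ) (fun n => μ n / (lam n / 2 * Real.log 2)) := by
    filter_upwards [hev, hkkt] with h h1 h3
    refine ⟨h3.nonneg, fun n => (h3.le_bound hμpos hμanti hx
      (fun k => (half_pos (hlam k)).trans_le (h1 k)) n).trans ?_⟩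
    exact div_le_div_of_nonneg_left (hμpos n).le (mul_pos (half_pos (hlam n)) h2)
      (mul_le_mul_of_nonneg_right (h1 n) h2.le)
  -- The optimal powers stay in a compact box. Every cluster point is again a maximiser, by passing
  -- to the limit in the optimality inequality, and without ties there is only one.
  refine isCompact_Icc.tendsto_nhds_of_unique_mapClusterPt hbox fun p hp hclus => ?_
  obtain ⟨U, hU, hlim⟩ := mapClusterPt_iff_ultrafilter.1 hclus
  refine (isKKT_of_max hμpos hμanti hx hlam hp.1 fun R hR => ?_).unique hμpos hμanti hx
    (isKKT_optPower hμpos hμanti hx hlam) htie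
  have hh : Tendsto (fun h : ℝ => h) U (𝓝 0) := hU
  have hn : ∀ n, Tendsto (fun h : ℝ => optPower μ (lam + h • v) x n) U (𝓝 (p n)) :=
    fun n => (tendsto_pi_nhds.1 hlim) n
  have hgain : Tendsto (fun h : ℝ => uplinkGain μ lam x (optPower μ (lam + h • v) x)) U
      (𝓝 (uplinkGain μ lam x p)) := by
    have hc := continuousOn_uplinkGain μ lam hx p hp.1
    refine hc.tendsto.comp (tendsto_nhdsWithin_iff.2 ⟨hlim, ?_⟩)
    exact (hkkt.mono fun h hh => hh.nonneg).filter_mono hU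
  have hl : Tendsto (fun h : ℝ => uplinkGain μ lam x R - h * ∑ n, v n * R n) U
      (𝓝 (uplinkGain μ lam x R - 0 * ∑ n, v n * R n)) :=
    tendsto_const_nhds.sub (hh.mul_const _)
  have hr : Tendsto (fun h : ℝ => uplinkGain μ lam x (optPower μ (lam + h • v) x)
      - h * ∑ n, v n * optPower μ (lam + h • v) x n) U
      (𝓝 (uplinkGain μ lam x p - 0 * ∑ n, v n * p n)) :=
    hgain.sub (hh.mul (tendsto_finsetSum _ fun n _ => (hn n).const_mul _))
  have := le_of_tendsto_of_tendsto hl hr ((hkkt.filter_mono hU).mono fun h hk => by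
    have := hk.uplinkGain_le hμpos hμanti hx hR
    rwa [uplinkGain_line, uplinkGain_line] at this)
  simpa using this

/-- The envelope theorem for the uplink value. -/
lemma hasDerivAt_uplinkValue (hμpos : ∀ n, 0 < μ n) (hμanti : Antitone μ) (hx : ∀ n, 0 < x n)
    (hlam : ∀ n, 0 < lam n) (htie : NoTie μ lam x) (v : Fin N → ℝ) :
    HasDerivAt (fun h : ℝ => uplinkValue μ (lam + h • v) x) (-∑ n, v n * optPower μ lam x n) 0 := by
  have hlim : Tendsto (fun h : ℝ => ∑ n, v n * optPower μ (lam + h • v) x n) (𝓝 0)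
      (𝓝 (∑ n, v n * optPower μ lam x n)) :=
    tendsto_finsetSum _ fun n _ =>
      ((tendsto_pi_nhds.1 (tendsto_optPower hμpos hμanti hx hlam htie v)) n).const_mul _
  rw [hasDerivAt_iff_isLittleO, Asymptotics.isLittleO_iff]
  intro c hc
  filter_upwards [eventually_half_le hlam v, Metric.tendsto_nhds.1 hlim c hc] with h h1 h3
  have hpos : ∀ n, 0 < (lam + h • v) n := fun n => (half_pos (hlam n)).trans_le (h1 n)
  have hk0 := isKKT_optPower hμpos hμanti hx hlam
  have hkh := isKKT_optPower hμpos hμanti hx hpos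
  -- Using the optimal powers at each of the two prices as a candidate at the other encloses the
  -- increment between `-h * s0` and `-h * s`. Continuity of the optimal powers makes `s - s0`
  -- small.
  have e1 := uplinkGain_le_uplinkValue hμpos hμanti hx hpos hk0.nonneg
  have e2 := uplinkGain_le_uplinkValue hμpos hμanti hx hlam hkh.nonneg
  rw [uplinkGain_line] at e1
  have e3 : uplinkValue μ (lam + h • v) x = uplinkGain μ lam x (optPower μ (lam + h • v) x)
      - h * ∑ n, v n * optPower μ (lam + h • v) x n := by
    rw [uplinkValue, uplinkGain_line]
  have e0 : uplinkValue μ (lam + (0 : ℝ) • v) x = uplinkValue μ lam x := by simp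
  have e4 : uplinkGain μ lam x (optPower μ lam x) = uplinkValue μ lam x := rfl
  rw [e0, sub_zero, Real.norm_eq_abs, Real.norm_eq_abs, smul_eq_mul]
  rw [Real.dist_eq] at h3
  set s := ∑ n, v n * optPower μ (lam + h • v) x n
  set s0 := ∑ n, v n * optPower μ lam x n
  have hb : |h * (s - s0)| ≤ c * |h| := by
    rw [abs_mul, mul_comm]
    exact mul_le_mul_of_nonneg_right h3.le (abs_nonneg h)
  rw [abs_le] at hb ⊢
  constructor
  · have : 0 ≤ c * |h| := mul_nonneg hc.le (abs_nonneg h)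
    linarith
  · linarith [hb.1]

/-- The scheduling variable of the rules, as a measurable function of the gains. -/
def ruleMode (μ : Fin N → ℝ) (η' Pmax : ℝ) (lam : Fin N → ℝ) (lam0 : ℝ) (x : Fin N → ℝ) : ℝ :=
  Set.indicator {x | uplinkGain μ lam x (rulePower μ lam x) < downlinkGain η' Pmax lam lam0 x} 1 x

lemma ruleMode_eq_one
    (h : uplinkGain μ lam x (rulePower μ lam x) < downlinkGain η' Pmax lam lam0 x) :
    ruleMode μ η' Pmax lam lam0 x = 1 :=
  Set.indicator_of_mem (s := {x | uplinkGain μ lam x (rulePower μ lam x)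
    < downlinkGain η' Pmax lam lam0 x}) h _

lemma ruleMode_eq_zero
    (h : downlinkGain η' Pmax lam lam0 x ≤ uplinkGain μ lam x (rulePower μ lam x)) :
    ruleMode μ η' Pmax lam lam0 x = 0 :=
  Set.indicator_of_notMem (s := {x | uplinkGain μ lam x (rulePower μ lam x)
    < downlinkGain η' Pmax lam lam0 x}) (not_lt.2 h) _

/-- The directional derivative of the slot value in the direction `(v, w)`. -/
def slotSlope (μ : Fin N → ℝ) (η' Pmax : ℝ) (lam : Fin N → ℝ) (lam0 : ℝ) (v : Fin N → ℝ) (w : ℝ)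
    (x : Fin N → ℝ) : ℝ :=
  ∑ n, v n * (η' * Pmax * (ruleMode μ η' Pmax lam lam0 x * x n)
    - (1 - ruleMode μ η' Pmax lam lam0 x) * rulePower μ lam x n)
    - w * (Pmax * ruleMode μ η' Pmax lam lam0 x)

lemma continuous_downlinkGain_line (η' Pmax : ℝ) (lam v : Fin N → ℝ) (lam0 w : ℝ) (x : Fin N → ℝ) :
    Continuous fun h : ℝ => downlinkGain η' Pmax (lam + h • v) (lam0 + h * w) x := by
  unfold downlinkGain
  simp only [Pi.add_apply, Pi.smul_apply, smul_eq_mul]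
  fun_prop

/-- A maximum of two functions is differentiable where one of them dominates nearby. The inequality
`hne` concerns the downlink value without its positive part, because with `lam0 > 0` both mode
values may be `0` on a set of positive measure. -/
lemma hasDerivAt_slotValue (hμpos : ∀ n, 0 < μ n) (hμanti : Antitone μ)
    (hx : ∀ n, 0 < x n) (hlam : ∀ n, 0 < lam n) (htie : NoTie μ lam x)
    (hne : uplinkGain μ lam x (rulePower μ lam x) ≠ Pmax * (η' * ∑ n, lam n * x n - lam0))
    (v : Fin N → ℝ) (w : ℝ) :
    HasDerivAt (fun h : ℝ => slotValue μ η' Pmax (lam + h • v) (lam0 + h * w) x)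
      (slotSlope μ η' Pmax lam lam0 v w x) 0 := by
  have hopt := optPower_eq_rulePower hμpos hμanti hx hlam htie
  have hU := hasDerivAt_uplinkValue hμpos hμanti hx hlam htie v
  have hval : uplinkGain μ lam x (rulePower μ lam x) = uplinkValue μ lam x := by
    rw [uplinkValue, hopt]
  rw [hval] at hne
  have hUc : Tendsto (fun h : ℝ => uplinkValue μ (lam + h • v) x) (𝓝 0) (𝓝 (uplinkValue μ lam x)) := by
    have := hU.continuousAt.tendsto
    simpa using this
  have hDc : Tendsto (fun h : ℝ => downlinkGain η' Pmax (lam + h • v) (lam0 + h * w) x) (𝓝 0)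
      (𝓝 (downlinkGain η' Pmax lam lam0 x)) := by
    have := (continuous_downlinkGain_line η' Pmax lam v lam0 w x).tendsto 0
    simpa using this
  set aff : ℝ → ℝ := fun h => η' * ∑ n, (lam + h • v) n * x n - (lam0 + h * w) with haff
  have haffd : HasDerivAt aff (η' * ∑ n, v n * x n - w) 0 := by
    have h1 : aff = fun h => (η' * ∑ n, lam n * x n - lam0) + h * (η' * ∑ n, v n * x n - w) := by
      funext h
      simp only [haff, Pi.add_apply, Pi.smul_apply, smul_eq_mul, add_mul, Finset.sum_add_distrib,
        mul_assoc, ← Finset.mul_sum]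
      ring
    rw [h1]
    simpa using ((hasDerivAt_id (0 : ℝ)).mul_const (η' * ∑ n, v n * x n - w)).const_add
      (η' * ∑ n, lam n * x n - lam0)
  have haff0 : aff 0 = η' * ∑ n, lam n * x n - lam0 := by simp [haff]
  have hd : ∀ h, downlinkGain η' Pmax (lam + h • v) (lam0 + h * w) x = Pmax * max 0 (aff h) :=
    fun h => rfl
  have hd0 : downlinkGain η' Pmax lam lam0 x = Pmax * max 0 (aff 0) := by rw [haff0]; rfl
  by_cases hmode : uplinkValue μ lam x < downlinkGain η' Pmax lam lam0 x
  · have hA : ruleMode μ η' Pmax lam lam0 x = 1 :=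
      ruleMode_eq_one (by rwa [hval])
    have hslope : slotSlope μ η' Pmax lam lam0 v w x = Pmax * (η' * ∑ n, v n * x n - w) := by
      rw [slotSlope, hA, mul_sub, Finset.mul_sum, Finset.mul_sum]
      congr 1
      · exact Finset.sum_congr rfl fun n _ => by ring
      · ring
    rw [hslope]
    have hpos : 0 < aff 0 := by
      by_contra hcon
      rw [hd0, max_eq_left (not_lt.1 hcon), mul_zero] at hmode
      exact absurd hmode (not_lt.2 (uplinkValue_nonneg hμpos hμanti hx hlam))
    refine (haffd.const_mul Pmax).congr_of_eventuallyEq ?_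
    filter_upwards [hUc.eventually_lt hDc hmode, haffd.continuousAt.tendsto.eventually_const_lt hpos]
      with h h1 h2
    rw [slotValue, max_eq_right h1.le, hd, max_eq_right h2.le]
  · have hA : ruleMode μ η' Pmax lam lam0 x = 0 :=
      ruleMode_eq_zero (by rw [hval]; exact not_lt.1 hmode)
    have hslope : slotSlope μ η' Pmax lam lam0 v w x = -∑ n, v n * optPower μ lam x n := by
      rw [slotSlope, hA, hopt, ← Finset.sum_neg_distrib]
      simp
    rw [hslope]
    refine hU.congr_of_eventuallyEq ?_
    -- If the affine part is negative, the downlink value vanishes nearby and the nonnegative uplink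
    -- value is the maximum, even when the two agree. Otherwise `hne` makes the uplink strictly
    -- better.
    rcases lt_or_ge (aff 0) 0 with hneg | hnn
    · filter_upwards [haffd.continuousAt.tendsto.eventually_lt_const hneg,
        eventually_half_le hlam v] with h h1 h2
      rw [slotValue, hd, max_eq_left h1.le, mul_zero, max_eq_left]
      exact uplinkValue_nonneg hμpos hμanti hx fun n => (half_pos (hlam n)).trans_le (h2 n)
    · have hlt : downlinkGain η' Pmax lam lam0 x < uplinkValue μ lam x := by
        refine lt_of_le_of_ne (not_lt.1 hmode) ?_
        rw [hd0, max_eq_right hnn, haff0]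
        exact hne.symm
      filter_upwards [hDc.eventually_lt hUc hlt] with h h1
      rw [slotValue, max_eq_left h1.le]

end Value

/-! ### The expected slot value: differentiability and growth. -/

section Dual

variable {N : ℕ} {μ lam v x : Fin N → ℝ} {η' Pmax lam0 w : ℝ} {ν : Measure (Fin N → ℝ)}

/-- Positive nonincreasing weights and positive system parameters. -/
structure IsSystem (μ : Fin N → ℝ) (η' Pmax : ℝ) : Prop where
  pos : ∀ n, 0 < μ n
  anti : Antitone μ
  card_pos : 0 < N
  eta_pos : 0 < η'
  power_pos : 0 < Pmax

/-- Laws of positive integrable gains without atoms. -/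
structure IsGainLaw (ν : Measure (Fin N → ℝ)) : Prop where
  prob : IsProbabilityMeasure ν
  cont : IsContinuousLaw ν
  pos : ∀ᵐ x ∂ν, ∀ n, 0 < x n
  integrable : ∀ n, Integrable (fun x => x n) ν

lemma measurable_downlinkGain (η' Pmax : ℝ) (lam : Fin N → ℝ) (lam0 : ℝ) :
    Measurable (downlinkGain η' Pmax lam lam0) := by
  unfold downlinkGain
  fun_prop

lemma measurable_ruleMode (μ : Fin N → ℝ) (η' Pmax : ℝ) (lam : Fin N → ℝ) (lam0 : ℝ) :
    Measurable (ruleMode μ η' Pmax lam lam0) :=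
  measurable_one.indicator (measurableSet_lt
    (measurable_uplinkGain μ lam (measurable_rulePower μ lam)) (measurable_downlinkGain ..))

lemma ruleMode_eq_zero_or_one (μ : Fin N → ℝ) (η' Pmax : ℝ) (lam : Fin N → ℝ) (lam0 : ℝ)
    (x : Fin N → ℝ) : ruleMode μ η' Pmax lam lam0 x = 0 ∨ ruleMode μ η' Pmax lam lam0 x = 1 := by
  rcases le_or_gt (downlinkGain η' Pmax lam lam0 x) (uplinkGain μ lam x (rulePower μ lam x))
    with h | h
  · exact Or.inl (ruleMode_eq_zero h)
  · exact Or.inr (ruleMode_eq_one h)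

lemma integrable_ruleMode [IsFiniteMeasure ν] (μ : Fin N → ℝ) (η' Pmax : ℝ) (lam : Fin N → ℝ)
    (lam0 : ℝ) : Integrable (ruleMode μ η' Pmax lam lam0) ν := by
  refine Integrable.of_bound (measurable_ruleMode ..).aestronglyMeasurable 1
    (Eventually.of_forall fun x => ?_)
  rcases ruleMode_eq_zero_or_one μ η' Pmax lam lam0 x with h | h <;> simp [h]

lemma integrable_ruleMode_mul {f : (Fin N → ℝ) → ℝ} (hf : Integrable f ν) :
    Integrable (fun x => ruleMode μ η' Pmax lam lam0 x * f x) ν := by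
  refine hf.bdd_mul (c := 1) (measurable_ruleMode ..).aestronglyMeasurable
    (Eventually.of_forall fun x => ?_)
  rcases ruleMode_eq_zero_or_one μ η' Pmax lam lam0 x with h | h <;> simp [h]

lemma ae_slotValue (hs : IsSystem μ η' Pmax) (hν : IsGainLaw ν) (hlam : ∀ n, 0 < lam n)
    (lam0 : ℝ) : slotValue μ η' Pmax lam lam0 =ᵐ[ν] fun x =>
      max (uplinkGain μ lam x (rulePower μ lam x)) (downlinkGain η' Pmax lam lam0 x) := by
  filter_upwards [hν.pos, ae_noTie (μ := μ) hν.cont hν.pos hlam] with x hx htie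
  rw [slotValue, uplinkValue, optPower_eq_rulePower hs.pos hs.anti hx hlam htie]

lemma aestronglyMeasurable_slotValue (hs : IsSystem μ η' Pmax) (hν : IsGainLaw ν)
    (hlam : ∀ n, 0 < lam n) (lam0 : ℝ) :
    AEStronglyMeasurable (slotValue μ η' Pmax lam lam0) ν :=
  ((measurable_uplinkGain μ lam (measurable_rulePower μ lam)).max
    (measurable_downlinkGain ..)).aestronglyMeasurable.congr (ae_slotValue hs hν hlam lam0).symm

lemma integrable_downlinkGain (hν : IsGainLaw ν) (η' Pmax : ℝ) (lam : Fin N → ℝ) (lam0 : ℝ) :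
    Integrable (downlinkGain η' Pmax lam lam0) ν := by
  have := hν.prob
  unfold downlinkGain
  refine Integrable.const_mul ((integrable_zero _ ℝ _).sup (Integrable.sub ?_ (integrable_const _))) _
  exact (integrable_finsetSum _ fun n _ => (hν.integrable n).const_mul _).const_mul _

lemma integrable_slotValue (hs : IsSystem μ η' Pmax) (hν : IsGainLaw ν)
    (hlam : ∀ n, 0 < lam n) (lam0 : ℝ) : Integrable (slotValue μ η' Pmax lam lam0) ν := by
  have hb : Integrable (fun x : Fin N → ℝ =>
      ∑ n, μ n / (lam n * Real.log 2) * (x n / Real.log 2 * μ n)) ν :=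
    integrable_finsetSum _ fun n _ =>
      (((hν.integrable n).div_const _).mul_const _).const_mul _
  refine (hb.add (integrable_downlinkGain hν η' Pmax lam lam0)).mono'
    (aestronglyMeasurable_slotValue hs hν hlam lam0) ?_
  filter_upwards [hν.pos] with x hx
  rw [Real.norm_of_nonneg (slotValue_nonneg hs.power_pos.le)]
  have h1 := uplinkValue_le_sum hs.pos hs.anti hx hlam
  have h2 := uplinkValue_nonneg hs.pos hs.anti hx hlam
  have h3 : 0 ≤ downlinkGain η' Pmax lam lam0 x := downlinkGain_nonneg hs.power_pos.le
  simp only [Pi.add_apply]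
  exact max_le (by linarith) (by linarith)

lemma measurable_slotSlope (μ : Fin N → ℝ) (η' Pmax : ℝ) (lam : Fin N → ℝ) (lam0 : ℝ)
    (v : Fin N → ℝ) (w : ℝ) : Measurable (slotSlope μ η' Pmax lam lam0 v w) := by
  have h1 := measurable_ruleMode μ η' Pmax lam lam0
  have h2 := measurable_rulePower μ lam
  unfold slotSlope
  fun_prop

/-- The expected value of the best slot. -/
def meanValue (μ : Fin N → ℝ) (η' Pmax : ℝ) (ν : Measure (Fin N → ℝ)) (lam : Fin N → ℝ)
    (lam0 : ℝ) : ℝ :=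
  ∫ x, slotValue μ η' Pmax lam lam0 x ∂ν

/-- Differentiation under the integral: almost every slot value is differentiable at `0`, and the
Lipschitz bound with prices above `lam n / 2` is integrable. The averaged function is thus
differentiable although single slot values have kinks. -/
lemma hasDerivAt_meanValue (hs : IsSystem μ η' Pmax) (hν : IsGainLaw ν) (hlam : ∀ n, 0 < lam n)
    (lam0 : ℝ) (v : Fin N → ℝ) (w : ℝ) :
    HasDerivAt (fun h : ℝ => meanValue μ η' Pmax ν (lam + h • v) (lam0 + h * w))
      (∫ x, slotSlope μ η' Pmax lam lam0 v w x ∂ν) 0 := by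
  have := hν.prob
  have h2 : 0 < Real.log 2 := Real.log_pos one_lt_two
  have hmem := eventually_half_le hlam v
  have hhalf : ∀ n, 0 < lam n / 2 := fun n => half_pos (hlam n)
  refine (hasDerivAt_integral_of_dominated_loc_of_lip (μ := ν)
    (F := fun (h : ℝ) x => slotValue μ η' Pmax (lam + h • v) (lam0 + h * w) x)
    (s := {h : ℝ | ∀ n, lam n / 2 ≤ (lam + h • v) n})
    (bound := fun x => ∑ n, |v n| * (μ n / (lam n / 2 * Real.log 2) + Pmax * η' * x n)
      + Pmax * |w|) hmem ?_ ?_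
    (measurable_slotSlope μ η' Pmax lam lam0 v w).aestronglyMeasurable ?_ ?_ ?_).2
  · filter_upwards [hmem] with h hh
    exact aestronglyMeasurable_slotValue hs hν (fun n => (hhalf n).trans_le (hh n)) _
  · simpa using integrable_slotValue hs hν hlam lam0
  · filter_upwards [hν.pos] with x hx
    have hbnn : 0 ≤ ∑ n, |v n| * (μ n / (lam n / 2 * Real.log 2) + Pmax * η' * x n)
        + Pmax * |w| := by
      refine add_nonneg (Finset.sum_nonneg fun n _ => mul_nonneg (abs_nonneg _) (add_nonneg ?_ ?_))
        (mul_nonneg hs.power_pos.le (abs_nonneg _))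
      · exact (div_pos (hs.pos n) (mul_pos (hhalf n) h2)).le
      · exact (mul_pos (mul_pos hs.power_pos hs.eta_pos) (hx n)).le
    refine LipschitzOnWith.of_le_add_mul _ fun s hs' t ht => ?_
    have h := slotValue_le_add (lam := lam + t • v) (lam' := lam + s • v)
      (lam0 := lam0 + t * w) (lam0' := lam0 + s * w) hs.pos hs.anti hs.eta_pos hs.power_pos hx
      hhalf ht hs'
    refine h.trans_eq ?_
    congr 1
    rw [Real.coe_nnabs, abs_of_nonneg hbnn, Real.dist_eq, add_mul, Finset.sum_mul]
    congr 1
    · refine Finset.sum_congr rfl fun n _ => ?_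
      have : (lam + s • v) n - (lam + t • v) n = (s - t) * v n := by
        simp only [Pi.add_apply, Pi.smul_apply, smul_eq_mul]
        ring
      rw [this, abs_mul]
      ring
    · have : lam0 + s * w - (lam0 + t * w) = (s - t) * w := by ring
      rw [this, abs_mul]
      ring
  · refine Integrable.add (integrable_finsetSum _ fun n _ => Integrable.const_mul
      ((integrable_const _).add ((hν.integrable n).const_mul _)) _) (integrable_const _)
  · filter_upwards [ae_generic hν.cont hν.pos hs.card_pos hs.pos hs.anti hlam hs.eta_pos
      hs.power_pos lam0] with x ⟨hx, htie, hne⟩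
    exact hasDerivAt_slotValue hs.pos hs.anti hx hlam htie hne v w

lemma meanValue_nonneg (hs : IsSystem μ η' Pmax) : 0 ≤ meanValue μ η' Pmax ν lam lam0 :=
  integral_nonneg fun _ => slotValue_nonneg hs.power_pos.le

lemma pos_of_ae_mem [IsProbabilityMeasure ν] {s : Set (Fin N → ℝ)} (h : ∀ᵐ x ∂ν, x ∈ s) :
    0 < ν s := by
  have h1 : s =ᵐ[ν] Set.univ := eventuallyEq_univ.2 h
  rw [measure_congr h1, measure_univ]
  exact one_pos

lemma integral_gain_pos (hν : IsGainLaw ν) (n : Fin N) : 0 < ∫ x, x n ∂ν := by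
  have := hν.prob
  rw [integral_pos_iff_support_of_nonneg_ae (hν.pos.mono fun x hx => (hx n).le) (hν.integrable n)]
  have h : ∀ᵐ x ∂ν, x ∈ Function.support fun x : Fin N → ℝ => x n :=
    hν.pos.mono fun x hx => (hx n).ne'
  exact pos_of_ae_mem h

lemma integral_min_gain_pos (hν : IsGainLaw ν) (n : Fin N) : 0 < ∫ x, min (x n) 1 ∂ν := by
  have := hν.prob
  have hint : Integrable (fun x : Fin N → ℝ => min (x n) 1) ν :=
    (hν.integrable n).inf (integrable_const _)
  rw [integral_pos_iff_support_of_nonneg_ae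
    (hν.pos.mono fun x hx => le_min (hx n).le zero_le_one) hint]
  have h : ∀ᵐ x ∂ν, x ∈ Function.support fun x : Fin N → ℝ => min (x n) 1 :=
    hν.pos.mono fun x hx => (lt_min (hx n) one_pos).ne'
  exact pos_of_ae_mem h

/-- Lower bound of the mean value that is large for a large price. -/
lemma le_meanValue_of_large (hs : IsSystem μ η' Pmax) (hν : IsGainLaw ν) (hlam : ∀ n, 0 < lam n)
    (lam0 : ℝ) (n : Fin N) :
    Pmax * (η' * (lam n * ∫ x, x n ∂ν) - lam0) ≤ meanValue μ η' Pmax ν lam lam0 := by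
  have := hν.prob
  have h1 : ∫ x, Pmax * (η' * (lam n * x n) - lam0) ∂ν
      = Pmax * (η' * (lam n * ∫ x, x n ∂ν) - lam0) := by
    rw [integral_const_mul, integral_sub (((hν.integrable n).const_mul _).const_mul _)
      (integrable_const _), integral_const_mul, integral_const_mul]
    simp
  rw [← h1]
  refine integral_mono_ae (((((hν.integrable n).const_mul _).const_mul _).sub
    (integrable_const _)).const_mul _) (integrable_slotValue hs hν hlam lam0) ?_
  filter_upwards [hν.pos] with x hx
  refine le_trans ?_ (le_max_right _ _)
  refine mul_le_mul_of_nonneg_left (le_trans ?_ (le_max_right _ _)) hs.power_pos.le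
  have := Finset.single_le_sum (f := fun k => lam k * x k)
    (fun k _ => (mul_pos (hlam k) (hx k)).le) (Finset.mem_univ n)
  have := mul_le_mul_of_nonneg_left this hs.eta_pos.le
  linarith

lemma uplinkGain_single (n : Fin N) (t : ℝ) :
    uplinkGain μ lam x (Pi.single n t) = μ n * Real.logb 2 (1 + t * x n) - lam n * t := by
  have hlev : ∀ m, level x (Pi.single n t) m = if n ≤ m then 1 + t * x n else 1 := by
    intro m
    rw [level, Finset.sum_filter, Finset.sum_eq_single n]
    · by_cases h : n ≤ m <;> simp [h]
    · intro k _ hk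
      simp [hk]
    · simp
  rw [uplinkGain_eq]
  congr 1
  · rw [← sum_weightDrop μ n, Finset.sum_mul, Finset.sum_filter]
    refine Finset.sum_congr rfl fun m _ => ?_
    rw [hlev]
    split_ifs <;> simp
  · rw [Finset.sum_eq_single n]
    · simp
    · intro k _ hk
      simp [hk]
    · simp

/-- Bernoulli's inequality for the exponent `min y 1`. It separates gain from price, so that the
expected rate is bounded below by a positive constant times a function of the price. -/
lemma min_mul_logb_le {y l : ℝ} (hy : 0 < y) (hl : 0 < l) :
    min y 1 * Real.logb 2 (1 + 1 / l) ≤ Real.logb 2 (1 + 1 / l * y) := by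
  have hm0 : 0 ≤ min y 1 := le_min hy.le zero_le_one
  have hl1 : 0 < 1 / l := by positivity
  have h1 := rpow_one_add_le_one_add_mul_self (s := 1 / l) (p := min y 1) (by linarith) hm0
    (min_le_right _ _)
  have h3 : 1 + min y 1 * (1 / l) ≤ 1 + 1 / l * y := by
    have := mul_le_mul_of_nonneg_right (min_le_left y 1) hl1.le
    linarith
  rw [Real.logb, Real.logb, mul_div_assoc', ← Real.log_rpow (by positivity)]
  refine div_le_div_of_nonneg_right ?_ (Real.log_pos one_lt_two).le
  exact Real.log_le_log (by positivity) (h1.trans h3)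

/-- Lower bound of the mean value that is large for a small price. -/
lemma le_meanValue_of_small (hs : IsSystem μ η' Pmax) (hν : IsGainLaw ν) (hlam : ∀ n, 0 < lam n)
    (lam0 : ℝ) (n : Fin N) :
    μ n * ((∫ x, min (x n) 1 ∂ν) * Real.logb 2 (1 + 1 / lam n)) - 1
      ≤ meanValue μ η' Pmax ν lam lam0 := by
  have := hν.prob
  have hint : Integrable (fun x : Fin N → ℝ => min (x n) 1) ν :=
    (hν.integrable n).inf (integrable_const _)
  have h1 : ∫ x, (μ n * (min (x n) 1 * Real.logb 2 (1 + 1 / lam n)) - 1) ∂ν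
      = μ n * ((∫ x, min (x n) 1 ∂ν) * Real.logb 2 (1 + 1 / lam n)) - 1 := by
    rw [integral_sub ((hint.mul_const _).const_mul _) (integrable_const _), integral_const_mul,
      integral_mul_const]
    simp
  rw [← h1]
  refine integral_mono_ae (((hint.mul_const _).const_mul _).sub (integrable_const _))
    (integrable_slotValue hs hν hlam lam0) ?_
  filter_upwards [hν.pos] with x hx
  refine le_trans ?_ (le_max_left _ _)
  have hl : 0 ≤ 1 / lam n := (one_div_pos.2 (hlam n)).le
  -- Test with user `n` alone at power `1 / lam n`, which costs exactly `1` while its rate grows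
  -- without bound as the price tends to `0`.
  refine le_trans ?_ (uplinkGain_le_uplinkValue (R := Pi.single n (1 / lam n)) hs.pos hs.anti hx
    hlam fun k => ?_)
  · rw [uplinkGain_single, mul_one_div_cancel (hlam n).ne']
    have := mul_le_mul_of_nonneg_left (min_mul_logb_le (hx n) (hlam n)) (hs.pos n).le
    linarith
  · by_cases hk : k = n
    · subst hk; simpa using hl
    · simp [hk]

lemma meanValue_le_add (hs : IsSystem μ η' Pmax) (hν : IsGainLaw ν) {δ lam lam' : Fin N → ℝ}
    {lam0 lam0' : ℝ} (hδ : ∀ n, 0 < δ n) (hlam : ∀ n, δ n ≤ lam n) (hlam' : ∀ n, δ n ≤ lam' n) :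
    meanValue μ η' Pmax ν lam' lam0' ≤ meanValue μ η' Pmax ν lam lam0
      + (∑ n, |lam' n - lam n| * (μ n / (δ n * Real.log 2) + Pmax * η' * ∫ x, x n ∂ν)
        + Pmax * |lam0' - lam0|) := by
  have := hν.prob
  have hi : ∀ n, Integrable (fun x : Fin N → ℝ =>
      |lam' n - lam n| * (μ n / (δ n * Real.log 2) + Pmax * η' * x n)) ν := fun n =>
    ((integrable_const _).add ((hν.integrable n).const_mul _)).const_mul _
  have hI : Integrable (fun x : Fin N → ℝ =>
      ∑ n, |lam' n - lam n| * (μ n / (δ n * Real.log 2) + Pmax * η' * x n)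
        + Pmax * |lam0' - lam0|) ν :=
    (integrable_finsetSum _ fun n _ => hi n).add (integrable_const _)
  have h1 : ∫ x, (∑ n, |lam' n - lam n| * (μ n / (δ n * Real.log 2) + Pmax * η' * x n)
        + Pmax * |lam0' - lam0|) ∂ν
      = ∑ n, |lam' n - lam n| * (μ n / (δ n * Real.log 2) + Pmax * η' * ∫ x, x n ∂ν)
        + Pmax * |lam0' - lam0| := by
    rw [integral_add (integrable_finsetSum _ fun n _ => hi n) (integrable_const _),
      integral_finsetSum _ fun n _ => hi n]
    congr 1
    · refine Finset.sum_congr rfl fun n _ => ?_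
      rw [integral_const_mul, integral_add (integrable_const _) ((hν.integrable n).const_mul _),
        integral_const_mul]
      simp
    · simp
  have hS := integrable_slotValue hs hν (fun n => (hδ n).trans_le (hlam n)) lam0
  rw [← h1, meanValue, meanValue, ← integral_add hS hI]
  refine integral_mono_ae (integrable_slotValue hs hν (fun n => (hδ n).trans_le (hlam' n)) lam0')
    (hS.add hI) ?_
  filter_upwards [hν.pos] with x hx
  exact slotValue_le_add hs.pos hs.anti hs.eta_pos hs.power_pos hx hδ hlam hlam'

end Dual

/-! ### Minimisers of the dual function and the constraints they satisfy. -/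

section Multipliers

variable {N : ℕ} {μ lam : Fin N → ℝ} {η' Pmax lam0 : ℝ} {ν : Measure (Fin N → ℝ)}

/-- The mean value of the Lagrangian, with the constant `lam0 * c`. -/
def dualMean (μ : Fin N → ℝ) (η' Pmax : ℝ) (ν : Measure (Fin N → ℝ)) (c : ℝ)
    (p : (Fin N → ℝ) × ℝ) : ℝ :=
  meanValue μ η' Pmax ν p.1 p.2 + p.2 * c

lemma continuousOn_dualMean (hs : IsSystem μ η' Pmax) (hν : IsGainLaw ν) {δ : Fin N → ℝ}
    (hδ : ∀ n, 0 < δ n) (c : ℝ) :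
    ContinuousOn (dualMean μ η' Pmax ν c) {p | ∀ n, δ n ≤ p.1 n} := by
  intro p hp
  set ω : (Fin N → ℝ) × ℝ → ℝ := fun q =>
    ∑ n, |q.1 n - p.1 n| * (μ n / (δ n * Real.log 2) + Pmax * η' * ∫ x, x n ∂ν)
      + Pmax * |q.2 - p.2| with hω
  have hω0 : Tendsto ω (𝓝 p) (𝓝 0) := by
    have hc : Continuous ω := by fun_prop
    have := hc.tendsto p
    simpa [hω] using this
  have hmean : Tendsto (fun q : (Fin N → ℝ) × ℝ => meanValue μ η' Pmax ν q.1 q.2)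
      (𝓝[{p | ∀ n, δ n ≤ p.1 n}] p) (𝓝 (meanValue μ η' Pmax ν p.1 p.2)) := by
    rw [tendsto_iff_dist_tendsto_zero]
    refine squeeze_zero' (Eventually.of_forall fun _ => dist_nonneg) ?_
      (hω0.mono_left nhdsWithin_le_nhds)
    filter_upwards [self_mem_nhdsWithin] with q hq
    have h1 := meanValue_le_add (lam0 := p.2) (lam0' := q.2) hs hν hδ hp hq
    have h2 := meanValue_le_add (lam0 := q.2) (lam0' := p.2) hs hν hδ hq hp
    simp only [abs_sub_comm (p.1 _), abs_sub_comm p.2] at h2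
    rw [Real.dist_eq, abs_le]
    constructor <;> simp only [hω] <;> linarith
  exact hmean.add ((continuous_snd.mul continuous_const).continuousAt.continuousWithinAt)

/-- For multipliers of the power constraint in a compact set the dual problem has a solution with
positive prices. -/
lemma exists_dualMean_min (hs : IsSystem μ η' Pmax) (hν : IsGainLaw ν) (c : ℝ) {K : Set ℝ}
    (hK : IsCompact K) (hne : K.Nonempty) :
    ∃ p : (Fin N → ℝ) × ℝ, (∀ n, 0 < p.1 n) ∧ p.2 ∈ K ∧
      ∀ q : (Fin N → ℝ) × ℝ, (∀ n, 0 < q.1 n) → q.2 ∈ K →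
        dualMean μ η' Pmax ν c p ≤ dualMean μ η' Pmax ν c q := by
  obtain ⟨k₀, hk₀⟩ := hne
  obtain ⟨C, hC⟩ := hK.isBounded.exists_norm_le
  have hC' : ∀ k ∈ K, |k| ≤ C := fun k hk => hC k hk
  set B := dualMean μ η' Pmax ν c ((fun _ => 1), k₀) with hB
  have hkc : ∀ k ∈ K, -(C * |c|) ≤ k * c := by
    intro k hk
    have h1 : |k * c| ≤ C * |c| := by
      rw [abs_mul]
      exact mul_le_mul_of_nonneg_right (hC' k hk) (abs_nonneg c)
    linarith [neg_abs_le (k * c)]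
  -- Coercivity: a price near `0` or a large price gives a value above the reference value `B` at
  -- unit prices. Minimising over a compact box of positive prices that contains the reference point
  -- is then enough.
  have hsmall : ∀ n, ∃ d, 0 < d ∧ ∀ q : (Fin N → ℝ) × ℝ, (∀ n, 0 < q.1 n) → q.2 ∈ K →
      q.1 n < d → B < dualMean μ η' Pmax ν c q := by
    intro n
    have hm := mul_pos (hs.pos n) (integral_min_gain_pos hν n)
    have hlim : Tendsto (fun l : ℝ => Real.log l⁻¹) (𝓝[>] 0) atTop :=
      Real.tendsto_log_atTop.comp tendsto_inv_nhdsGT_zero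
    have hev := hlim.eventually_gt_atTop ((B + 1 + C * |c|) * Real.log 2
      / (μ n * ∫ x, min (x n) 1 ∂ν))
    obtain ⟨d, hd, hsub⟩ := mem_nhdsGT_iff_exists_Ioo_subset.1 hev
    refine ⟨d, hd, fun q hq hqK hqd => ?_⟩
    have h1 : (B + 1 + C * |c|) * Real.log 2 / (μ n * ∫ x, min (x n) 1 ∂ν)
      < Real.log (q.1 n)⁻¹ := hsub ⟨hq n, hqd⟩
    have h2 : 0 < Real.log 2 := Real.log_pos one_lt_two
    have h3 := le_meanValue_of_small hs hν hq q.2 n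
    have h4 : Real.log (q.1 n)⁻¹ ≤ Real.log (1 + 1 / q.1 n) := by
      rw [one_div]
      exact Real.log_le_log (inv_pos.2 (hq n)) (by linarith)
    have h5 : (B + 1 + C * |c|) < μ n * ((∫ x, min (x n) 1 ∂ν) * Real.logb 2 (1 + 1 / q.1 n)) := by
      rw [Real.logb, ← mul_assoc, mul_div_assoc', lt_div_iff₀ h2]
      rw [div_lt_iff₀ hm] at h1
      have := mul_le_mul_of_nonneg_right h4 hm.le
      linarith
    have h6 := hkc q.2 hqK
    rw [dualMean]
    linarith
  have hlarge : ∀ n, ∃ R, ∀ q : (Fin N → ℝ) × ℝ, (∀ n, 0 < q.1 n) → q.2 ∈ K →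
      R < q.1 n → B < dualMean μ η' Pmax ν c q := by
    intro n
    have hm := integral_gain_pos hν n
    have hm' : 0 < Pmax * (η' * ∫ x, x n ∂ν) := mul_pos hs.power_pos (mul_pos hs.eta_pos hm)
    refine ⟨(B + Pmax * C + C * |c|) / (Pmax * (η' * ∫ x, x n ∂ν)), fun q hq hqK hlt => ?_⟩
    rw [div_lt_iff₀ hm'] at hlt
    have h3 := le_meanValue_of_large hs hν hq q.2 n
    have h6 := hkc q.2 hqK
    have h7 := mul_le_mul_of_nonneg_left ((le_abs_self _).trans (hC' q.2 hqK)) hs.power_pos.le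
    rw [dualMean]
    linarith
  choose d hd hdB using hsmall
  choose R hRB using hlarge
  set lo : Fin N → ℝ := fun n => min (d n) 1
  set hi : Fin N → ℝ := fun n => max (R n) 1
  have hlo : ∀ n, 0 < lo n := fun n => lt_min (hd n) one_pos
  have hcomp : IsCompact (Set.Icc lo hi ×ˢ K) := isCompact_Icc.prod hK
  have hmem : ((fun _ => (1 : ℝ)), k₀) ∈ Set.Icc lo hi ×ˢ K :=
    ⟨⟨fun n => min_le_right _ _, fun n => le_max_right _ _⟩, hk₀⟩
  obtain ⟨p, ⟨hp1, hp2⟩, hmin⟩ := hcomp.exists_isMinOn ⟨_, hmem⟩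
    ((continuousOn_dualMean hs hν hlo c).mono fun q hq => hq.1.1)
  refine ⟨p, fun n => (hlo n).trans_le (hp1.1 n), hp2, fun q hq hqK => ?_⟩
  have hpB : dualMean μ η' Pmax ν c p ≤ B := hmin hmem
  by_cases hbox : q.1 ∈ Set.Icc lo hi
  · exact hmin (Set.mk_mem_prod hbox hqK)
  · have hn : ∃ n, q.1 n < lo n ∨ hi n < q.1 n := by
      by_contra hcon
      push Not at hcon
      exact hbox ⟨fun n => (hcon n).1, fun n => (hcon n).2⟩
    obtain ⟨n, hn | hn⟩ := hn
    · exact hpB.trans (hdB n q hq hqK (hn.trans_le (min_le_left _ _))).le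
    · exact hpB.trans (hRB n q hq hqK ((le_max_left _ _).trans_lt hn)).le

lemma hasDerivAt_dualMean (hs : IsSystem μ η' Pmax) (hν : IsGainLaw ν) (c : ℝ)
    {p : (Fin N → ℝ) × ℝ} (hp : ∀ n, 0 < p.1 n) (v : Fin N → ℝ) (w : ℝ) :
    HasDerivAt (fun h : ℝ => dualMean μ η' Pmax ν c (p.1 + h • v, p.2 + h * w))
      (∫ x, slotSlope μ η' Pmax p.1 p.2 v w x ∂ν + w * c) 0 := by
  have h1 := hasDerivAt_meanValue hs hν hp p.2 v w
  have h2 : HasDerivAt (fun h : ℝ => (p.2 + h * w) * c) (w * c) 0 := by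
    simpa using (((hasDerivAt_id (0 : ℝ)).mul_const w).const_add p.2).mul_const c
  exact h1.add h2

lemma integrable_rulePower (hs : IsSystem μ η' Pmax) (hν : IsGainLaw ν) (hlam : ∀ n, 0 < lam n)
    (n : Fin N) : Integrable (fun x => rulePower μ lam x n) ν := by
  have := hν.prob
  refine Integrable.of_bound (measurable_rulePower μ lam n).aestronglyMeasurable
    (μ n / (lam n * Real.log 2)) ?_
  filter_upwards [hν.pos, ae_noTie (μ := μ) hν.cont hν.pos hlam] with x hx htie
  have h := isKKT_rulePower hs.pos hs.anti hx hlam htie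
  rw [Real.norm_of_nonneg (h.nonneg n)]
  exact h.le_bound hs.pos hs.anti hx hlam n

lemma integrable_uplinkPower (hs : IsSystem μ η' Pmax) (hν : IsGainLaw ν) (hlam : ∀ n, 0 < lam n)
    (lam0 : ℝ) (n : Fin N) :
    Integrable (fun x => (1 - ruleMode μ η' Pmax lam lam0 x) * rulePower μ lam x n) ν := by
  simp only [sub_mul, one_mul]
  exact (integrable_rulePower hs hν hlam n).sub
    (integrable_ruleMode_mul (integrable_rulePower hs hν hlam n))

/-- Energy balance of the rules at a minimiser of the dual function. -/
lemma energy_balance_of_min (hs : IsSystem μ η' Pmax) (hν : IsGainLaw ν) {c : ℝ}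
    {p : (Fin N → ℝ) × ℝ} (hp : ∀ n, 0 < p.1 n)
    (hmin : ∀ lam : Fin N → ℝ, (∀ n, 0 < lam n) →
      dualMean μ η' Pmax ν c p ≤ dualMean μ η' Pmax ν c (lam, p.2)) (n : Fin N) :
    ∫ x, (1 - ruleMode μ η' Pmax p.1 p.2 x) * rulePower μ p.1 x n ∂ν
      = ∫ x, η' * Pmax * (ruleMode μ η' Pmax p.1 p.2 x * x n) ∂ν := by
  -- The partial derivative in the price of user `n` is its mean harvested energy minus its mean
  -- spent energy, and it vanishes at an interior minimum.
  have hd := hasDerivAt_dualMean hs hν c hp (Pi.single n 1) 0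
  have hloc : IsLocalMin (fun h : ℝ => dualMean μ η' Pmax ν c
      (p.1 + h • (Pi.single n 1 : Fin N → ℝ), p.2 + h * 0)) 0 := by
    filter_upwards [eventually_half_le hp (Pi.single n 1)] with h hh
    have := hmin _ fun k => (half_pos (hp k)).trans_le (hh k)
    simpa using this
  have hz := hloc.hasDerivAt_eq_zero hd
  have hslope : ∀ x, slotSlope μ η' Pmax p.1 p.2 (Pi.single n 1) 0 x
      = η' * Pmax * (ruleMode μ η' Pmax p.1 p.2 x * x n)
        - (1 - ruleMode μ η' Pmax p.1 p.2 x) * rulePower μ p.1 x n := by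
    intro x
    rw [slotSlope, Finset.sum_eq_single n]
    · simp
    · intro k _ hk
      simp [hk]
    · simp
  simp_rw [hslope] at hz
  rw [integral_sub ((integrable_ruleMode_mul (hν.integrable n)).const_mul _)
    (integrable_uplinkPower hs hν hp p.2 n)] at hz
  linarith

lemma integral_slotSlope_power (μ : Fin N → ℝ) (η' Pmax : ℝ) (ν : Measure (Fin N → ℝ))
    (lam : Fin N → ℝ) (lam0 : ℝ) :
    ∫ x, slotSlope μ η' Pmax lam lam0 0 1 x ∂ν
      = -(Pmax * ∫ x, ruleMode μ η' Pmax lam lam0 x ∂ν) := by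
  rw [← integral_const_mul, ← integral_neg]
  refine integral_congr_ae (Eventually.of_forall fun x => ?_)
  simp [slotSlope]

/-- With free base-station power a downlink slot has positive value, so it beats a silent uplink
slot. -/
lemma rulePower_eq_zero_imp (hs : IsSystem μ η' Pmax) {x : Fin N → ℝ} (hx : ∀ n, 0 < x n)
    (hlam : ∀ n, 0 < lam n) (h : ∀ n, rulePower μ lam x n = 0) :
    ruleMode μ η' Pmax lam 0 x = 1 := by
  refine ruleMode_eq_one ?_
  have h0 : rulePower μ lam x = 0 := funext h
  rw [h0, uplinkGain_zero, downlinkGain, sub_zero]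
  have hne : (Finset.univ : Finset (Fin N)).Nonempty := ⟨⟨0, hs.card_pos⟩, Finset.mem_univ _⟩
  have := Finset.sum_pos (fun n _ => mul_pos (hlam n) (hx n)) hne
  exact mul_pos hs.power_pos (lt_max_of_lt_right (mul_pos hs.eta_pos this))

/-- Without power constraint both modes are used with positive probability. -/
lemma ruleMode_mean_mem (hs : IsSystem μ η' Pmax) (hν : IsGainLaw ν) (hlam : ∀ n, 0 < lam n)
    (hbal : ∀ n, ∫ x, (1 - ruleMode μ η' Pmax lam 0 x) * rulePower μ lam x n ∂ν
      = ∫ x, η' * Pmax * (ruleMode μ η' Pmax lam 0 x * x n) ∂ν) :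
    0 < ∫ x, ruleMode μ η' Pmax lam 0 x ∂ν ∧ ∫ x, ruleMode μ η' Pmax lam 0 x ∂ν < 1 := by
  have := hν.prob
  have h01 := ruleMode_eq_zero_or_one μ η' Pmax lam 0
  have hnn : ∀ x, 0 ≤ ruleMode μ η' Pmax lam 0 x := fun x => by rcases h01 x with h | h <;> simp [h]
  have hle : ∀ x, ruleMode μ η' Pmax lam 0 x ≤ 1 := fun x => by rcases h01 x with h | h <;> simp [h]
  have hint := integrable_ruleMode (ν := ν) μ η' Pmax lam 0
  have hone : ∫ _, (1 : ℝ) ∂ν = 1 := by simp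
  constructor
  -- If almost all slots were uplink, nothing would be harvested and energy balance would force all
  -- powers to vanish; but then downlink is chosen.
  · refine lt_of_le_of_ne (integral_nonneg hnn) fun h0 => ?_
    have hz : ∀ᵐ x ∂ν, ruleMode μ η' Pmax lam 0 x = 0 :=
      (integral_eq_zero_iff_of_nonneg hnn hint).1 h0.symm
    have hP : ∀ᵐ x ∂ν, ∀ n, rulePower μ lam x n = 0 := by
      refine ae_all_iff.2 fun n => ?_
      have h1 : ∫ x, rulePower μ lam x n ∂ν = 0 := by
        rw [integral_congr_ae (g := fun x => (1 - ruleMode μ η' Pmax lam 0 x) * rulePower μ lam x n)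
          (hz.mono fun x hx => by simp [hx]), hbal n,
          integral_congr_ae (g := fun _ => 0) (hz.mono fun x hx => by simp [hx])]
        simp
      refine (integral_eq_zero_iff_of_nonneg_ae ?_ (integrable_rulePower hs hν hlam n)).1 h1
      filter_upwards [hν.pos, ae_noTie (μ := μ) hν.cont hν.pos hlam] with x hx htie
      exact (isKKT_rulePower hs.pos hs.anti hx hlam htie).nonneg n
    obtain ⟨x, hx0, hx1, hx2⟩ := (hz.and (hP.and hν.pos)).exists
    have := rulePower_eq_zero_imp hs hx2 hlam hx1
    rw [hx0] at this
    exact zero_ne_one this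
  · refine lt_of_le_of_ne ?_ fun h1 => ?_
    · exact (integral_mono hint (integrable_const 1) hle).trans_eq hone
    -- If almost all slots were downlink, a positive mean energy would be harvested and none spent.
    · have hz : ∀ᵐ x ∂ν, ruleMode μ η' Pmax lam 0 x = 1 := by
        have h2 : ∫ x, (1 - ruleMode μ η' Pmax lam 0 x) ∂ν = 0 := by
          rw [integral_sub (integrable_const _) hint, hone, h1, sub_self]
        have := (integral_eq_zero_iff_of_nonneg (fun x => sub_nonneg.2 (hle x))
          ((integrable_const _).sub hint)).1 h2
        exact this.mono fun x hx => (sub_eq_zero.1 hx).symm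
      have hl : ∫ x, (1 - ruleMode μ η' Pmax lam 0 x) * rulePower μ lam x ⟨0, hs.card_pos⟩ ∂ν = 0 := by
        rw [integral_congr_ae (g := fun _ => 0) (hz.mono fun x hx => by simp [hx])]
        simp
      have hr : ∫ x, η' * Pmax * (ruleMode μ η' Pmax lam 0 x * x ⟨0, hs.card_pos⟩) ∂ν
          = η' * Pmax * ∫ x, x ⟨0, hs.card_pos⟩ ∂ν := by
        rw [← integral_const_mul]
        exact integral_congr_ae (hz.mono fun x hx => by simp [hx])
      have hpos := mul_pos (mul_pos hs.eta_pos hs.power_pos) (integral_gain_pos hν ⟨0, hs.card_pos⟩)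
      rw [← hr, ← hbal, hl] at hpos
      exact lt_irrefl 0 hpos

/-- Existence of multipliers for which the rules meet the constraints on average. -/
theorem exists_multipliers (hs : IsSystem μ η' Pmax) (hν : IsGainLaw ν) :
    ∃ Pcrit : ℝ, 0 < Pcrit ∧ Pcrit < Pmax ∧ ∀ Pavg : ℝ, 0 < Pavg →
      ∃ (lam : Fin N → ℝ) (lam0 : ℝ), (∀ n, 0 < lam n) ∧ 0 ≤ lam0 ∧
        (lam0 = 0 ∨ Pavg < Pcrit) ∧ (Pcrit < Pavg → lam0 = 0) ∧
        (∀ n, ∫ x, (1 - ruleMode μ η' Pmax lam lam0 x) * rulePower μ lam x n ∂ν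
          = ∫ x, η' * Pmax * (ruleMode μ η' Pmax lam lam0 x * x n) ∂ν) ∧
        Pmax * ∫ x, ruleMode μ η' Pmax lam lam0 x ∂ν = min Pavg Pcrit := by
  -- The dual problem without the average power constraint; the mean base-station power at this
  -- minimiser is the critical power.
  obtain ⟨p, hp, hp0, hpmin⟩ := exists_dualMean_min hs hν 0 (K := {0}) isCompact_singleton ⟨0, rfl⟩
  obtain ⟨lam₁, k⟩ := p
  rw [Set.mem_singleton_iff] at hp0
  simp only at hp0 hp
  subst hp0
  have hbal₁ := energy_balance_of_min hs hν (c := 0) hp fun lam hlam => hpmin (lam, 0) hlam rfl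
  obtain ⟨hA0, hA1⟩ := ruleMode_mean_mem hs hν hp hbal₁
  refine ⟨Pmax * ∫ x, ruleMode μ η' Pmax lam₁ 0 x ∂ν, mul_pos hs.power_pos hA0,
    mul_lt_of_lt_one_right hs.power_pos hA1, fun Pavg hPavg => ?_⟩
  set Pcrit := Pmax * ∫ x, ruleMode μ η' Pmax lam₁ 0 x ∂ν with hPcrit
  rcases le_or_gt Pcrit Pavg with hle | hlt
  · exact ⟨lam₁, 0, hp, le_rfl, Or.inl rfl, fun _ => rfl, hbal₁, (min_eq_right hle).symm⟩
  -- With this `Λ` the term `Λ * Pavg` alone exceeds the dual value at unit prices and `lam0 = 0`,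
  -- so a minimiser over `[0, Λ]` avoids the right end point.
  · set Λ := meanValue μ η' Pmax ν (fun _ => 1) 0 / Pavg + 1 with hΛ
    have hΛpos : 0 < Λ :=
      add_pos_of_nonneg_of_pos (div_nonneg (meanValue_nonneg hs) hPavg.le) one_pos
    obtain ⟨q, hq, hqK, hqmin⟩ := exists_dualMean_min hs hν Pavg (K := Set.Icc 0 Λ) isCompact_Icc
      ⟨0, le_rfl, hΛpos.le⟩
    have hbal := energy_balance_of_min hs hν (c := Pavg) hq fun lam hlam =>
      hqmin (lam, q.2) hlam hqK
    -- The left end point is excluded too. The minimum over `lam0 = 0` is attained at `lam₁`, where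
    -- the derivative in `lam0` is `Pavg - Pcrit < 0`, so a small positive `lam0` does better.
    have hq0 : 0 < q.2 := by
      refine lt_of_le_of_ne hqK.1 fun h0 => ?_
      have hd := hasDerivAt_dualMean hs hν Pavg (p := (lam₁, 0)) hp 0 1
      rw [integral_slotSlope_power, ← hPcrit, one_mul] at hd
      have hneg : -Pcrit + Pavg < 0 := by linarith
      have hev : ∀ᶠ h : ℝ in 𝓝[>] 0, dualMean μ η' Pmax ν Pavg (lam₁, h)
          < dualMean μ η' Pmax ν Pavg (lam₁, 0) := by
        have hslope := (hasDerivAt_iff_tendsto_slope.1 hd).mono_left (nhdsGT_le_nhdsNE 0)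
        have h1 := hslope.eventually_lt_const hneg
        filter_upwards [h1, self_mem_nhdsWithin] with h hh hpos
        rw [slope_def_field, sub_zero, div_lt_iff₀ hpos, zero_mul] at hh
        simpa using hh
      obtain ⟨h, hh, hhK⟩ := (hev.and (Ioo_mem_nhdsGT hΛpos)).exists
      have h1 := hqmin (lam₁, h) hp ⟨hhK.1.le, hhK.2.le⟩
      have h2 := hpmin (q.1, 0) hq rfl
      have h3 : q = (q.1, 0) := Prod.ext rfl h0.symm
      rw [h3] at h1
      simp only [dualMean, zero_mul, add_zero] at h1 h2 hh
      linarith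
    have hqΛ : q.2 < Λ := by
      refine lt_of_le_of_ne hqK.2 fun h1 => ?_
      have h2 := hqmin ((fun _ => 1), 0) (fun _ => one_pos) ⟨le_rfl, hΛpos.le⟩
      have h3 := meanValue_nonneg (ν := ν) (lam := q.1) (lam0 := q.2) hs
      have h4 : Λ * Pavg = meanValue μ η' Pmax ν (fun _ => 1) 0 + Pavg := by
        rw [hΛ]
        field_simp
      simp only [dualMean, zero_mul, add_zero] at h2
      rw [h1] at h2 h3
      linarith
    -- At an interior minimum the derivative in `lam0`, which is `Pavg` minus the mean base-station
    -- power, vanishes.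
    have hpow : Pmax * ∫ x, ruleMode μ η' Pmax q.1 q.2 x ∂ν = Pavg := by
      have hd := hasDerivAt_dualMean hs hν Pavg hq 0 1
      rw [integral_slotSlope_power, one_mul] at hd
      have hloc : IsLocalMin (fun h : ℝ => dualMean μ η' Pmax ν Pavg
          (q.1 + h • (0 : Fin N → ℝ), q.2 + h * 1)) 0 := by
        have hc : Tendsto (fun h : ℝ => q.2 + h * 1) (𝓝 0) (𝓝 q.2) := by
          have : Continuous fun h : ℝ => q.2 + h * 1 := by fun_prop
          simpa using this.tendsto 0
        filter_upwards [hc.eventually (Icc_mem_nhds hq0 hqΛ)] with h hh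
        have := hqmin (q.1 + h • (0 : Fin N → ℝ), q.2 + h * 1) (by simpa using hq) hh
        simpa using this
      have := hloc.hasDerivAt_eq_zero hd
      linarith
    exact ⟨q.1, q.2, hq, hqK.1, Or.inr hlt, fun h => absurd h (not_lt.2 hlt.le), hbal,
      hpow.trans (min_eq_left hlt.le).symm⟩

end Multipliers

/-! ### The allocation of the rules, duality and time averages. -/

section Assembly

variable {N : ℕ} {μ lam x : Fin N → ℝ} {η' Pmax lam0 : ℝ} {ν : Measure (Fin N → ℝ)}

lemma selection_eq_ruleMode (hs : IsSystem μ η' Pmax) (hlam : ∀ n, 0 < lam n)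
    (htie : NoTie μ lam x) {S : Finset (Fin N)} (hS : x ∈ region μ lam S) :
    selection μ η' Pmax lam lam0 x (activePower μ lam S x) = ruleMode μ η' Pmax lam lam0 x := by
  rw [← rulePower_eq hs.pos hs.anti hlam htie hS, selection_eq hs.eta_pos]
  split_ifs with h
  · exact (ruleMode_eq_zero h).symm
  · exact (ruleMode_eq_one (not_le.1 h)).symm

/-- Downlink is chosen only if its value exceeds the nonnegative uplink value. Its positive part is
then nonzero, so the power threshold is met and the base station uses full power. -/
lemma bsPower_ruleMode (hs : IsSystem μ η' Pmax) (hx : ∀ n, 0 < x n) (hlam : ∀ n, 0 < lam n)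
    (htie : NoTie μ lam x) :
    bsPower η' Pmax lam lam0 x (ruleMode μ η' Pmax lam lam0 x)
      = Pmax * ruleMode μ η' Pmax lam lam0 x := by
  by_cases h : uplinkGain μ lam x (rulePower μ lam x) < downlinkGain η' Pmax lam lam0 x
  · have hA : ruleMode μ η' Pmax lam lam0 x = 1 := ruleMode_eq_one h
    have h0 := (isKKT_rulePower hs.pos hs.anti hx hlam htie).uplinkGain_le hs.pos hs.anti hx
      (R := 0) fun _ => le_rfl
    rw [uplinkGain_zero] at h0
    have hpos := h0.trans_lt h
    rw [hA, mul_one, bsPower, if_pos]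
    refine ⟨?_, rfl⟩
    rw [div_le_iff₀ hs.eta_pos]
    by_contra hcon
    rw [downlinkGain, max_eq_left (by linarith), mul_zero] at hpos
    exact lt_irrefl 0 hpos
  · have hA : ruleMode μ η' Pmax lam lam0 x = 0 := ruleMode_eq_zero (not_lt.1 h)
    rw [hA, mul_zero, bsPower, if_neg fun h => zero_ne_one h.2]

/-- The action of the rules in a slot without ties. -/
def ruleAction (μ : Fin N → ℝ) (η' Pmax : ℝ) (lam : Fin N → ℝ) (lam0 : ℝ) (x : Fin N → ℝ) :
    ℝ × ℝ × (Fin N → ℝ) :=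
  (ruleMode μ η' Pmax lam lam0 x, Pmax * ruleMode μ η' Pmax lam lam0 x,
    fun n => (1 - ruleMode μ η' Pmax lam lam0 x) * rulePower μ lam x n)

lemma ruleAction_eq (hs : IsSystem μ η' Pmax) (hlam : ∀ n, 0 < lam n)
    (htie : NoTie μ lam x) {S : Finset (Fin N)} (hS : x ∈ region μ lam S) :
    ruleAction μ η' Pmax lam lam0 x
      = (selection μ η' Pmax lam lam0 x (activePower μ lam S x),
        bsPower η' Pmax lam lam0 x (selection μ η' Pmax lam lam0 x (activePower μ lam S x)),
        fun n => (1 - selection μ η' Pmax lam lam0 x (activePower μ lam S x))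
          * activePower μ lam S x n) := by
  rw [selection_eq_ruleMode hs hlam htie hS, bsPower_ruleMode hs hS.1 hlam htie,
    ← rulePower_eq hs.pos hs.anti hlam htie hS]
  rfl

lemma ruleAction_mem (hs : IsSystem μ η' Pmax) (hx : ∀ n, 0 < x n) (hlam : ∀ n, 0 < lam n)
    (htie : NoTie μ lam x) : ruleAction μ η' Pmax lam lam0 x ∈ SlotActions N Pmax := by
  obtain ⟨S, hS⟩ := exists_mem_region hs.pos hs.anti hx hlam
  rw [ruleAction_eq hs hlam htie hS]
  exact rule_mem_slotActions hs.power_pos.le (activePower_nonneg hS)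

lemma slotLagrangian_ruleAction_eq (hs : IsSystem μ η' Pmax) (hx : ∀ n, 0 < x n)
    (hlam : ∀ n, 0 < lam n) (htie : NoTie μ lam x) :
    slotLagrangian μ η' lam lam0 x (ruleAction μ η' Pmax lam lam0 x)
      = slotValue μ η' Pmax lam lam0 x := by
  obtain ⟨S, hS⟩ := exists_mem_region hs.pos hs.anti hx hlam
  rw [ruleAction_eq hs hlam htie hS, slotLagrangian_rule hs.eta_pos hx (activePower_nonneg hS),
    slotValue, uplinkValue, optPower_eq_rulePower hs.pos hs.anti hx hlam htie,
    rulePower_eq hs.pos hs.anti hlam htie hS]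

/-- The weighted rate of the rules in a slot. -/
def ruleRate (μ : Fin N → ℝ) (η' Pmax : ℝ) (lam : Fin N → ℝ) (lam0 : ℝ) (x : Fin N → ℝ) : ℝ :=
  slotObjective μ x (ruleAction μ η' Pmax lam lam0 x).1 (ruleAction μ η' Pmax lam lam0 x).2.2

/-- The mode is `0` or `1`, so its repeated factors collapse. The prices `lam'` need not be those of
the rules, as weak duality requires. -/
lemma slotLagrangian_ruleAction (lam' : Fin N → ℝ) (lam0' : ℝ) (x : Fin N → ℝ) :
    slotLagrangian μ η' lam' lam0' x (ruleAction μ η' Pmax lam lam0 x)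
      = ruleRate μ η' Pmax lam lam0 x
        - ∑ n, lam' n * ((1 - ruleMode μ η' Pmax lam lam0 x) * rulePower μ lam x n
          - η' * Pmax * (ruleMode μ η' Pmax lam lam0 x * x n))
        - lam0' * (Pmax * ruleMode μ η' Pmax lam lam0 x) := by
  have hA := ruleMode_eq_zero_or_one μ η' Pmax lam lam0 x
  rw [slotLagrangian, ruleRate, ruleAction]
  simp only
  generalize ruleMode μ η' Pmax lam lam0 x = A at hA
  rcases hA with rfl | rfl
  · simp
  · simp

lemma measurable_ruleRate (μ : Fin N → ℝ) (η' Pmax : ℝ) (lam : Fin N → ℝ) (lam0 : ℝ) :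
    Measurable (ruleRate μ η' Pmax lam lam0) := by
  have h1 := measurable_ruleMode μ η' Pmax lam lam0
  have h2 := measurable_rulePower μ lam
  unfold ruleRate ruleAction slotObjective slotRate
  simp only [Real.logb]
  fun_prop

lemma integrable_ruleTerm (hs : IsSystem μ η' Pmax) (hν : IsGainLaw ν) (hlam : ∀ n, 0 < lam n)
    (lam0 : ℝ) (lam' : Fin N → ℝ) (n : Fin N) : Integrable (fun x =>
      lam' n * ((1 - ruleMode μ η' Pmax lam lam0 x) * rulePower μ lam x n
        - η' * Pmax * (ruleMode μ η' Pmax lam lam0 x * x n))) ν :=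
  ((integrable_uplinkPower hs hν hlam lam0 n).sub
    ((integrable_ruleMode_mul (hν.integrable n)).const_mul _)).const_mul _

/-- Off the ties the rate is the slot value plus the price terms, and each of these is integrable.
-/
lemma integrable_ruleRate (hs : IsSystem μ η' Pmax) (hν : IsGainLaw ν) (hlam : ∀ n, 0 < lam n)
    (lam0 : ℝ) : Integrable (ruleRate μ η' Pmax lam lam0) ν := by
  have := hν.prob
  have h : Integrable (fun x => slotValue μ η' Pmax lam lam0 x
      + ∑ n, lam n * ((1 - ruleMode μ η' Pmax lam lam0 x) * rulePower μ lam x n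
          - η' * Pmax * (ruleMode μ η' Pmax lam lam0 x * x n))
      + lam0 * (Pmax * ruleMode μ η' Pmax lam lam0 x)) ν :=
    ((integrable_slotValue hs hν hlam lam0).add
      (integrable_finsetSum _ fun n _ => integrable_ruleTerm hs hν hlam lam0 lam n)).add
      (((integrable_ruleMode μ η' Pmax lam lam0).const_mul _).const_mul _)
  refine h.congr ?_
  filter_upwards [hν.pos, ae_noTie (μ := μ) hν.cont hν.pos hlam] with x hx htie
  rw [← slotLagrangian_ruleAction_eq hs hx hlam htie, slotLagrangian_ruleAction]
  ring

lemma integrable_slotLagrangian_ruleAction (hs : IsSystem μ η' Pmax) (hν : IsGainLaw ν)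
    (hlam : ∀ n, 0 < lam n) (lam0 : ℝ) (lam' : Fin N → ℝ) (lam0' : ℝ) :
    Integrable (fun x => slotLagrangian μ η' lam' lam0' x (ruleAction μ η' Pmax lam lam0 x)) ν := by
  have := hν.prob
  simp only [slotLagrangian_ruleAction]
  exact ((integrable_ruleRate hs hν hlam lam0).sub
    (integrable_finsetSum _ fun n _ => integrable_ruleTerm hs hν hlam lam0 lam' n)).sub
    (((integrable_ruleMode μ η' Pmax lam lam0).const_mul _).const_mul _)

/-- Under energy balance the mean Lagrangian of the rules does not depend on the prices. -/
lemma integral_slotLagrangian_ruleAction (hs : IsSystem μ η' Pmax) (hν : IsGainLaw ν)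
    (hlam : ∀ n, 0 < lam n)
    (hbal : ∀ n, ∫ x, (1 - ruleMode μ η' Pmax lam lam0 x) * rulePower μ lam x n ∂ν
      = ∫ x, η' * Pmax * (ruleMode μ η' Pmax lam lam0 x * x n) ∂ν)
    (lam' : Fin N → ℝ) (lam0' : ℝ) :
    ∫ x, slotLagrangian μ η' lam' lam0' x (ruleAction μ η' Pmax lam lam0 x) ∂ν
      = ∫ x, ruleRate μ η' Pmax lam lam0 x ∂ν
        - lam0' * (Pmax * ∫ x, ruleMode μ η' Pmax lam lam0 x ∂ν) := by
  have := hν.prob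
  have hT := fun n => integrable_ruleTerm hs hν hlam lam0 lam' n
  have hR := integrable_ruleRate hs hν hlam lam0
  have hz : ∀ n, ∫ x, lam' n * ((1 - ruleMode μ η' Pmax lam lam0 x) * rulePower μ lam x n
        - η' * Pmax * (ruleMode μ η' Pmax lam lam0 x * x n)) ∂ν = 0 := by
    intro n
    rw [integral_const_mul, integral_sub (integrable_uplinkPower hs hν hlam lam0 n)
      ((integrable_ruleMode_mul (hν.integrable n)).const_mul _), hbal n, sub_self, mul_zero]
  simp only [slotLagrangian_ruleAction]
  have hS : Integrable (fun x => ∑ n, lam' n * ((1 - ruleMode μ η' Pmax lam lam0 x)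
      * rulePower μ lam x n - η' * Pmax * (ruleMode μ η' Pmax lam lam0 x * x n))) ν :=
    integrable_finsetSum _ fun n _ => hT n
  have hRS : Integrable (fun x => ruleRate μ η' Pmax lam lam0 x
      - ∑ n, lam' n * ((1 - ruleMode μ η' Pmax lam lam0 x) * rulePower μ lam x n
        - η' * Pmax * (ruleMode μ η' Pmax lam lam0 x * x n))) ν := hR.sub hS
  rw [integral_sub hRS (((integrable_ruleMode μ η' Pmax lam lam0).const_mul _).const_mul _),
    integral_sub hR hS, integral_finsetSum _ fun n _ => hT n, integral_const_mul, integral_const_mul]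
  simp [hz]

/-- Truncation at `0` only increases the integral. This is needed because at foreign prices the
Lagrangian of the rules can be negative. -/
lemma ofReal_integral_le_lintegral {f : (Fin N → ℝ) → ℝ} (hf : Integrable f ν) :
    ENNReal.ofReal (∫ x, f x ∂ν) ≤ ∫⁻ x, ENNReal.ofReal (f x) ∂ν := by
  have h1 : ∫ x, f x ∂ν ≤ ∫ x, max (f x) 0 ∂ν :=
    integral_mono hf hf.pos_part fun x => le_max_left _ _
  refine (ENNReal.ofReal_le_ofReal h1).trans_eq ?_
  rw [ofReal_integral_eq_lintegral_ofReal hf.pos_part (Eventually.of_forall fun x => le_max_right _ _)]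
  refine lintegral_congr fun x => ?_
  rcases le_total (f x) 0 with h | h
  · rw [max_eq_right h, ENNReal.ofReal_zero, ENNReal.ofReal_of_nonpos h]
  · rw [max_eq_left h]

/-- Weak duality. -/
lemma ofReal_integral_ruleRate_le_dualValue (hs : IsSystem μ η' Pmax) (hν : IsGainLaw ν)
    (hlam : ∀ n, 0 < lam n)
    (hbal : ∀ n, ∫ x, (1 - ruleMode μ η' Pmax lam lam0 x) * rulePower μ lam x n ∂ν
      = ∫ x, η' * Pmax * (ruleMode μ η' Pmax lam lam0 x * x n) ∂ν)
    {Pavg : ℝ} (hle : Pmax * ∫ x, ruleMode μ η' Pmax lam lam0 x ∂ν ≤ Pavg)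
    (lam' : Fin N → ℝ) {lam0' : ℝ} (hlam0' : 0 ≤ lam0') :
    ENNReal.ofReal (∫ x, ruleRate μ η' Pmax lam lam0 x ∂ν)
      ≤ dualValue μ η' Pmax Pavg ν lam' lam0' := by
  have h1 := integral_slotLagrangian_ruleAction hs hν hlam hbal lam' lam0'
  -- The user prices have dropped out by energy balance, whatever their signs; the power constraint
  -- and `lam0' ≥ 0` take care of the remaining term.
  have h2 : ∫ x, ruleRate μ η' Pmax lam lam0 x ∂ν
      ≤ ∫ x, slotLagrangian μ η' lam' lam0' x (ruleAction μ η' Pmax lam lam0 x) ∂ν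
        + lam0' * Pavg := by
    have := mul_le_mul_of_nonneg_left hle hlam0'
    linarith
  refine (ENNReal.ofReal_le_ofReal h2).trans (ENNReal.ofReal_add_le.trans ?_)
  refine add_le_add ((ofReal_integral_le_lintegral
    (integrable_slotLagrangian_ruleAction hs hν hlam lam0 lam' lam0')).trans ?_) le_rfl
  refine lintegral_mono_ae ?_
  filter_upwards [hν.pos, ae_noTie (μ := μ) hν.cont hν.pos hlam] with x hx htie
  exact le_iSup₂ (f := fun u (_ : u ∈ SlotActions N Pmax) =>
    ENNReal.ofReal (slotLagrangian μ η' lam' lam0' x u)) _ (ruleAction_mem hs hx hlam htie)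

/-- Strong duality. -/
lemma dualValue_eq (hs : IsSystem μ η' Pmax) (hν : IsGainLaw ν) (hlam : ∀ n, 0 < lam n)
    (hlam0 : 0 ≤ lam0)
    (hbal : ∀ n, ∫ x, (1 - ruleMode μ η' Pmax lam lam0 x) * rulePower μ lam x n ∂ν
      = ∫ x, η' * Pmax * (ruleMode μ η' Pmax lam lam0 x * x n) ∂ν)
    {Pavg : ℝ} (hPavg : 0 ≤ Pavg)
    (hslack : lam0 * (Pmax * ∫ x, ruleMode μ η' Pmax lam lam0 x ∂ν) = lam0 * Pavg) :
    dualValue μ η' Pmax Pavg ν lam lam0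
      = ENNReal.ofReal (∫ x, ruleRate μ η' Pmax lam lam0 x ∂ν) := by
  have h1 := integral_slotLagrangian_ruleAction hs hν hlam hbal lam lam0
  have hae : ∀ᵐ x ∂ν, slotLagrangian μ η' lam lam0 x (ruleAction μ η' Pmax lam lam0 x)
      = slotValue μ η' Pmax lam lam0 x := by
    filter_upwards [hν.pos, ae_noTie (μ := μ) hν.cont hν.pos hlam] with x hx htie
    exact slotLagrangian_ruleAction_eq hs hx hlam htie
  rw [integral_congr_ae hae, hslack] at h1
  have h2 : ∫⁻ x, ⨆ u ∈ SlotActions N Pmax, ENNReal.ofReal (slotLagrangian μ η' lam lam0 x u) ∂ν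
      = ENNReal.ofReal (∫ x, slotValue μ η' Pmax lam lam0 x ∂ν) := by
    rw [ofReal_integral_eq_lintegral_ofReal (integrable_slotValue hs hν hlam lam0)
      (Eventually.of_forall fun x => slotValue_nonneg hs.power_pos.le)]
    refine lintegral_congr_ae ?_
    filter_upwards [hν.pos, ae_noTie (μ := μ) hν.cont hν.pos hlam] with x hx htie
    refine le_antisymm (iSup₂_le fun u hu => ENNReal.ofReal_le_ofReal ?_) ?_
    · exact slotLagrangian_le hs.pos hs.anti hx (isKKT_optPower hs.pos hs.anti hx hlam) hu
    · rw [← slotLagrangian_ruleAction_eq hs hx hlam htie]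
      exact le_iSup₂ (f := fun u (_ : u ∈ SlotActions N Pmax) =>
        ENNReal.ofReal (slotLagrangian μ η' lam lam0 x u)) _ (ruleAction_mem hs hx hlam htie)
  rw [dualValue, h2, ← ENNReal.ofReal_add (integral_nonneg fun x => slotValue_nonneg hs.power_pos.le)
    (mul_nonneg hlam0 hPavg), h1, sub_add_cancel]

/-- The allocation of the rules on a path without ties. -/
def ruleAlloc (μ : Fin N → ℝ) (η' Pmax : ℝ) (lam : Fin N → ℝ) (lam0 : ℝ) (x : ℕ → Fin N → ℝ) :
    Alloc N where
  a i := (ruleAction μ η' Pmax lam lam0 (x i)).1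
  P0 i := (ruleAction μ η' Pmax lam lam0 (x i)).2.1
  Pd i := (ruleAction μ η' Pmax lam lam0 (x i)).2.2

/-- Without ties every slot lies in one region only, which leaves the rules no freedom, whichever
witness `S` is taken. -/
lemma followsRule_iff (hs : IsSystem μ η' Pmax) (hlam : ∀ n, 0 < lam n) {x : ℕ → Fin N → ℝ}
    (hx : ∀ i n, 0 < x i n) (htie : ∀ i, NoTie μ lam (x i)) (A : Alloc N) :
    FollowsRule μ η' Pmax lam lam0 x A ↔ A = ruleAlloc μ η' Pmax lam lam0 x := by
  constructor
  · intro hA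
    obtain ⟨a, P0, Pd⟩ := A
    have h : ∀ i, (a i, P0 i, Pd i) = ruleAction μ η' Pmax lam lam0 (x i) := by
      intro i
      obtain ⟨S, hS, h1, h2, h3⟩ := hA i
      simp only at h1 h2 h3
      rw [ruleAction_eq hs hlam (htie i) hS, ← h1, ← h2]
      congr 2
      exact funext h3
    simp only [ruleAlloc, ← h]
  · rintro rfl i
    obtain ⟨S, hS⟩ := exists_mem_region hs.pos hs.anti (hx i) hlam
    refine ⟨S, hS, ?_⟩
    simp only [ruleAlloc, ruleAction_eq hs hlam (htie i) hS]
    exact ⟨trivial, trivial, fun _ => trivial⟩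

lemma isGainLaw_map {Ω : Type*} [MeasurableSpace Ω] {ℙ : Measure Ω} [IsProbabilityMeasure ℙ]
    {X : Ω → Fin N → ℝ} (hX : Measurable X) (hpos : ∀ᵐ ω ∂ℙ, ∀ n, 0 < X ω n)
    (hint : ∀ n, Integrable (fun ω => X ω n) ℙ) (hc : IsContinuousLaw (ℙ.map X)) :
    IsGainLaw (ℙ.map X) where
  prob := Measure.isProbabilityMeasure_map hX.aemeasurable
  cont := hc
  pos := (ae_map_iff hX.aemeasurable measurableSet_pos).2 hpos
  integrable n := (integrable_map_measure (measurable_pi_apply n).aestronglyMeasurable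
    hX.aemeasurable).2 (hint n)

/-- Performance of the rules under stationary ergodic fading. -/
theorem ae_ruleAlloc {Ω : Type*} [MeasurableSpace Ω] {ℙ : Measure Ω} [IsProbabilityMeasure ℙ]
    {x : ℕ → Ω → Fin N → ℝ} (hx : IsStationaryErgodic ℙ x) (hs : IsSystem μ η' Pmax)
    (hν : IsGainLaw (ℙ.map (x 0))) (hlam : ∀ n, 0 < lam n) (lam0 : ℝ) :
    ∀ᵐ ω ∂ℙ,
      (∀ n, Tendsto (avg fun i => (1 - (ruleAlloc μ η' Pmax lam lam0 fun i => x i ω).a i)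
          * (ruleAlloc μ η' Pmax lam lam0 fun i => x i ω).Pd i n) atTop
          (𝓝 (∫ y, (1 - ruleMode μ η' Pmax lam lam0 y) * rulePower μ lam y n ∂(ℙ.map (x 0))))) ∧
      (∀ n, Tendsto (avg fun i => η' * (ruleAlloc μ η' Pmax lam lam0 fun i => x i ω).a i
          * (ruleAlloc μ η' Pmax lam lam0 fun i => x i ω).P0 i * x i ω n) atTop
          (𝓝 (∫ y, η' * Pmax * (ruleMode μ η' Pmax lam lam0 y * y n) ∂(ℙ.map (x 0))))) ∧
      Tendsto (avg fun i => (ruleAlloc μ η' Pmax lam lam0 fun i => x i ω).a i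
          * (ruleAlloc μ η' Pmax lam lam0 fun i => x i ω).P0 i) atTop
          (𝓝 (Pmax * ∫ y, ruleMode μ η' Pmax lam lam0 y ∂(ℙ.map (x 0)))) ∧
      Tendsto (avgObjective μ (fun i => x i ω) (ruleAlloc μ η' Pmax lam lam0 fun i => x i ω)) atTop
          (𝓝 (∫ y, ruleRate μ η' Pmax lam lam0 y ∂(ℙ.map (x 0)))) := by
  have := hν.prob
  have hA := ruleMode_eq_zero_or_one μ η' Pmax lam lam0
  have hm := measurable_ruleMode μ η' Pmax lam lam0
  have hp := measurable_rulePower μ lam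
  have h1 := ae_all_iff.2 fun n => hx.ae_tendsto_avg
    (f := fun y => (1 - ruleMode μ η' Pmax lam lam0 y) * rulePower μ lam y n) (by fun_prop)
    (integrable_uplinkPower hs hν hlam lam0 n)
  have h2 := ae_all_iff.2 fun n => hx.ae_tendsto_avg
    (f := fun y => η' * Pmax * (ruleMode μ η' Pmax lam lam0 y * y n)) (by fun_prop)
    ((integrable_ruleMode_mul (hν.integrable n)).const_mul _)
  have h3 := hx.ae_tendsto_avg (f := fun y => Pmax * ruleMode μ η' Pmax lam lam0 y) (by fun_prop)
    ((integrable_ruleMode μ η' Pmax lam lam0).const_mul _)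
  rw [integral_const_mul] at h3
  have h4 := hx.ae_tendsto_avg (measurable_ruleRate μ η' Pmax lam lam0)
    (integrable_ruleRate hs hν hlam lam0)
  filter_upwards [h1, h2, h3, h4] with ω w1 w2 w3 w4
  refine ⟨fun n => ?_, fun n => ?_, ?_, w4⟩
  · refine (w1 n).congr fun M => ?_
    congr 1
    funext i
    simp only [ruleAlloc, ruleAction]
    rcases hA (x i ω) with h | h <;> simp [h]
  · refine (w2 n).congr fun M => ?_
    congr 1
    funext i
    simp only [ruleAlloc, ruleAction]
    rcases hA (x i ω) with h | h <;> simp [h]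
  · refine w3.congr fun M => ?_
    congr 1
    funext i
    simp only [ruleAlloc, ruleAction]
    rcases hA (x i ω) with h | h <;> simp [h]

lemma isFeasible_of_tendsto {A : Alloc N} {x : ℕ → Fin N → ℝ} {Pavg m : ℝ} {B : Fin N → ℝ}
    (hmem : ∀ i, (A.a i, A.P0 i, A.Pd i) ∈ SlotActions N Pmax)
    (h1 : ∀ n, Tendsto (avg fun i => (1 - A.a i) * A.Pd i n) atTop (𝓝 (B n)))
    (h2 : ∀ n, Tendsto (avg fun i => η' * A.a i * A.P0 i * x i n) atTop (𝓝 (B n)))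
    (h3 : Tendsto (avg fun i => A.a i * A.P0 i) atTop (𝓝 m)) (hm : m ≤ Pavg) :
    IsFeasible η' Pmax Pavg x A := by
  refine ⟨fun i => (hmem i).1, fun i => (hmem i).2.1, fun i => (hmem i).2.2, fun n => ?_,
    fun δ hδ => ?_⟩
  · simpa using (h1 n).sub (h2 n)
  · exact (h3.eventually_lt_const (by linarith : m < Pavg + δ)).mono fun M hM => hM.le

end Assembly

end WPT

end

/-! ### The main theorem. -/

theorem theorem1 {N : ℕ} (μ : Fin N → ℝ) (hμpos : ∀ n, 0 < μ n) (hμanti : Antitone μ)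
    (hμsum : ∑ n, μ n = 1) (η N₀ ε Pmax : ℝ) (hη : 0 < η) (hη1 : η < 1) (hN₀ : 0 < N₀)
    (hε : 1 < ε) (hPmax : 0 < Pmax) :
    -- The activity regions cover all gain vectors, and they are disjoint off the ties.
    (∀ lam : Fin N → ℝ, (∀ n, 0 < lam n) → ∀ x : Fin N → ℝ, (∀ n, 0 < x n) →
      (∃ S, x ∈ WPT.region μ lam S) ∧
      ((∀ m n, m ≠ n → μ m = μ n → lam m / x m ≠ lam n / x n) →
        ∃! S, x ∈ WPT.region μ lam S)) ∧
    -- Multipliers that satisfy the constraints give an optimal allocation, on every fading path.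
    (∀ x : ℕ → Fin N → ℝ, (∀ i n, 0 < x i n) →
      ∀ Pavg : ℝ, 0 < Pavg →
      ∀ (lam : Fin N → ℝ) (lam0 : ℝ), (∀ n, 0 < lam n) → 0 ≤ lam0 →
      ∀ A : WPT.Alloc N,
        WPT.FollowsRule μ (WPT.etaPrime η N₀ ε) Pmax lam lam0 x A →
        WPT.IsFeasible (WPT.etaPrime η N₀ ε) Pmax Pavg x A →
        (lam0 = 0 ∨ Tendsto (WPT.avg (fun i => A.a i * A.P0 i)) atTop (𝓝 Pavg)) →
        WPT.IsOptimal μ (WPT.etaPrime η N₀ ε) Pmax Pavg x A) ∧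
    -- For stationary ergodic fading such multipliers exist, and there is no duality gap.
    (∀ {Ω : Type*} [MeasurableSpace Ω] (ℙ : Measure Ω) [IsProbabilityMeasure ℙ]
      (x : ℕ → Ω → Fin N → ℝ),
      WPT.IsStationaryErgodic ℙ x →
      (∀ i, ∀ᵐ ω ∂ℙ, ∀ n, 0 < x i ω n) →
      (∀ n, Integrable (fun ω => x 0 ω n) ℙ) →
      WPT.IsContinuousLaw (ℙ.map (x 0)) →
      ∃ Pcrit : ℝ, 0 < Pcrit ∧ Pcrit < Pmax ∧
      ∀ Pavg : ℝ, 0 < Pavg →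
      ∃ (lam : Fin N → ℝ) (lam0 V : ℝ) (B : Fin N → ℝ),
        (∀ n, 0 < lam n) ∧ 0 ≤ lam0 ∧ (Pcrit < Pavg → lam0 = 0) ∧
        (∀ᵐ ω ∂ℙ,
          (∀ i, ∃! S, x i ω ∈ WPT.region μ lam S) ∧
          (∃! A : WPT.Alloc N,
            WPT.FollowsRule μ (WPT.etaPrime η N₀ ε) Pmax lam lam0 (fun i => x i ω) A) ∧
          ∀ A : WPT.Alloc N,
            WPT.FollowsRule μ (WPT.etaPrime η N₀ ε) Pmax lam lam0 (fun i => x i ω) A →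
            (∀ n, Tendsto (WPT.avg (fun i => (1 - A.a i) * A.Pd i n)) atTop (𝓝 (B n)) ∧
              Tendsto (WPT.avg (fun i => WPT.etaPrime η N₀ ε * A.a i * A.P0 i * x i ω n))
                atTop (𝓝 (B n))) ∧
            Tendsto (WPT.avg (fun i => A.a i * A.P0 i)) atTop (𝓝 (min Pavg Pcrit)) ∧
            Tendsto (WPT.avgObjective μ (fun i => x i ω) A) atTop (𝓝 V) ∧
            WPT.IsOptimal μ (WPT.etaPrime η N₀ ε) Pmax Pavg (fun i => x i ω) A) ∧
        WPT.dualValue μ (WPT.etaPrime η N₀ ε) Pmax Pavg (ℙ.map (x 0)) lam lam0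
          = ENNReal.ofReal V ∧
        ∀ (lam' : Fin N → ℝ) (lam0' : ℝ), 0 ≤ lam0' →
          ENNReal.ofReal V
            ≤ WPT.dualValue μ (WPT.etaPrime η N₀ ε) Pmax Pavg (ℙ.map (x 0)) lam' lam0') := by
  have hN : 0 < N := by
    rcases Nat.eq_zero_or_pos N with rfl | h
    · simp at hμsum
    · exact h
  have hη' : 0 < WPT.etaPrime η N₀ ε := div_pos (mul_pos hη hN₀) (one_pos.trans hε)
  refine ⟨fun lam hlam x hx => ⟨WPT.exists_mem_region hμpos hμanti hx hlam,
    fun htie => WPT.existsUnique_mem_region hμpos hμanti hx hlam htie⟩,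
    fun x hx Pavg _ lam lam0 hlam hlam0 A hA hfeas hC3 =>
      WPT.isOptimal_of_followsRule hμpos hμanti hη' hx hlam hlam0 hA hfeas hC3, ?_⟩
  intro Ω _ ℙ _ x hx hpos hint hc
  have hs : WPT.IsSystem μ (WPT.etaPrime η N₀ ε) Pmax := ⟨hμpos, hμanti, hN, hη', hPmax⟩
  have hν := WPT.isGainLaw_map (hx.1 0) (hpos 0) hint hc
  obtain ⟨Pcrit, hPcrit0, hPcrit1, hmult⟩ := WPT.exists_multipliers hs hν
  refine ⟨Pcrit, hPcrit0, hPcrit1, fun Pavg hPavg => ?_⟩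
  obtain ⟨lam, lam0, hlam, hlam0, hor, hzero, hbal, hpow⟩ := hmult Pavg hPavg
  -- Complementary slackness, used both for optimality on the path and for the zero duality gap.
  have hC3 : lam0 = 0 ∨ min Pavg Pcrit = Pavg := hor.imp_right fun h => min_eq_left h.le
  refine ⟨lam, lam0, ∫ y, WPT.ruleRate μ (WPT.etaPrime η N₀ ε) Pmax lam lam0 y ∂(ℙ.map (x 0)),
    fun n => ∫ y, (1 - WPT.ruleMode μ (WPT.etaPrime η N₀ ε) Pmax lam lam0 y)
      * WPT.rulePower μ lam y n ∂(ℙ.map (x 0)), hlam, hlam0, hzero, ?_, ?_, ?_⟩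
  -- The law is assumed continuous in slot `0` only; stationarity gives it in every slot, and a
  -- countable union of null sets is null.
  · have htie : ∀ᵐ ω ∂ℙ, ∀ i, WPT.NoTie μ lam (x i ω) := ae_all_iff.2 fun i => by
      have h := WPT.ae_noTie (μ := μ) hc hν.pos hlam
      rw [← hx.map_eq i] at h
      exact ae_of_ae_map (hx.1 i).aemeasurable h
    filter_upwards [htie, ae_all_iff.2 hpos, WPT.ae_ruleAlloc hx hs hν hlam lam0]
      with ω hω hωpos ⟨h1, h2, h3, h4⟩
    have hiff := WPT.followsRule_iff (lam0 := lam0) hs hlam hωpos hω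
    refine ⟨fun i => WPT.existsUnique_mem_region hμpos hμanti (hωpos i) hlam (hω i),
      ⟨_, (hiff _).2 rfl, fun A hA => (hiff A).1 hA⟩, fun A hA => ?_⟩
    have hA' := hA
    rw [hiff] at hA
    subst hA
    simp_rw [← hbal] at h2
    rw [hpow] at h3
    refine ⟨fun n => ⟨h1 n, h2 n⟩, h3, h4, ?_⟩
    refine WPT.isOptimal_of_followsRule hμpos hμanti hη' hωpos hlam hlam0 hA'
      (WPT.isFeasible_of_tendsto (fun i => WPT.ruleAction_mem hs (hωpos i) hlam (hω i))
        h1 h2 h3 (min_le_left _ _)) (hC3.imp_right fun h => ?_)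
    rwa [h] at h3
  · refine WPT.dualValue_eq hs hν hlam hlam0 hbal hPavg.le ?_
    rw [hpow]
    rcases hC3 with h | h
    · rw [h, zero_mul, zero_mul]
    · rw [h]
  · exact fun lam' lam0' hlam0' => WPT.ofReal_integral_ruleRate_le_dualValue hs hν hlam hbal
      (hpow.trans_le (min_le_left _ _)) lam' hlam0'
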